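/- Let $K=\mathbb{C}(q)$, $\xi=q-q^{-1}$, and let $r,s,n$ be positive integers (the values $0$ are also allowed). Put $I_{N|N}=\{-N,\dots,-1,1,\dots,N\}$ with parity $|i|=\bar0$ for $i>0$ and $|i|=\bar1$ for $i<0$; the matrix unit $E_{ij}$ has parity $|i|+|j|$, all tensor products carry the usual rule of signs, $X^{1},X^{2},X^{12},\dots$ denote the tensor legs in which the matrix units of $X$ are placed, and an index in brackets is the position of the algebra factor. Set $\varphi(i,j)=(-1)^{|j|}(\delta_{i,j}+\delta_{i,-j})$ and $$S=\sum_{i,j}q^{\varphi(i,j)}E_{ii}\otimes E_{jj}+\xi\sum_{i<j}(-1)^{|i|}(E_{ji}+E_{-j,-i})\otimes E_{ij},\quad S^{-1}=\sum_{i,j}q^{-\varphi(i,j)}E_{ii}\otimes E_{jj}-\xi\sum_{i<j}(-1)^{|i|}(E_{ji}+E_{-j,-i})\otimes E_{ij}.$$ * $\mathrm{U}_q(\mathfrak{q}_N)$ is the superalgebra over $K$ generated by $L_{ij}$ ($i\le j$ in $I_{N|N}$) of parity $|i|+|j|$, with relations $L_{ii}L_{-i,-i}=1=L_{-i,-i}L_{ii}$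 and $L^{[1]2}L^{[1]3}S^{23}=S^{23}L^{[1]3}L^{[1]2}$, where $L=\sum_{i\le j}L_{ij}\otimes E_{ij}$; its comultiplication and counit are $\Delta(L_{ij})=\sum_k(-1)^{(|i|+|k|)(|k|+|j|)}L_{ik}\otimes L_{kj}$ and $\varepsilon(L_{ij})=\delta_{ij}$. $\mathrm{U}_q(\mathfrak{q}_N)^{\mathrm{cop}}$ is the same superalgebra with the super-opposite comultiplication. * $\mathsf{A}_{r,n}$ is the superalgebra generated by $t_{ia}$ ($i\in I_{r|r}$, $a\in I_{n|n}$) of parity $|i|+|a|$, with relations $t_{ia}=t_{-i,-a}$ and $S^{12}T^{1[3]}T^{2[3]}=T^{2[3]}T^{1[3]}S^{12}$, where $T=\sum E_{ia}\otimes t_{ia}$; put $T_+=\sum_{i>0}E_{ia}\otimes t_{ia}$. * $\bar{\mathsf{A}}_{s,n}$ is the superalgebra generated by $\bar t_{\alpha b}$ ($\alpha\in I_{s|s}$, $b\in I_{n|n}$) of parity $|\alpha|+|b|$, with relations $\bar t_{\alpha b}=(-1)^{|\alpha|+|b|}\bar t_{-\alpha,-b}$ and $\bar T^{1[3]}\bar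 T^{2[3]}S^{12}=S^{12}\bar T^{2[3]}\bar T^{1[3]}$, where $\bar T=\sum(-1)^{|b|(|\alpha|+|b|)}E_{b\alpha}\otimes\bar t_{\alpha b}$. A superalgebra $\mathsf A$ with a supermodule structure $\rho$ over a superalgebra $U$ with comultiplication and counit is a $U$-supermodule superalgebra if $\rho_u(1)=\varepsilon(u)1$ and $\rho_u(xy)=\sum(-1)^{|x||u_{(2)}|}\rho_{u_{(1)}}(x)\rho_{u_{(2)}}(y)$. Let $\epsilon\in\{1,-1\}$, $D=\sum_{\alpha\in I_{s|s}}q^{2(-1)^{|\alpha|}\alpha}E_{\alpha\alpha}$ and $\tilde S=(1\otimes D^{\epsilon})S(1\otimes D^{-\epsilon})$. Then: (0) There are unique actions $\Phi$ of $\mathrm{U}_q(\mathfrak{q}_n)$ on $\mathsf{A}_{r,n}$ and on $\bar{\mathsf{A}}_{s,n}$ making them $\mathrm{U}_q(\mathfrak{q}_n)$-supermodule superalgebras with $L^{[2]3}\underset{\Phi}{\cdot}T^{1[2]}=T^{1[2]}S^{13}$ and $L^{[2]3}\underset{\Phi}{\cdot}\bar T^{1[2]}=(S^{-1})^{13}\bar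 T^{1[2]}$, and a unique action $\bar\Psi$ of $\mathrm{U}_q(\mathfrak{q}_s)$ on $\bar{\mathsf{A}}_{s,n}$ making it a $\mathrm{U}_q(\mathfrak{q}_s)^{\mathrm{cop}}$-supermodule superalgebra with $L^{[2]3}\underset{\bar\Psi}{\cdot}\bar T^{1[2]}=\bar T^{1[2]}\tilde S^{13}$. There is a unique $K$-linear map $\Upsilon:\bar{\mathsf{A}}_{s,n}\otimes\mathsf{A}_{r,n}\to\mathsf{A}_{r,n}\otimes\bar{\mathsf{A}}_{s,n}$ with $\Upsilon(1\otimes f)=f\otimes1$, $\Upsilon(\bar g\otimes1)=1\otimes\bar g$, $\Upsilon\circ(1\otimes\mathrm{mul})=(\mathrm{mul}\otimes1)(1\otimes\Upsilon)(\Upsilon\otimes1)$, $\Upsilon\circ(\mathrm{mul}\otimes1)=(1\otimes\mathrm{mul})(\Upsilon\otimes1)(1\otimes\Upsilon)$ and $\Upsilon(\bar T^{1[3]}T_+^{2[4]})=T_+^{2[3]}(S^{-1})^{12}\bar T^{1[4]}$. (1) $\Upsilon$ is an (even) homomorphism of $\mathrm{U}_q(\mathfrak{q}_n)$-supermodules,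 where $\mathrm{U}_q(\mathfrak{q}_n)$ acts on both tensor products by $\Phi$ through $\Delta$, i.e. $u\cdot(x\otimes y)=\sum(-1)^{|x||u_{(2)}|}\Phi_{u_{(1)}}(x)\otimes\Phi_{u_{(2)}}(y)$. (2) $\Upsilon$ is an (even) homomorphism of $\mathrm{U}_q(\mathfrak{q}_s)$-supermodules, where $u\cdot(\bar g\otimes f)=\bar\Psi_u(\bar g)\otimes f$ and $u\cdot(f\otimes\bar g)=(-1)^{|f||u|}f\otimes\bar\Psi_u(\bar g)$. (3) Consequently $\mathcal{O}_{r,s}=\mathsf{A}_{r,n}\otimes\bar{\mathsf{A}}_{s,n}$, with the multiplication $(\mathrm{mul}\otimes\mathrm{mul})\circ(\mathrm{id}\otimes\Upsilon\otimes\mathrm{id})$ and unit $1\otimes1$, is an associative superalgebra; it is a $\mathrm{U}_q(\mathfrak{q}_n)$-supermodule superalgebra under the action of (1) and a $\mathrm{U}_q(\mathfrak{q}_s)^{\mathrm{cop}}$-supermodule superalgebra under the action of (2). -/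

import Mathlib

open scoped TensorProduct DirectSum

noncomputable section

namespace QueerBraid

/-! ### Base field, signed indices, parities -/

/-- The base field `ℂ(q)`. -/
abbrev K : Type := RatFunc ℂ

/-- The indeterminate `q`. -/
def q : K := RatFunc.X

/-- The signed index set `I_{N|N} = {-N, …, -1, 1, …, N}`. -/
abbrev Idx (N : ℕ) : Type := ↥((Finset.Icc (-(N : ℤ)) (N : ℤ)).erase 0)

instance instNegIdx (N : ℕ) : Neg (Idx N) where
  neg i := ⟨-i.1, by
    have h := i.2
    simp only [Finset.mem_erase, Finset.mem_Icc] at h ⊢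
    omega⟩

/-- The parity `|i|`: even for `i > 0`, odd for `i < 0`. -/
def par {N : ℕ} (i : Idx N) : ZMod 2 := if i.1 < 0 then 1 else 0

/-- The sign `(-1)^d` for `d ∈ ℤ/2ℤ`. -/
def sgn (d : ZMod 2) : K := if d = 0 then 1 else -1

theorem sgn_add (a b : ZMod 2) : sgn (a + b) = sgn a * sgn b := by
  have h : ∀ x : ZMod 2, x = 0 ∨ x = 1 := by decide
  have h2 : (1 + 1 : ZMod 2) = 0 := by decide
  rcases h a with rfl | rfl <;> rcases h b with rfl | rfl <;> simp [sgn, h2]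

/-! ### Even matrices with two tensor legs -/

/-- `X : Mat2 a b c d B` stands for the even element
`∑ E_{ij} ⊗ E_{kl} ⊗ X i j k l`, where `i ∈ I_{a|a}`, `j ∈ I_{b|b}`, `k ∈ I_{c|c}`, `l ∈ I_{d|d}`
and the entry `X i j k l` of `B` has parity `|i| + |j| + |k| + |l|`. -/
abbrev Mat2 (a b c d : ℕ) (B : Type) : Type := Idx a → Idx b → Idx c → Idx d → B

/-- The product of even elements with two matrix legs, by the rule of signs
`(E_{ij} ⊗ E_{kl} ⊗ x)(E_{ji'} ⊗ E_{lk'} ⊗ y)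
  = (-1)^{|x|(|E_{ji'}| + |E_{lk'}|) + |E_{kl}||E_{ji'}|} E_{ii'} ⊗ E_{kk'} ⊗ x y`,
where entries are multiplied by `μ`. -/
def dotWith {B C D : Type} [AddCommMonoid D] [Module K D] (μ : B → C → D)
    {a b c a' b' c' : ℕ} (X : Mat2 a b a' b' B) (Y : Mat2 b c b' c' C) : Mat2 a c a' c' D :=
  fun i i' k k' => ∑ j, ∑ l,
    sgn ((par i + par j + par k + par l) * (par j + par i' + par l + par k')
      + (par k + par l) * (par j + par i')) • μ (X i j k l) (Y j i' l k')

/-- The product of even elements with entries in an algebra. -/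
def dot {B : Type} [Ring B] [Algebra K B] {a b c a' b' c' : ℕ}
    (X : Mat2 a b a' b' B) (Y : Mat2 b c b' c' B) : Mat2 a c a' c' B :=
  dotWith (fun x y => x * y) X Y

infixl:70 " ⋆ " => dot

/-- `X^1 = ∑ E_{ij} ⊗ 1 ⊗ X i j`. -/
def leg1 {B : Type} [Zero B] {a b : ℕ} (c : ℕ) (X : Idx a → Idx b → B) : Mat2 a b c c B :=
  fun i j k l => if k = l then X i j else 0

/-- `X^2 = ∑ 1 ⊗ E_{kl} ⊗ X k l`. -/
def leg2 {B : Type} [Zero B] {a b : ℕ} (c : ℕ) (X : Idx a → Idx b → B) : Mat2 c c a b B :=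
  fun i j k l => if i = j then X k l else 0

/-- A scalar matrix viewed with entries in an algebra. -/
def scal (B : Type) [Ring B] [Algebra K B] {a b c d : ℕ} (X : Mat2 a b c d K) : Mat2 a b c d B :=
  fun i j k l => algebraMap K B (X i j k l)

/-! ### The matrix `S` -/

/-- `φ(i,j) = (-1)^{|j|}(δ_{i,j} + δ_{i,-j})`. -/
def phi {N : ℕ} (i j : Idx N) : ℤ :=
  (if j.1 < 0 then -1 else 1) * ((if i = j then 1 else 0) + (if i = -j then 1 else 0))

/-- `∑ Q^{φ(i,j)} E_{ii} ⊗ E_{jj} + (Q - Q⁻¹) ∑_{j<l} (-1)^{|j|} (E_{lj} + E_{-l,-j}) ⊗ E_{jl}`;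
the entry at `i k j l` is the coefficient of `E_{ik} ⊗ E_{jl}`. -/
def sMatrix (N : ℕ) (Q : K) : Mat2 N N N N K := fun i k j l =>
  (if i = k ∧ j = l then Q ^ phi i j else 0) +
    (Q - Q⁻¹) * (if j < l then
      sgn (par j) * ((if i = l ∧ k = j then 1 else 0) + (if i = -l ∧ k = -j then 1 else 0))
      else 0)

/-- The matrix `S`. -/
def S (N : ℕ) : Mat2 N N N N K := sMatrix N q

/-- The matrix `S⁻¹ = ∑ q^{-φ(i,j)} E_{ii} ⊗ E_{jj} - ξ ∑_{j<l} (-1)^{|j|} (E_{lj} + E_{-l,-j}) ⊗ E_{jl}`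
with `ξ = q - q⁻¹`. -/
def Sinv (N : ℕ) : Mat2 N N N N K := sMatrix N q⁻¹

/-- `(1 ⊗ D^e) S (1 ⊗ D^{-e})` with `D = ∑ q^{2 (-1)^{|α|} α} E_{αα}`, where `(-1)^{|α|} α` is the
absolute value of `α`. -/
def Stilde (N : ℕ) (e : ℤˣ) : Mat2 N N N N K := fun i k j l =>
  (q ^ (2 * |j.1|)) ^ (e : ℤ) * S N i k j l * (q ^ (2 * |l.1|)) ^ (-(e : ℤ))

/-! ### Superalgebras given by homogeneous generators and relations -/

section Presentation

variable {X : Type} (p : X → ZMod 2)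

/-- The component of parity `d` of the free superalgebra on generators `x` of parity `p x`. -/
def freeGrade (d : ZMod 2) : Submodule K (FreeAlgebra K X) :=
  Submodule.span K {w | ∃ l : List X, (l.map p).sum = d ∧ w = (l.map (FreeAlgebra.ι K)).prod}

theorem one_mem_freeGrade : (1 : FreeAlgebra K X) ∈ freeGrade p 0 :=
  Submodule.subset_span ⟨[], by simp⟩

theorem gen_mem_freeGrade (x : X) : FreeAlgebra.ι K x ∈ freeGrade p (p x) :=
  Submodule.subset_span ⟨[x], by simp⟩

theorem mul_mem_freeGrade {d e : ZMod 2} {x y : FreeAlgebra K X}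
    (hx : x ∈ freeGrade p d) (hy : y ∈ freeGrade p e) : x * y ∈ freeGrade p (d + e) := by
  have h := Submodule.mul_mem_mul hx hy
  rw [freeGrade, freeGrade, Submodule.span_mul_span] at h
  refine Submodule.span_mono ?_ h
  rintro _ ⟨_, ⟨l, hl, rfl⟩, _, ⟨m, hm, rfl⟩, rfl⟩
  exact ⟨l ++ m, by simp [hl, hm]⟩

variable (rel : FreeAlgebra K X → FreeAlgebra K X → Prop)

/-- The component of parity `d` of the superalgebra with generators `X` and relations `rel`. -/
def quotGrade (d : ZMod 2) : Submodule K (RingQuot rel) :=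
  (freeGrade p d).map (RingQuot.mkAlgHom K rel).toLinearMap

instance instGradedMonoidQuot : SetLike.GradedMonoid (quotGrade p rel) where
  one_mem := ⟨1, one_mem_freeGrade p, map_one (RingQuot.mkAlgHom K rel)⟩
  mul_mem := by
    rintro d e _ _ ⟨x, hx, rfl⟩ ⟨y, hy, rfl⟩
    exact ⟨x * y, mul_mem_freeGrade p hx hy, map_mul (RingQuot.mkAlgHom K rel) x y⟩

theorem mk_mem_quotGrade {d : ZMod 2} {x : FreeAlgebra K X} (hx : x ∈ freeGrade p d) :
    RingQuot.mkAlgHom K rel x ∈ quotGrade p rel d := ⟨x, hx, rfl⟩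

/-- Decomposition into homogeneous components, on the free algebra. -/
def freeDecompose : FreeAlgebra K X →ₐ[K] ⨁ d, quotGrade p rel d :=
  FreeAlgebra.lift K fun x => DirectSum.of (fun d => ↥(quotGrade p rel d)) (p x)
    ⟨RingQuot.mkAlgHom K rel (FreeAlgebra.ι K x), mk_mem_quotGrade p rel (gen_mem_freeGrade p x)⟩

theorem freeDecompose_list (l : List X) : ∀ (d : ZMod 2) (_ : (l.map p).sum = d)
    (h : RingQuot.mkAlgHom K rel (l.map (FreeAlgebra.ι K)).prod ∈ quotGrade p rel d),
    freeDecompose p rel (l.map (FreeAlgebra.ι K)).prod =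
      DirectSum.of (fun d => ↥(quotGrade p rel d)) d ⟨_, h⟩ := by
  induction l with
  | nil =>
    intro d hd h
    simp only [List.map_nil, List.sum_nil] at hd
    subst hd
    simp only [List.map_nil, List.prod_nil, map_one]
    exact DirectSum.of_eq_of_gradedMonoid_eq (Sigma.subtype_ext rfl rfl)
  | cons x l ih =>
    intro d hd h
    have hl : RingQuot.mkAlgHom K rel (l.map (FreeAlgebra.ι K)).prod ∈
        quotGrade p rel (l.map p).sum :=
      mk_mem_quotGrade p rel (Submodule.subset_span ⟨l, rfl, rfl⟩)
    simp only [List.map_cons, List.prod_cons, List.sum_cons, map_mul] at hd h ⊢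
    rw [ih _ rfl hl]
    conv_lhs => rw [freeDecompose, FreeAlgebra.lift_ι_apply, DirectSum.of_mul_of]
    exact DirectSum.of_eq_of_gradedMonoid_eq (Sigma.subtype_ext hd rfl)

theorem freeDecompose_of_mem {d : ZMod 2} {x : FreeAlgebra K X} (hx : x ∈ freeGrade p d) :
    freeDecompose p rel x = DirectSum.of (fun d => ↥(quotGrade p rel d)) d
      ⟨RingQuot.mkAlgHom K rel x, mk_mem_quotGrade p rel hx⟩ := by
  induction hx using Submodule.span_induction with
  | mem x h =>
    obtain ⟨l, hl, rfl⟩ := h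
    exact freeDecompose_list p rel l d hl _
  | zero =>
    rw [map_zero]
    symm
    convert map_zero (DirectSum.of (fun d => ↥(quotGrade p rel d)) d)
    exact map_zero (RingQuot.mkAlgHom K rel)
  | add x y hx hy ihx ihy =>
    rw [map_add, ihx, ihy, ← map_add]
    congr 1
    exact Subtype.ext (map_add (RingQuot.mkAlgHom K rel) x y).symm
  | smul a x hx ih =>
    rw [map_smul, ih, ← DirectSum.lof_eq_of K, ← DirectSum.lof_eq_of K, ← map_smul]
    congr 1
    exact Subtype.ext (map_smul (RingQuot.mkAlgHom K rel) a x).symm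

/-- If the relations are homogeneous, the quotient is a superalgebra. -/
abbrev quotGradedAlgebra
    (hrel : ∀ ⦃x y⦄, rel x y → ∃ d, x ∈ freeGrade p d ∧ y ∈ freeGrade p d) :
    GradedAlgebra (quotGrade p rel) :=
  GradedAlgebra.ofAlgHom (quotGrade p rel)
    (RingQuot.liftAlgHom K ⟨freeDecompose p rel, fun x y h => by
      obtain ⟨d, hx, hy⟩ := hrel h
      rw [freeDecompose_of_mem p rel hx, freeDecompose_of_mem p rel hy]
      congr 1
      exact Subtype.ext (RingQuot.mkAlgHom_rel K h)⟩)
    (by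
      apply RingQuot.ringQuot_ext'
      ext x
      simp [freeDecompose])
    (by
      rintro d ⟨_, x, hx, rfl⟩
      exact (RingQuot.liftAlgHom_mkAlgHom_apply K _ _ x).trans (freeDecompose_of_mem p rel hx))

end Presentation

/-! ### Homogeneity of the matrix relations -/

theorem par_cases {N : ℕ} (i : Idx N) : par i = 0 ∨ par i = 1 := by
  unfold par; split <;> simp

theorem add_self_two (d : ZMod 2) : d + d = 0 := CharTwo.add_self_eq_zero d

theorem par_neg {N : ℕ} (i : Idx N) : par (-i) = par i + 1 := by
  have h := i.2
  simp only [Finset.mem_erase, Finset.mem_Icc] at h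
  have h2 : (1 + 1 : ZMod 2) = 0 := by decide
  have hn : (-i).1 = -i.1 := rfl
  unfold par
  rw [hn]
  by_cases hi : i.1 < 0
  · rw [if_neg (by omega), if_pos hi, h2]
  · rw [if_pos (by omega), if_neg hi, zero_add]

theorem sMatrix_eq_zero {N : ℕ} (Q : K) (i k j l : Idx N)
    (h : par i + par k + par j + par l ≠ 0) : sMatrix N Q i k j l = 0 := by
  unfold sMatrix
  rw [if_neg, if_neg (c := i = l ∧ k = j), if_neg (c := i = -l ∧ k = -j)]
  · simp
  · rintro ⟨rfl, rfl⟩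
    apply h
    rw [par_neg, par_neg]
    linear_combination add_self_two (par l) + add_self_two (par j) + add_self_two 1
  · rintro ⟨rfl, rfl⟩
    apply h
    linear_combination add_self_two (par i) + add_self_two (par k)
  · rintro ⟨rfl, rfl⟩
    apply h
    linear_combination add_self_two (par i) + add_self_two (par j)

section Even

variable {X : Type} (p : X → ZMod 2)

/-- The entries of `M` have the parities required of an even element. -/
def IsEvenMat {a b c d : ℕ} (M : Mat2 a b c d (FreeAlgebra K X)) : Prop :=
  ∀ i j k l, M i j k l ∈ freeGrade p (par i + par j + par k + par l)

theorem IsEvenMat.dot {a b c a' b' c' : ℕ} {M : Mat2 a b a' b' (FreeAlgebra K X)}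
    {M' : Mat2 b c b' c' (FreeAlgebra K X)} (h : IsEvenMat p M) (h' : IsEvenMat p M') :
    IsEvenMat p (M ⋆ M') := by
  intro i i' k k'
  unfold QueerBraid.dot dotWith
  refine Submodule.sum_mem _ fun j _ => Submodule.sum_mem _ fun l _ =>
    Submodule.smul_mem (freeGrade p _) _ ?_
  have e : par i + par i' + par k + par k' =
      (par i + par j + par k + par l) + (par j + par i' + par l + par k') := by
    linear_combination - add_self_two (par j) - add_self_two (par l)
  rw [e]
  exact mul_mem_freeGrade p (h i j k l) (h' j i' l k')

theorem isEvenMat_scal_sMatrix (N : ℕ) (Q : K) :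
    IsEvenMat p (scal (FreeAlgebra K X) (sMatrix N Q)) := by
  intro i k j l
  by_cases h : par i + par k + par j + par l = 0
  · rw [h, scal, Algebra.algebraMap_eq_smul_one]
    exact Submodule.smul_mem _ _ (one_mem_freeGrade p)
  · simp [scal, sMatrix_eq_zero Q i k j l h]

theorem isEvenMat_leg1 {a b : ℕ} (c : ℕ) {M : Idx a → Idx b → FreeAlgebra K X}
    (h : ∀ i j, M i j ∈ freeGrade p (par i + par j)) : IsEvenMat p (leg1 c M) := by
  intro i j k l
  unfold leg1
  split
  · next e =>
    subst e
    rw [add_assoc, add_self_two, add_zero]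
    exact h i j
  · exact Submodule.zero_mem _

theorem isEvenMat_leg2 {a b : ℕ} (c : ℕ) {M : Idx a → Idx b → FreeAlgebra K X}
    (h : ∀ i j, M i j ∈ freeGrade p (par i + par j)) : IsEvenMat p (leg2 c M) := by
  intro i j k l
  unfold leg2
  split
  · next e =>
    subst e
    rw [add_self_two, zero_add]
    exact h k l
  · exact Submodule.zero_mem _

end Even

/-! ### The quantum queer superalgebra -/

/-- Indices of the generators `L_{ij}`, `i ≤ j`. -/
abbrev UGen (N : ℕ) : Type := {x : Idx N × Idx N // x.1 ≤ x.2}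

def UGen.par {N : ℕ} (x : UGen N) : ZMod 2 := QueerBraid.par x.1.1 + QueerBraid.par x.1.2

/-- `L_{ij}` in the free algebra, with `L_{ij} = 0` for `i > j`. -/
def freeL {N : ℕ} (i j : Idx N) : FreeAlgebra K (UGen N) :=
  if h : i ≤ j then FreeAlgebra.ι K ⟨(i, j), h⟩ else 0

/-- The generating matrix `∑ L_{ij} ⊗ E_{ij} = ∑ E_{ij} ⊗ (-1)^{|i|+|j|} L_{ij}`,
with matrix units written to the left of the entries. -/
def genMat {B : Type} [AddCommGroup B] [Module K B] {N : ℕ} (L : Idx N → Idx N → B) :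
    Idx N → Idx N → B :=
  fun i j => sgn (par i + par j) • L i j

/-- The relations `L_{ii} L_{-i,-i} = 1` (for all `i`, positive or negative) and
`L^{[1]2} L^{[1]3} S^{23} = S^{23} L^{[1]3} L^{[1]2}`. -/
inductive URel (N : ℕ) : FreeAlgebra K (UGen N) → FreeAlgebra K (UGen N) → Prop
  | inv (i : Idx N) : URel N (freeL i i * freeL (-i) (-i)) 1
  | rll (i j k l : Idx N) : URel N
      ((leg1 N (genMat freeL) ⋆ leg2 N (genMat freeL) ⋆ scal _ (S N)) i j k l)
      ((scal _ (S N) ⋆ leg2 N (genMat freeL) ⋆ leg1 N (genMat freeL)) i j k l)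

/-- The quantum queer superalgebra `U_q(𝔮_N)`. -/
abbrev Uq (N : ℕ) : Type := RingQuot (URel N)

/-- The generator `L_{ij}`, zero for `i > j`. -/
def L {N : ℕ} (i j : Idx N) : Uq N := RingQuot.mkAlgHom K (URel N) (freeL i j)

theorem freeL_mem {N : ℕ} (i j : Idx N) : freeL i j ∈ freeGrade UGen.par (par i + par j) := by
  unfold freeL
  split
  · next h => exact gen_mem_freeGrade UGen.par (⟨(i, j), h⟩ : UGen N)
  · exact Submodule.zero_mem _

theorem genMat_freeL_mem {N : ℕ} (i j : Idx N) :
    genMat freeL i j ∈ freeGrade UGen.par (par i + par j) :=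
  Submodule.smul_mem _ _ (freeL_mem i j)

/-- The homogeneous components of `U_q(𝔮_N)`. -/
abbrev gradeU (N : ℕ) : ZMod 2 → Submodule K (Uq N) := quotGrade UGen.par (URel N)

instance instGradedU (N : ℕ) : GradedAlgebra (gradeU N) :=
  quotGradedAlgebra UGen.par (URel N) (by
    rintro _ _ (i | ⟨i, j, k, l⟩)
    · refine ⟨0, ?_, one_mem_freeGrade _⟩
      have h := mul_mem_freeGrade UGen.par (freeL_mem i i) (freeL_mem (-i) (-i))
      rwa [add_self_two, add_self_two, add_zero] at h
    · have h1 := isEvenMat_leg1 UGen.par N (genMat_freeL_mem (N := N))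
      have h2 := isEvenMat_leg2 UGen.par N (genMat_freeL_mem (N := N))
      have h3 := isEvenMat_scal_sMatrix (UGen.par (N := N)) N q
      exact ⟨_, ((h1.dot _ h2).dot _ h3) i j k l, ((h3.dot _ h2).dot _ h1) i j k l⟩)

theorem L_mem {N : ℕ} (i j : Idx N) : L i j ∈ gradeU N (par i + par j) :=
  mk_mem_quotGrade _ _ (freeL_mem i j)

/-! ### The quantum coordinate superalgebras -/

/-- Indices of generators `t_{ia}`, `i ∈ I_{m|m}`, `a ∈ I_{n|n}`. -/
abbrev TGen (m n : ℕ) : Type := Idx m × Idx n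

def TGen.par {m n : ℕ} (x : TGen m n) : ZMod 2 := QueerBraid.par x.1 + QueerBraid.par x.2

/-- `t_{ia}` in the free algebra. -/
def freeT {m n : ℕ} (i : Idx m) (a : Idx n) : FreeAlgebra K (TGen m n) := FreeAlgebra.ι K (i, a)

/-- The entries `(-1)^{|b|(|α|+|b|)} t_{αb}` of the `n × s` matrix
`∑ (-1)^{|b|(|α|+|b|)} E_{bα} ⊗ t_{αb}`. -/
def barMat {B : Type} [AddCommGroup B] [Module K B] {s n : ℕ} (t : Idx s → Idx n → B) :
    Idx n → Idx s → B :=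
  fun b α => sgn (par b * (par α + par b)) • t α b

theorem freeT_mem {m n : ℕ} (i : Idx m) (a : Idx n) :
    freeT i a ∈ freeGrade TGen.par (par i + par a) :=
  gen_mem_freeGrade TGen.par (i, a)

theorem barMat_freeT_mem {s n : ℕ} (b : Idx n) (α : Idx s) :
    barMat freeT b α ∈ freeGrade TGen.par (par b + par α) := by
  rw [add_comm]
  exact Submodule.smul_mem _ _ (freeT_mem α b)

/-- The relations `t_{ia} = t_{-i,-a}` and `S^{12} T^{1[3]} T^{2[3]} = T^{2[3]} T^{1[3]} S^{12}`
with `T = ∑ E_{ia} ⊗ t_{ia}`. -/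
inductive ARel (r n : ℕ) : FreeAlgebra K (TGen r n) → FreeAlgebra K (TGen r n) → Prop
  | sym (i : Idx r) (a : Idx n) : ARel r n (freeT i a) (freeT (-i) (-a))
  | rtt (i : Idx r) (a : Idx n) (j : Idx r) (b : Idx n) : ARel r n
      ((scal _ (S r) ⋆ leg1 r freeT ⋆ leg2 n freeT) i a j b)
      ((leg2 r freeT ⋆ leg1 n freeT ⋆ scal _ (S n)) i a j b)

/-- The quantum coordinate superalgebra `A_{r,n}`. -/
abbrev Aq (r n : ℕ) : Type := RingQuot (ARel r n)

/-- The generator `t_{ia}` of `A_{r,n}`. -/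
def t {r n : ℕ} (i : Idx r) (a : Idx n) : Aq r n := RingQuot.mkAlgHom K (ARel r n) (freeT i a)

/-- The homogeneous components of `A_{r,n}`. -/
abbrev gradeA (r n : ℕ) : ZMod 2 → Submodule K (Aq r n) := quotGrade TGen.par (ARel r n)

instance instGradedA (r n : ℕ) : GradedAlgebra (gradeA r n) :=
  quotGradedAlgebra TGen.par (ARel r n) (by
    rintro _ _ (⟨i, a⟩ | ⟨i, a, j, b⟩)
    · refine ⟨_, freeT_mem i a, ?_⟩
      have h := freeT_mem (-i) (-a)
      rw [par_neg, par_neg] at h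
      convert h using 2
      linear_combination - add_self_two 1
    · have h1 := fun c => isEvenMat_leg1 TGen.par c (freeT_mem (m := r) (n := n))
      have h2 := fun c => isEvenMat_leg2 TGen.par c (freeT_mem (m := r) (n := n))
      have h3 := fun c => isEvenMat_scal_sMatrix (TGen.par (m := r) (n := n)) c q
      exact ⟨_, (((h3 r).dot _ (h1 r)).dot _ (h2 n)) i a j b,
        (((h2 r).dot _ (h1 n)).dot _ (h3 n)) i a j b⟩)

/-- The relations `t̄_{αb} = (-1)^{|α|+|b|} t̄_{-α,-b}` and
`T̄^{1[3]} T̄^{2[3]} S^{12} = S^{12} T̄^{2[3]} T̄^{1[3]}` with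
`T̄ = ∑ (-1)^{|b|(|α|+|b|)} E_{bα} ⊗ t̄_{αb}`. -/
inductive AbarRel (s n : ℕ) : FreeAlgebra K (TGen s n) → FreeAlgebra K (TGen s n) → Prop
  | sym (α : Idx s) (b : Idx n) :
      AbarRel s n (freeT α b) (sgn (par α + par b) • freeT (-α) (-b))
  | rtt (a : Idx n) (α : Idx s) (b : Idx n) (β : Idx s) : AbarRel s n
      ((leg1 n (barMat freeT) ⋆ leg2 s (barMat freeT) ⋆ scal _ (S s)) a α b β)
      ((scal _ (S n) ⋆ leg2 n (barMat freeT) ⋆ leg1 s (barMat freeT)) a α b β)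

/-- The dual quantum coordinate superalgebra `Ā_{s,n}`. -/
abbrev Abar (s n : ℕ) : Type := RingQuot (AbarRel s n)

/-- The generator `t̄_{αb}` of `Ā_{s,n}`. -/
def tbar {s n : ℕ} (α : Idx s) (b : Idx n) : Abar s n :=
  RingQuot.mkAlgHom K (AbarRel s n) (freeT α b)

/-- The homogeneous components of `Ā_{s,n}`. -/
abbrev gradeAbar (s n : ℕ) : ZMod 2 → Submodule K (Abar s n) := quotGrade TGen.par (AbarRel s n)

instance instGradedAbar (s n : ℕ) : GradedAlgebra (gradeAbar s n) :=
  quotGradedAlgebra TGen.par (AbarRel s n) (by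
    rintro _ _ (⟨i, a⟩ | ⟨a, i, b, j⟩)
    · refine ⟨_, freeT_mem i a, Submodule.smul_mem _ _ ?_⟩
      have h := freeT_mem (-i) (-a)
      rw [par_neg, par_neg] at h
      convert h using 2
      linear_combination - add_self_two 1
    · have h1 := fun c => isEvenMat_leg1 TGen.par c (barMat_freeT_mem (s := s) (n := n))
      have h2 := fun c => isEvenMat_leg2 TGen.par c (barMat_freeT_mem (s := s) (n := n))
      have h3 := fun c => isEvenMat_scal_sMatrix (TGen.par (m := s) (n := n)) c q
      exact ⟨_, (((h1 n).dot _ (h2 s)).dot _ (h3 s)) a i b j,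
        (((h3 n).dot _ (h2 n)).dot _ (h1 s)) a i b j⟩)

/-! ### The comultiplication and the counit -/

section DotLemmas

variable {B : Type} [Ring B] [Algebra K B]

theorem sign_assoc (i j₁ j i' k l₁ l k' : ZMod 2) :
    ((i + j + k + l) * (j + i' + l + k') + (k + l) * (j + i'))
      + ((i + j₁ + k + l₁) * (j₁ + j + l₁ + l) + (k + l₁) * (j₁ + j))
    = ((i + j₁ + k + l₁) * (j₁ + i' + l₁ + k') + (k + l₁) * (j₁ + i'))
      + ((j₁ + j + l₁ + l) * (j + i' + l + k') + (l₁ + l) * (j + i')) := by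
  have h2 : (2 : ZMod 2) = 0 := by decide
  linear_combination (-((j₁ + l₁) * (j + i' + l + k') + l₁ * (j + i')
    - (j + l) * (i + j₁ + k + l₁) - j * (k + l₁))) * h2

theorem dot_apply {a b c a' b' c' : ℕ} (X : Mat2 a b a' b' B) (Y : Mat2 b c b' c' B)
    (i : Idx a) (i' : Idx c) (k : Idx a') (k' : Idx c') :
    (X ⋆ Y) i i' k k' = ∑ j, ∑ l,
      sgn ((par i + par j + par k + par l) * (par j + par i' + par l + par k')
        + (par k + par l) * (par j + par i')) • (X i j k l * Y j i' l k') := rfl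

theorem sum_four {α β γ δ M : Type} [Fintype α] [Fintype β] [Fintype γ] [Fintype δ]
    [AddCommMonoid M] (f : α → β → γ → δ → M) :
    ∑ a, ∑ b, ∑ c, ∑ d, f a b c d = ∑ c, ∑ d, ∑ a, ∑ b, f a b c d := by
  calc ∑ a, ∑ b, ∑ c, ∑ d, f a b c d
      = ∑ a, ∑ c, ∑ b, ∑ d, f a b c d :=
        Finset.sum_congr rfl fun a _ => Finset.sum_comm
    _ = ∑ c, ∑ a, ∑ b, ∑ d, f a b c d := Finset.sum_comm
    _ = ∑ c, ∑ a, ∑ d, ∑ b, f a b c d :=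
        Finset.sum_congr rfl fun c _ => Finset.sum_congr rfl fun a _ => Finset.sum_comm
    _ = ∑ c, ∑ d, ∑ a, ∑ b, f a b c d :=
        Finset.sum_congr rfl fun c _ => Finset.sum_comm

theorem dot_assoc {a b c d a' b' c' d' : ℕ} (X : Mat2 a b a' b' B) (Y : Mat2 b c b' c' B)
    (Z : Mat2 c d c' d' B) : X ⋆ Y ⋆ Z = X ⋆ (Y ⋆ Z) := by
  funext i i' k k'
  rw [dot_apply, dot_apply]
  have h1 : ∀ j l, sgn ((par i + par j + par k + par l) * (par j + par i' + par l + par k')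
        + (par k + par l) * (par j + par i')) • ((X ⋆ Y) i j k l * Z j i' l k') =
      ∑ j₁, ∑ l₁, sgn (((par i + par j + par k + par l) * (par j + par i' + par l + par k')
        + (par k + par l) * (par j + par i')) + ((par i + par j₁ + par k + par l₁) *
          (par j₁ + par j + par l₁ + par l) + (par k + par l₁) * (par j₁ + par j))) •
        (X i j₁ k l₁ * (Y j₁ j l₁ l * Z j i' l k')) := by
    intro j l
    rw [dot_apply, Finset.sum_mul, Finset.smul_sum]
    refine Finset.sum_congr rfl fun j₁ _ => ?_
    rw [Finset.sum_mul, Finset.smul_sum]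
    refine Finset.sum_congr rfl fun l₁ _ => ?_
    rw [smul_mul_assoc, smul_smul, ← sgn_add, mul_assoc]
  have h2 : ∀ j₁ l₁, sgn ((par i + par j₁ + par k + par l₁) * (par j₁ + par i' + par l₁ + par k')
        + (par k + par l₁) * (par j₁ + par i')) • (X i j₁ k l₁ * (Y ⋆ Z) j₁ i' l₁ k') =
      ∑ j, ∑ l, sgn (((par i + par j₁ + par k + par l₁) * (par j₁ + par i' + par l₁ + par k')
        + (par k + par l₁) * (par j₁ + par i')) + ((par j₁ + par j + par l₁ + par l) *
          (par j + par i' + par l + par k') + (par l₁ + par l) * (par j + par i'))) •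
        (X i j₁ k l₁ * (Y j₁ j l₁ l * Z j i' l k')) := by
    intro j₁ l₁
    rw [dot_apply, Finset.mul_sum, Finset.smul_sum]
    refine Finset.sum_congr rfl fun j _ => ?_
    rw [Finset.mul_sum, Finset.smul_sum]
    refine Finset.sum_congr rfl fun l _ => ?_
    rw [mul_smul_comm, smul_smul, ← sgn_add]
  refine (Finset.sum_congr rfl fun j _ => Finset.sum_congr rfl fun l _ => h1 j l).trans ?_
  refine Eq.trans ?_
    (Finset.sum_congr rfl fun j₁ _ => Finset.sum_congr rfl fun l₁ _ => h2 j₁ l₁).symm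
  rw [sum_four]
  refine Finset.sum_congr rfl fun j₁ _ => Finset.sum_congr rfl fun l₁ _ =>
    Finset.sum_congr rfl fun j _ => Finset.sum_congr rfl fun l _ => ?_
  rw [sign_assoc]

theorem leg2_dot_leg1 {a b c d : ℕ} (X : Idx a → Idx b → B) (Y : Idx c → Idx d → B)
    (i : Idx c) (i' : Idx d) (k : Idx a) (k' : Idx b) :
    (leg2 c X ⋆ leg1 b Y) i i' k k' = X k k' * Y i i' := by
  rw [dot_apply, Finset.sum_eq_single i, Finset.sum_eq_single k']
  · have e : (par i + par i + par k + par k') * (par i + par i' + par k' + par k')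
        + (par k + par k') * (par i + par i') = 0 := by
      linear_combination (par i + par i' + par k' + par k') * add_self_two (par i)
        + (par k + par k') * add_self_two (par k')
        + add_self_two ((par k + par k') * (par i + par i'))
    simp [leg1, leg2, e, sgn]
  · intro l _ h
    simp [leg1, h]
  · simp
  · intro j _ h
    simp [leg2, Ne.symm h]
  · simp

theorem leg1_dot_leg2 {a b c d : ℕ} (Y : Idx c → Idx d → B) (X : Idx a → Idx b → B)
    (i : Idx c) (i' : Idx d) (k : Idx a) (k' : Idx b) :
    (leg1 a Y ⋆ leg2 d X) i i' k k' =
      sgn ((par i + par i') * (par k + par k')) • (Y i i' * X k k') := by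
  rw [dot_apply, Finset.sum_eq_single i', Finset.sum_eq_single k]
  · have e : (par i + par i' + par k + par k) * (par i' + par i' + par k + par k')
        + (par k + par k) * (par i' + par i') = (par i + par i') * (par k + par k') := by
      linear_combination (par i' + par i' + par k + par k' + (par i' + par i')) *
          add_self_two (par k) + (par i + par i') * add_self_two (par i')
    simp [leg1, leg2, e]
  · intro l _ h
    simp [leg1, Ne.symm h]
  · simp
  · intro j _ h
    simp [leg2, h]
  · simp

/-- The product of two even elements with one matrix leg. -/
def dot1 {a b c : ℕ} (X : Idx a → Idx b → B) (Y : Idx b → Idx c → B) : Idx a → Idx c → B :=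
  fun i j => ∑ k, sgn ((par i + par k) * (par k + par j)) • (X i k * Y k j)

theorem leg1_dot1 {a b c : ℕ} (m : ℕ) (X : Idx a → Idx b → B) (Y : Idx b → Idx c → B) :
    leg1 m (dot1 X Y) = leg1 m X ⋆ leg1 m Y := by
  funext i i' k k'
  rw [dot_apply]
  by_cases h : k = k'
  · subst h
    simp only [leg1, if_true, dot1]
    refine Finset.sum_congr rfl fun j _ => ?_
    rw [Finset.sum_eq_single k]
    · have e : (par i + par j + par k + par k) * (par j + par i' + par k + par k)
          + (par k + par k) * (par j + par i') = (par i + par j) * (par j + par i') := by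
        linear_combination (par i + par j + (par k + par k) + (par j + par i') +
          (par j + par i')) * add_self_two (par k)
      simp [e]
    · intro l _ h
      simp [h]
    · simp
  · simp only [leg1, if_neg h]
    symm
    refine Finset.sum_eq_zero fun j _ => Finset.sum_eq_zero fun l _ => ?_
    by_cases h' : k = l
    · subst h'
      simp [h]
    · simp [h']

theorem leg2_dot1 {a b c : ℕ} (m : ℕ) (X : Idx a → Idx b → B) (Y : Idx b → Idx c → B) :
    leg2 m (dot1 X Y) = leg2 m X ⋆ leg2 m Y := by
  funext i i' k k'
  rw [dot_apply]
  by_cases h : i = i'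
  · subst h
    simp only [leg2, if_true, dot1]
    rw [Finset.sum_eq_single i]
    · refine Finset.sum_congr rfl fun l _ => ?_
      have e : (par i + par i + par k + par l) * (par i + par i + par l + par k')
          + (par k + par l) * (par i + par i) = (par k + par l) * (par l + par k') := by
        linear_combination (par k + par l + (par i + par i) + (par l + par k') +
          (par k + par l)) * add_self_two (par i)
      simp [e]
    · intro l _ h
      simp [Ne.symm h]
    · simp
  · simp only [leg2, if_neg h]
    symm
    refine Finset.sum_eq_zero fun j _ => Finset.sum_eq_zero fun l _ => ?_
    by_cases h' : i = j
    · subst h'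
      simp [h]
    · simp [h']

/-- Products of solutions of the matrix relation with supercommuting entries are solutions. -/
theorem rll_dot1 {N : ℕ} (X Y : Idx N → Idx N → B) (Z : Mat2 N N N N B)
    (hX : leg1 N X ⋆ leg2 N X ⋆ Z = Z ⋆ leg2 N X ⋆ leg1 N X)
    (hY : leg1 N Y ⋆ leg2 N Y ⋆ Z = Z ⋆ leg2 N Y ⋆ leg1 N Y)
    (hXY : ∀ i j k l, Y i j * X k l =
      sgn ((par i + par j) * (par k + par l)) • (X k l * Y i j)) :
    leg1 N (dot1 X Y) ⋆ leg2 N (dot1 X Y) ⋆ Z = Z ⋆ leg2 N (dot1 X Y) ⋆ leg1 N (dot1 X Y) := by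
  have sq : ∀ d, sgn d * sgn d = 1 := fun d => by rw [← sgn_add, add_self_two]; simp [sgn]
  have c1 : leg1 N Y ⋆ leg2 N X = leg2 N X ⋆ leg1 N Y := by
    funext i i' k k'
    rw [leg1_dot_leg2, leg2_dot_leg1, hXY, smul_smul, sq, one_smul]
  have c2 : leg2 N Y ⋆ leg1 N X = leg1 N X ⋆ leg2 N Y := by
    funext i i' k k'
    rw [leg1_dot_leg2, leg2_dot_leg1, hXY, mul_comm (par k + par k')]
  rw [leg1_dot1, leg2_dot1]
  calc leg1 N X ⋆ leg1 N Y ⋆ (leg2 N X ⋆ leg2 N Y) ⋆ Z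
      = leg1 N X ⋆ (leg1 N Y ⋆ leg2 N X) ⋆ leg2 N Y ⋆ Z := by simp only [dot_assoc]
    _ = leg1 N X ⋆ leg2 N X ⋆ (leg1 N Y ⋆ leg2 N Y ⋆ Z) := by rw [c1]; simp only [dot_assoc]
    _ = leg1 N X ⋆ leg2 N X ⋆ Z ⋆ leg2 N Y ⋆ leg1 N Y := by rw [hY]; simp only [dot_assoc]
    _ = Z ⋆ leg2 N X ⋆ (leg1 N X ⋆ leg2 N Y) ⋆ leg1 N Y := by rw [hX]; simp only [dot_assoc]
    _ = _ := by rw [← c2]; simp only [dot_assoc]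

theorem map_dot {C : Type} [Ring C] [Algebra K C] (f : B →ₐ[K] C) {a b c a' b' c' : ℕ}
    (X : Mat2 a b a' b' B) (Y : Mat2 b c b' c' B)
    (i : Idx a) (i' : Idx c) (k : Idx a') (k' : Idx c') :
    f ((X ⋆ Y) i i' k k') =
      ((fun i j k l => f (X i j k l)) ⋆ (fun i j k l => f (Y i j k l))) i i' k k' := by
  simp only [dot_apply, map_sum, map_smul, map_mul]

theorem map_rll {C : Type} [Ring C] [Algebra K C] (f : B →ₐ[K] C) {N : ℕ}
    (X : Idx N → Idx N → B) (Z : Mat2 N N N N K) (i j k l : Idx N) :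
    f ((leg1 N X ⋆ leg2 N X ⋆ scal B Z) i j k l) =
      (leg1 N (fun i j => f (X i j)) ⋆ leg2 N (fun i j => f (X i j)) ⋆ scal C Z) i j k l ∧
    f ((scal B Z ⋆ leg2 N X ⋆ leg1 N X) i j k l) =
      (scal C Z ⋆ leg2 N (fun i j => f (X i j)) ⋆ leg1 N (fun i j => f (X i j))) i j k l := by
  have h1 : (fun i j k l => f (leg1 N X i j k l)) = leg1 N (fun i j => f (X i j)) := by
    funext i j k l
    simp only [leg1, apply_ite f, map_zero]
  have h2 : (fun i j k l => f (leg2 N X i j k l)) = leg2 N (fun i j => f (X i j)) := by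
    funext i j k l
    simp only [leg2, apply_ite f, map_zero]
  have h3 : (fun i j k l => f (scal B Z i j k l)) = scal C Z := by
    funext i j k l
    simp only [scal, AlgHom.commutes]
  constructor
  · rw [map_dot, h3]
    simp only [map_dot, h1, h2]
  · rw [map_dot, h1]
    simp only [map_dot, h3, h2]

theorem hom_rll {C : Type} [Ring C] [Algebra K C] (f : B →ₐ[K] C) {N : ℕ}
    {X : Idx N → Idx N → B} {Z : Mat2 N N N N K}
    (h : leg1 N X ⋆ leg2 N X ⋆ scal B Z = scal B Z ⋆ leg2 N X ⋆ leg1 N X) :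
    leg1 N (fun i j => f (X i j)) ⋆ leg2 N (fun i j => f (X i j)) ⋆ scal C Z =
      scal C Z ⋆ leg2 N (fun i j => f (X i j)) ⋆ leg1 N (fun i j => f (X i j)) := by
  funext i j k l
  rw [← (map_rll f X Z i j k l).1, ← (map_rll f X Z i j k l).2, h]

theorem leg_one_dot {N : ℕ} (Z : Mat2 N N N N B) :
    leg1 N (fun i j => if i = j then 1 else 0) ⋆ Z = Z ∧
    leg2 N (fun i j => if i = j then 1 else 0) ⋆ Z = Z ∧
    Z ⋆ leg1 N (fun i j => if i = j then 1 else 0) = Z ∧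
    Z ⋆ leg2 N (fun i j => if i = j then 1 else 0) = Z := by
  have e1 : (leg1 N (fun i j => if i = j then 1 else 0) : Mat2 N N N N B) =
      fun i j k l => if i = j then (if k = l then 1 else 0) else 0 := by
    funext i j k l
    unfold leg1
    by_cases h : i = j <;> by_cases h' : k = l <;> simp [h, h']
  have e2 : (leg2 N (fun i j => if i = j then 1 else 0) : Mat2 N N N N B) =
      fun i j k l => if i = j then (if k = l then 1 else 0) else 0 := rfl
  have hl : (fun i j k l => if i = j then (if k = l then 1 else 0) else 0 : Mat2 N N N N B) ⋆ Z
      = Z := by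
    funext i i' k k'
    rw [dot_apply, Finset.sum_eq_single i, Finset.sum_eq_single k]
    · have e : (par i + par i + par k + par k) * (par i + par i' + par k + par k')
          + (par k + par k) * (par i + par i') = 0 := by
        linear_combination (par i + par i' + par k + par k') * add_self_two (par i)
          + (par i + par i' + par k + par k' + par i + par i') * add_self_two (par k)
      simp [e, sgn]
    · intro l _ h
      simp [Ne.symm h]
    · simp
    · intro j _ h
      simp [Ne.symm h]
    · simp
  have hr : Z ⋆ (fun i j k l => if i = j then (if k = l then 1 else 0) else 0 : Mat2 N N N N B)
      = Z := by
    funext i i' k k'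
    rw [dot_apply, Finset.sum_eq_single i', Finset.sum_eq_single k']
    · have e : (par i + par i' + par k + par k') * (par i' + par i' + par k' + par k')
          + (par k + par k') * (par i' + par i') = 0 := by
        linear_combination (par i + par i' + par k + par k' + par k + par k') *
            add_self_two (par i') + (par i + par i' + par k + par k') * add_self_two (par k')
      simp [e, sgn]
    · intro l _ h
      simp [h]
    · simp
    · intro j _ h
      simp [h]
    · simp
  rw [e1, e2]
  exact ⟨hl, hl, hr, hr⟩

end DotLemmas

theorem L_inv {N : ℕ} (i : Idx N) : L i i * L (-i) (-i) = 1 := by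
  have h := RingQuot.mkAlgHom_rel K (URel.inv i)
  rwa [map_mul, map_one] at h

theorem L_eq_zero {N : ℕ} {i j : Idx N} (h : ¬ i ≤ j) : L i j = 0 := by
  simp [L, freeL, h]

theorem L_rll (N : ℕ) :
    leg1 N (genMat (L (N := N))) ⋆ leg2 N (genMat L) ⋆ scal _ (S N) =
      scal _ (S N) ⋆ leg2 N (genMat L) ⋆ leg1 N (genMat L) := by
  funext i j k l
  have h := RingQuot.mkAlgHom_rel K (URel.rll i j k l)
  rw [(map_rll _ _ _ _ _ _ _).1, (map_rll _ _ _ _ _ _ _).2] at h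
  have e : (fun i j => RingQuot.mkAlgHom K (URel N) (genMat freeL i j)) = genMat L := by
    funext i j
    simp [genMat, L]
  rwa [e] at h

/-- Algebra homomorphisms out of `U_q(𝔮_N)`. -/
def liftU {N : ℕ} {B : Type} [Ring B] [Algebra K B] (M : Idx N → Idx N → B)
    (h0 : ∀ i j, ¬ i ≤ j → M i j = 0) (hinv : ∀ i, M i i * M (-i) (-i) = 1)
    (hrll : leg1 N (genMat M) ⋆ leg2 N (genMat M) ⋆ scal B (S N) =
      scal B (S N) ⋆ leg2 N (genMat M) ⋆ leg1 N (genMat M)) : Uq N →ₐ[K] B :=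
  RingQuot.liftAlgHom K ⟨FreeAlgebra.lift K fun x : UGen N => M x.1.1 x.1.2, by
    have hM : ∀ i j : Idx N, FreeAlgebra.lift K (fun x : UGen N => M x.1.1 x.1.2) (freeL i j) =
        M i j := by
      intro i j
      unfold freeL
      split
      · simp
      · next h => rw [map_zero, h0 i j h]
    have hG : (fun i j => FreeAlgebra.lift K (fun x : UGen N => M x.1.1 x.1.2)
        (genMat freeL i j)) = genMat M := by
      funext i j
      rw [genMat, map_smul, hM, genMat]
    rintro _ _ (i | ⟨i, j, k, l⟩)
    · rw [map_mul, hM, hM, hinv, map_one]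
    · rw [(map_rll _ _ _ _ _ _ _).1, (map_rll _ _ _ _ _ _ _).2, hG, hrll]⟩

/-- The super tensor square `U_q(𝔮_N) ⊗ U_q(𝔮_N)`, with product
`(a ⊗ b)(a' ⊗ b') = (-1)^{|b||a'|} aa' ⊗ bb'`. -/
abbrev UU (N : ℕ) : Type := GradedTensorProduct K (gradeU N) (gradeU N)

/-- `Δ(L_{ij}) = ∑_k (-1)^{(|i|+|k|)(|k|+|j|)} L_{ik} ⊗ L_{kj}`. -/
def comulGen {N : ℕ} (i j : Idx N) : UU N :=
  ∑ k, sgn ((par i + par k) * (par k + par j)) • GradedTensorProduct.tmul K (L i k) (L k j)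

theorem tmul_sign {N : ℕ} (a₁ b₂ : Uq N) {d e : ZMod 2} {b₁ a₂ : Uq N}
    (hb : b₁ ∈ gradeU N d) (ha : a₂ ∈ gradeU N e) :
    (GradedTensorProduct.tmul K a₁ b₁ * GradedTensorProduct.tmul K a₂ b₂ : UU N) =
      sgn (d * e) • GradedTensorProduct.tmul K (a₁ * a₂) (b₁ * b₂) := by
  have h := GradedTensorProduct.tmul_coe_mul_coe_tmul (R := K) (gradeU N) (gradeU N) a₁ ⟨b₁, hb⟩
    ⟨a₂, ha⟩ b₂
  refine h.trans ?_
  have hc : ∀ x : ZMod 2, x = 0 ∨ x = 1 := by decide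
  rcases hc (d * e) with h | h <;> rw [h] <;> simp [sgn]

/-- The comultiplication `Δ : U_q(𝔮_N) → U_q(𝔮_N) ⊗ U_q(𝔮_N)`, `Δ(L) = L ⊗ L`. -/
def comulAlg (N : ℕ) : Uq N →ₐ[K] UU N :=
  liftU comulGen
    (by
      intro i j h
      refine Finset.sum_eq_zero fun k _ => ?_
      by_cases hk : i ≤ k
      · rw [L_eq_zero (fun hkj => h (hk.trans hkj))]
        simp
      · rw [L_eq_zero hk]
        simp)
    (by
      have hd : ∀ i : Idx N, comulGen i i = GradedTensorProduct.tmul K (L i i) (L i i) := by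
        intro i
        rw [comulGen, Finset.sum_eq_single i]
        · simp [add_self_two, sgn]
        · intro k _ hk
          by_cases h : i ≤ k
          · rw [L_eq_zero (fun hki => hk (le_antisymm hki h))]
            simp
          · rw [L_eq_zero h]
            simp
        · simp
      intro i
      rw [hd, hd, tmul_sign _ _ (L_mem i i) (L_mem (-i) (-i)), L_inv, add_self_two, zero_mul]
      simp [sgn]
      rfl)
    (by
      have e : genMat (comulGen (N := N)) =
          dot1 (fun i j => GradedTensorProduct.includeLeft (gradeU N) (gradeU N) (genMat L i j))
            (fun i j => GradedTensorProduct.includeRight (gradeU N) (gradeU N) (genMat L i j)) := by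
        funext i j
        rw [genMat, comulGen, dot1, Finset.smul_sum]
        refine Finset.sum_congr rfl fun k _ => ?_
        have hm : (GradedTensorProduct.includeLeft (gradeU N) (gradeU N) (L i k) *
            GradedTensorProduct.includeRight (gradeU N) (gradeU N) (L k j) : UU N) =
            GradedTensorProduct.tmul K (L i k) (L k j) :=
          GradedTensorProduct.tmul_one_mul_one_tmul _ _ _ _
        simp only [genMat, map_smul, smul_mul_assoc, mul_smul_comm, smul_smul, ← sgn_add, hm]
        congr 2
        linear_combination - add_self_two (par k)
      rw [e]
      refine rll_dot1 _ _ _ (hom_rll _ (L_rll N)) (hom_rll _ (L_rll N)) ?_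
      intro i j k l
      have hL : ∀ i j, genMat L i j ∈ gradeU N (par i + par j) := fun i j =>
        Submodule.smul_mem _ _ (L_mem i j)
      refine (tmul_sign 1 1 (hL i j) (hL k l)).trans ?_
      rw [one_mul, mul_one]
      congr 1
      exact (GradedTensorProduct.tmul_one_mul_one_tmul _ _ _ _).symm)

/-- The counit `ε : U_q(𝔮_N) → ℂ(q)`, `ε(L_{ij}) = δ_{ij}`. -/
def counitAlg (N : ℕ) : Uq N →ₐ[K] K :=
  liftU (fun i j => if i = j then 1 else 0)
    (by
      intro i j h
      rw [if_neg (fun e => h e.le)])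
    (by simp)
    (by
      have e : genMat (fun i j : Idx N => if i = j then (1 : K) else 0) =
          fun i j => if i = j then 1 else 0 := by
        funext i j
        by_cases h : i = j
        · subst h
          simp [genMat, add_self_two, sgn]
        · simp [genMat, h]
      have h := fun Z : Mat2 N N N N K => leg_one_dot Z
      rw [e, dot_assoc, dot_assoc, (h _).1, (h _).2.1, (h _).2.1, (h _).2.2.1])

/-- The comultiplication, as a linear map into the underlying tensor product. -/
def comul (N : ℕ) : Uq N →ₗ[K] Uq N ⊗[K] Uq N :=
  (GradedTensorProduct.of K (gradeU N) (gradeU N)).symm.toLinearMap ∘ₗ (comulAlg N).toLinearMap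

/-- The counit, as a linear map. -/
def counit (N : ℕ) : Uq N →ₗ[K] K := (counitAlg N).toLinearMap

/-! ### Supermodules, superalgebras and supermodule superalgebras -/

section Super

variable {U : Type} [Ring U] [Algebra K U] (gU : ZMod 2 → Submodule K U) [GradedAlgebra gU]

/-- The linear map `u ↦ (-1)^{d|u|} u`. -/
def twist (d : ZMod 2) : U →ₗ[K] U := ∑ e : ZMod 2, sgn (d * e) • GradedAlgebra.proj gU e

/-- The super flip `u ⊗ v ↦ (-1)^{|u||v|} v ⊗ u`. -/
def superFlip : U ⊗[K] U →ₗ[K] U ⊗[K] U :=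
  ∑ d : ZMod 2, (TensorProduct.comm K U U).toLinearMap ∘ₗ
    TensorProduct.map (GradedAlgebra.proj gU d) (twist gU d)

variable {M : Type} [AddCommGroup M] [Module K M] (gM : ZMod 2 → Submodule K M)

/-- The space `M`, graded by `gM`, with multiplication `μ` and unit `one`, is a unital associative
superalgebra. -/
structure IsSuperalgebra (μ : M →ₗ[K] M →ₗ[K] M) (one : M) : Prop where
  isInternal : DirectSum.IsInternal gM
  one_mem : one ∈ gM 0
  mul_mem : ∀ {d e : ZMod 2} {x y : M}, x ∈ gM d → y ∈ gM e → μ x y ∈ gM (d + e)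
  one_mul : ∀ x, μ one x = x
  mul_one : ∀ x, μ x one = x
  mul_assoc : ∀ x y z, μ (μ x y) z = μ x (μ y z)

/-- The linear map `ρ` makes the graded space `M` a (left) `U`-supermodule. -/
structure IsSupermodule (ρ : U →ₗ[K] Module.End K M) : Prop where
  isInternal : DirectSum.IsInternal gM
  act_mem : ∀ {d e : ZMod 2} {u : U} {x : M}, u ∈ gU d → x ∈ gM e → ρ u x ∈ gM (d + e)
  one_act : ∀ x, ρ 1 x = x
  mul_act : ∀ u v x, ρ (u * v) x = ρ u (ρ v x)

/-- The action `ρ` makes the superalgebra `(M, μ, one)` a supermodule superalgebra over `U` with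
comultiplication `Δ` and counit `ε`: one has `ρ_u(1) = ε(u) 1` and
`ρ_u(xy) = ∑ (-1)^{|x||u₍₂₎|} ρ_{u₍₁₎}(x) ρ_{u₍₂₎}(y)` for `x` homogeneous. -/
structure IsSupermoduleSuperalgebra (Δ : U →ₗ[K] U ⊗[K] U) (ε : U →ₗ[K] K)
    (μ : M →ₗ[K] M →ₗ[K] M) (one : M) (ρ : U →ₗ[K] Module.End K M) : Prop where
  isSuperalgebra : IsSuperalgebra gM μ one
  isSupermodule : IsSupermodule gU gM ρ
  act_one : ∀ u, ρ u one = ε u • one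
  act_mul : ∀ (u : U) (d : ZMod 2) (x y : M), x ∈ gM d →
    ρ u (μ x y) = TensorProduct.lift (μ.compl₁₂ (ρ.flip x) (ρ.flip y ∘ₗ twist gU d)) (Δ u)

variable {M' : Type} [AddCommGroup M'] [Module K M'] (gM' : ZMod 2 → Submodule K M')

/-- `f` is an (even) homomorphism of `U`-supermodules from `(M, ρ)` to `(M', ρ')`. -/
structure IsSupermoduleHom (ρ : U →ₗ[K] Module.End K M) (ρ' : U →ₗ[K] Module.End K M')
    (f : M →ₗ[K] M') : Prop where
  source : IsSupermodule gU gM ρ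
  target : IsSupermodule gU gM' ρ'
  map_mem : ∀ {d : ZMod 2} {x : M}, x ∈ gM d → f x ∈ gM' d
  map_act : ∀ u x, f (ρ u x) = ρ' u (f x)

end Super

section TensorAction

variable {U : Type} [Ring U] [Algebra K U] (gU : ZMod 2 → Submodule K U) [GradedAlgebra gU]
variable {A : Type} [Ring A] [Algebra K A] (gA : ZMod 2 → Submodule K A) [GradedAlgebra gA]
variable {B : Type} [Ring B] [Algebra K B] (gB : ZMod 2 → Submodule K B)

/-- The grading of a tensor product: `(A ⊗ B)_d = ∑_{e+f=d} A_e ⊗ B_f`. -/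
def tensorGrade (d : ZMod 2) : Submodule K (A ⊗[K] B) :=
  Submodule.span K {z | ∃ e f : ZMod 2, e + f = d ∧ ∃ x ∈ gA e, ∃ y ∈ gB f, z = x ⊗ₜ[K] y}

/-- The action of `U` on `A ⊗ B` through `Δ`:
`u (x ⊗ y) = ∑ (-1)^{|x||u₍₂₎|} ρ_{u₍₁₎}(x) ⊗ σ_{u₍₂₎}(y)`. -/
def tensorAct (Δ : U →ₗ[K] U ⊗[K] U) (ρ : U →ₗ[K] Module.End K A) (σ : U →ₗ[K] Module.End K B) :
    U →ₗ[K] Module.End K (A ⊗[K] B) :=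
  (∑ d : ZMod 2, TensorProduct.lift
    ((TensorProduct.mapBilinear (RingHom.id K) A B A B).compl₁₂
      (LinearMap.lcomp K A (GradedAlgebra.proj gA d) ∘ₗ ρ) (σ ∘ₗ twist gU d))) ∘ₗ Δ

/-- The action of `U` on the first factor: `u (x ⊗ y) = ρ_u(x) ⊗ y`. -/
def actFirst (ρ : U →ₗ[K] Module.End K A) : U →ₗ[K] Module.End K (A ⊗[K] B) :=
  (TensorProduct.mapBilinear (RingHom.id K) A B A B).flip LinearMap.id ∘ₗ ρ

/-- The action of `U` on the second factor: `u (x ⊗ y) = (-1)^{|x||u|} x ⊗ σ_u(y)`. -/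
def actSecond (σ : U →ₗ[K] Module.End K B) : U →ₗ[K] Module.End K (A ⊗[K] B) :=
  ∑ d : ZMod 2, TensorProduct.mapBilinear (RingHom.id K) A B A B (GradedAlgebra.proj gA d) ∘ₗ
    σ ∘ₗ twist gU d

end TensorAction

/-! ### The actions, the braiding and the braided product -/

/-- `Φ` is the action of `U_q(𝔮_n)` on `A_{r,n}`: it makes `A_{r,n}` a supermodule superalgebra and
`L^{[2]3} ⬝ T^{1[2]} = T^{1[2]} S^{13}`. With the entries moved to the right of the matrix units,
`L^{[2]3} ⬝ T^{1[2]} = ∑ (-1)^{(|a|+|b|)(|i|+|c|)} E_{ic} ⊗ Φ_{L_{ab}}(t_{ic}) ⊗ E_{ab}` has the entry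
`(-1)^{|a|+|b|} Φ_{L_{ab}}(t_{ic})` at `E_{ic} ⊗ E_{ab}`. -/
structure IsPhi (r n : ℕ) (Φ : Uq n →ₗ[K] Module.End K (Aq r n)) : Prop where
  isSupermoduleSuperalgebra : IsSupermoduleSuperalgebra (gradeU n) (gradeA r n) (comul n) (counit n)
    (LinearMap.mul K (Aq r n)) 1 Φ
  act_gen : ∀ (i : Idx r) (c a b : Idx n), sgn (par a + par b) • Φ (L a b) (t i c) =
    (leg1 n t ⋆ scal (Aq r n) (S n)) i c a b

/-- `Φ` is the action of `U_q(𝔮_n)` on `Ā_{s,n}`: it makes `Ā_{s,n}` a supermodule superalgebra and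
`L^{[2]3} ⬝ T̄^{1[2]} = (S⁻¹)^{13} T̄^{1[2]}`. -/
structure IsPhiBar (s n : ℕ) (Φ : Uq n →ₗ[K] Module.End K (Abar s n)) : Prop where
  isSupermoduleSuperalgebra : IsSupermoduleSuperalgebra (gradeU n) (gradeAbar s n) (comul n)
    (counit n) (LinearMap.mul K (Abar s n)) 1 Φ
  act_gen : ∀ (c : Idx n) (α : Idx s) (a b : Idx n),
    sgn (par a + par b) • Φ (L a b) (barMat tbar c α) =
      (scal (Abar s n) (Sinv n) ⋆ leg1 n (barMat tbar)) c α a b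

/-- `Ψ` is the action of `U_q(𝔮_s)` on `Ā_{s,n}`: it makes `Ā_{s,n}` a supermodule superalgebra over
`U_q(𝔮_s)^cop` and `L^{[2]3} ⬝ T̄^{1[2]} = T̄^{1[2]} S̃^{13}`, where
`S̃ = (1 ⊗ D^e) S (1 ⊗ D^{-e})`. -/
structure IsPsiBar (s n : ℕ) (e : ℤˣ) (Ψ : Uq s →ₗ[K] Module.End K (Abar s n)) : Prop where
  isSupermoduleSuperalgebra : IsSupermoduleSuperalgebra (gradeU s) (gradeAbar s n)
    (superFlip (gradeU s) ∘ₗ comul s) (counit s) (LinearMap.mul K (Abar s n)) 1 Ψ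
  act_gen : ∀ (c : Idx n) (α a b : Idx s),
    sgn (par a + par b) • Ψ (L a b) (barMat tbar c α) =
      (leg1 s (barMat tbar) ⋆ scal (Abar s n) (Stilde s e)) c α a b

/-- The entries of `T₊ = ∑_{i > 0} E_{ia} ⊗ t_{ia}`. -/
def tplus {r n : ℕ} (i : Idx r) (a : Idx n) : Aq r n := if 0 < i.1 then t i a else 0

/-- The space `O_{r,s} = A_{r,n} ⊗ Ā_{s,n}`. -/
abbrev Oq (r s n : ℕ) : Type := Aq r n ⊗[K] Abar s n

/-- `Υ : Ā_{s,n} ⊗ A_{r,n} → A_{r,n} ⊗ Ā_{s,n}` is the braiding: it is compatible with units and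
multiplications, and `Υ(T̄^{1[3]} T₊^{2[4]}) = T₊^{2[3]} (S⁻¹)^{12} T̄^{1[4]}`. -/
structure IsBraiding (r s n : ℕ) (Υ : Abar s n ⊗[K] Aq r n →ₗ[K] Oq r s n) : Prop where
  one_left : ∀ f : Aq r n, Υ (1 ⊗ₜ f) = f ⊗ₜ 1
  one_right : ∀ g : Abar s n, Υ (g ⊗ₜ 1) = 1 ⊗ₜ g
  gen : ∀ (b : Idx n) (α : Idx s) (i : Idx r) (a : Idx n),
    Υ (dotWith (fun x y => x ⊗ₜ[K] y) (leg1 r (barMat tbar)) (leg2 s tplus) b α i a) =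
      dotWith (fun x y => x ⊗ₜ[K] y) (leg2 n tplus ⋆ scal (Aq r n) (Sinv n))
        (leg1 n (barMat tbar)) b α i a
  mul_right : Υ ∘ₗ (LinearMap.mul' K (Aq r n)).lTensor (Abar s n) =
    (LinearMap.mul' K (Aq r n)).rTensor (Abar s n) ∘ₗ
      (TensorProduct.assoc K (Aq r n) (Aq r n) (Abar s n)).symm.toLinearMap ∘ₗ
      Υ.lTensor (Aq r n) ∘ₗ
      (TensorProduct.assoc K (Aq r n) (Abar s n) (Aq r n)).toLinearMap ∘ₗ
      Υ.rTensor (Aq r n) ∘ₗ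
      (TensorProduct.assoc K (Abar s n) (Aq r n) (Aq r n)).symm.toLinearMap
  mul_left : Υ ∘ₗ (LinearMap.mul' K (Abar s n)).rTensor (Aq r n) =
    (LinearMap.mul' K (Abar s n)).lTensor (Aq r n) ∘ₗ
      (TensorProduct.assoc K (Aq r n) (Abar s n) (Abar s n)).toLinearMap ∘ₗ
      Υ.rTensor (Abar s n) ∘ₗ
      (TensorProduct.assoc K (Abar s n) (Aq r n) (Abar s n)).symm.toLinearMap ∘ₗ
      Υ.lTensor (Abar s n) ∘ₗ
      (TensorProduct.assoc K (Abar s n) (Abar s n) (Aq r n)).toLinearMap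

/-- The braided multiplication `(mul ⊗ mul)(id ⊗ Υ ⊗ id)` of `O_{r,s}`. -/
def braidedMul {r s n : ℕ} (Υ : Abar s n ⊗[K] Aq r n →ₗ[K] Oq r s n) :
    Oq r s n →ₗ[K] Oq r s n →ₗ[K] Oq r s n :=
  TensorProduct.curry
    (TensorProduct.map (LinearMap.mul' K (Aq r n)) (LinearMap.mul' K (Abar s n)) ∘ₗ
      (TensorProduct.assoc K (Aq r n) (Aq r n) (Abar s n ⊗[K] Abar s n)).symm.toLinearMap ∘ₗ
      ((TensorProduct.assoc K (Aq r n) (Abar s n) (Abar s n)).toLinearMap ∘ₗ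
        Υ.rTensor (Abar s n) ∘ₗ
        (TensorProduct.assoc K (Abar s n) (Aq r n) (Abar s n)).symm.toLinearMap).lTensor
          (Aq r n) ∘ₗ
      (TensorProduct.assoc K (Aq r n) (Abar s n) (Oq r s n)).toLinearMap)

/-- The grading of `Ā_{s,n} ⊗ A_{r,n}`. -/
abbrev gradeAbarA (r s n : ℕ) : ZMod 2 → Submodule K (Abar s n ⊗[K] Aq r n) :=
  tensorGrade (gradeAbar s n) (gradeA r n)

/-- The grading of `O_{r,s}`. -/
abbrev gradeO (r s n : ℕ) : ZMod 2 → Submodule K (Oq r s n) :=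
  tensorGrade (gradeA r n) (gradeAbar s n)

end QueerBraid

end

open QueerBraid
open scoped TensorProduct

noncomputable section

namespace QueerBraid

/-! Everything rests on the Yang–Baxter equation for `S`. An entry of `S` depends on its indices
only through order, equality and negation, and three indices together with their negatives form a
set of at most six elements. After removal of signs the equation is therefore a finite computation
with polynomials in q, done for symmetric index sets of sizes 2, 4 and 6 (`ybe_basisVec`);
invertibility needs only sizes 2 and 4. Let X = `xMat (S N)` and Y = `yMat (S N)` be `S` with its
second, respectively first, leg read as a matrix space. Taking the third, first or middle tensor
factor of the equation as the matrix space gives S X¹X² = X²X¹S, Y¹Y²S = S Y²Y¹ and, up to a sign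
normalisation of X, X¹SY² = Y²SX¹.

Actions are encoded by homomorphisms. If the generators of U form a matrix ℓ with Δ(ℓ) = ℓ ⊗ ℓ and
ε(ℓ) = 1, and γ is the parity involution of A, then the axioms of a supermodule superalgebra follow
once x ↦ (ρ(ℓ_{ab})γ^{|b|}x)_{ab} is an even algebra homomorphism from A to matrices over A
(`IsMatAct.isSupermoduleSuperalgebra`). The three actions come from T ↦ TX, T̄ ↦ X⁻¹T̄ and T̄ ↦
T̄X̃, with X̃ a supertranspose of the conjugated leg. They respect the defining relations because a
product of two solutions with supercommuting entries is again a solution (`Mix.dot1`, `RLL.dot1`).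
That the resulting operators satisfy the quadratic relations of U_q says that a scalar matrix
intertwines two algebra homomorphisms into matrices of size N², so it suffices to look at generators
(`mix_opMat`, `mix_opMatT`), where it is again a leg form of the Yang–Baxter equation. An action is
determined by its values on generators, hence is unique.

The braiding is Υ(T̄_{bα} ⊗ x) = ∑_d γ^{|α|}ν_{bd}(x) ⊗ T̄_{dα}, where ν is a homomorphism from A to
matrices over A prescribed on the rows of T with positive index; such a prescription extends to all
rows by `mix_symmetrize`. The operators of ν satisfy the relation of T̄ with `S n` on both sides and
supercommute with left multiplication by T̄, so their product defines an algebra homomorphism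
`braidAct` from Ā to the endomorphisms of A ⊗ Ā. This is compatibility of Υ with products in Ā.
Multiplicativity of ν makes `braidAct` commute with the right action of A (`braidAct_rightAct`),
which is compatibility with products in A and also the reason for associativity of the braided
product.

Equivariance has to be checked only on T̄_{bα} ⊗ x (`BraidCompatible`). For Φ it is the exchange
relation between ν and the homomorphism of Φ, which on generators reads S⁻¹X⁻¹Y = YX⁻¹S⁻¹
(`mix_xMat_inv_yMat`). For Ψ̄ the braiding acts on the left index of T̄ and the action on the right
one, so that only signs have to match. The braided product then inherits both actions. -/

theorem neg_val {N : ℕ} (i : Idx N) : (-i).1 = -i.1 := rfl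

theorem neg_neg_idx {N : ℕ} (i : Idx N) : -(-i) = i := Subtype.ext (neg_neg i.1)

theorem val_ne_zero {N : ℕ} (i : Idx N) : i.1 ≠ 0 := (Finset.mem_erase.1 i.2).1

theorem neg_idx_ne {N : ℕ} (i : Idx N) : -i ≠ i := by
  intro h
  have h1 := congrArg Subtype.val h
  rw [neg_val] at h1
  exact val_ne_zero i (by omega)

theorem neg_idx_inj {N : ℕ} {i j : Idx N} : -i = -j ↔ i = j :=
  ⟨fun h => by rw [← neg_neg_idx i, h, neg_neg_idx], fun h => by rw [h]⟩

theorem neg_idx_lt {N : ℕ} {i j : Idx N} : -i < -j ↔ j < i := by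
  rw [← Subtype.coe_lt_coe, ← Subtype.coe_lt_coe, neg_val, neg_val, neg_lt_neg_iff]

theorem neg_idx_eq_comm {N : ℕ} {i j : Idx N} : i = -j ↔ j = -i :=
  ⟨fun h => by rw [h, neg_neg_idx], fun h => by rw [h, neg_neg_idx]⟩

/-! ### Signs and the parameter q. -/

theorem sgn_zero : sgn 0 = 1 := by simp [sgn]

theorem sgn_one : sgn 1 = -1 := by simp [sgn]

theorem sgn_mul_self (d : ZMod 2) : sgn d * sgn d = 1 := by
  rw [← sgn_add, add_self_two, sgn_zero]

theorem zmod_two_cases (d : ZMod 2) : d = 0 ∨ d = 1 := by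
  revert d; decide

theorem q_ne_zero : q ≠ 0 := RatFunc.X_ne_zero

/-! ### The unsigned R-matrix -/

/-- The matrix of `S` composed with the super flip and the ordinary flip. -/
def rMat (N : ℕ) (i j k l : Idx N) : K :=
  sgn (par i * par j + par j * par k + par k * par l) * S N i k j l

/-- The inverse of `rMat`. -/
def rMatInv (N : ℕ) (i j k l : Idx N) : K := sgn (par j * par k) * Sinv N i k j l

/-- The conditions are put in terms of the source e_k ⊗ e_l, which is sent to a combination of e_k ⊗
e_l, of e_l ⊗ e_k if k < l, and of e_{-l} ⊗ e_{-k} if -k < l. With the chosen signs the second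
coefficient has no sign at all. This is the form that `stepR` copies. -/
theorem rMat_apply {N : ℕ} (i j k l : Idx N) : rMat N i j k l =
    (if i = k ∧ j = l then sgn (par k * par l) * q ^ phi k l else 0) +
    ((if k < l then (if i = l ∧ j = k then q - q⁻¹ else 0) else 0) +
    (if -k < l then (if i = -l ∧ j = -k then sgn (par l) * (q - q⁻¹) else 0) else 0)) := by
  have h1 : (if i = k ∧ j = l then sgn (par k * par l) * q ^ phi k l else 0) =
      sgn (par i * par j + par j * par k + par k * par l) *
        (if i = k ∧ j = l then q ^ phi i j else 0) := by
    split
    · next h =>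
      obtain ⟨rfl, rfl⟩ := h
      congr 2
      generalize par i = a; generalize par j = b; revert a b; decide
    · simp
  have h2 : (if k < l then (if i = l ∧ j = k then q - q⁻¹ else 0) else 0) =
      sgn (par i * par j + par j * par k + par k * par l) * ((q - q⁻¹) *
        (if j < l then sgn (par j) * (if i = l ∧ k = j then 1 else 0) else 0)) := by
    by_cases h : i = l ∧ j = k
    · obtain ⟨rfl, rfl⟩ := h
      have e : sgn (par i * par j + par j * par j + par j * par i) * sgn (par j) = 1 := by
        rw [← sgn_add, ← sgn_zero]
        congr 1
        generalize par i = a; generalize par j = b; revert a b; decide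
      by_cases hk : j < i
      · simp only [if_pos hk, and_self, if_true]
        linear_combination (-(q - q⁻¹)) * e
      · simp [hk]
    · rw [if_neg h, if_neg (c := i = l ∧ k = j) (fun h' => h ⟨h'.1, h'.2.symm⟩)]
      simp
  have h3 : (if -k < l then (if i = -l ∧ j = -k then sgn (par l) * (q - q⁻¹) else 0) else 0) =
      sgn (par i * par j + par j * par k + par k * par l) * ((q - q⁻¹) *
        (if j < l then sgn (par j) * (if i = -l ∧ k = -j then 1 else 0) else 0)) := by
    by_cases h : i = -l ∧ j = -k
    · obtain ⟨rfl, rfl⟩ := h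
      have e : sgn (par (-l) * par (-k) + par (-k) * par k + par k * par l) * sgn (par (-k)) =
          sgn (par l) := by
        rw [← sgn_add]
        congr 1
        rw [par_neg, par_neg]
        generalize par k = a; generalize par l = b; revert a b; decide
      by_cases hk : -k < l
      · simp only [if_pos hk, neg_neg_idx, and_self, if_true]
        linear_combination (-(q - q⁻¹)) * e
      · simp [hk]
    · rw [if_neg h, if_neg (c := i = -l ∧ k = -j) (fun h' => h ⟨h'.1, neg_idx_eq_comm.1 h'.2⟩)]
      simp
  rw [h1, h2, h3, rMat, S, sMatrix]
  split_ifs <;> ring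

/-- The same three terms as for `rMat`, but the sign of the last one is now governed by k instead of
l. -/
theorem rMatInv_apply {N : ℕ} (i j k l : Idx N) : rMatInv N i j k l =
    (if i = k ∧ j = l then sgn (par k * par l) * q ^ (-phi k l) else 0) +
    ((if k < l then (if i = l ∧ j = k then -(q - q⁻¹) else 0) else 0) +
    (if -k < l then (if i = -l ∧ j = -k then sgn (par k) * (q - q⁻¹) else 0) else 0)) := by
  have h1 : (if i = k ∧ j = l then sgn (par k * par l) * q ^ (-phi k l) else 0) =
      sgn (par j * par k) * (if i = k ∧ j = l then q⁻¹ ^ phi i j else 0) := by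
    split
    · next h =>
      obtain ⟨rfl, rfl⟩ := h
      rw [inv_zpow', mul_comm (par i)]
    · simp
  have h2 : (if k < l then (if i = l ∧ j = k then -(q - q⁻¹) else 0) else 0) =
      sgn (par j * par k) * ((q⁻¹ - q) *
        (if j < l then sgn (par j) * (if i = l ∧ k = j then 1 else 0) else 0)) := by
    by_cases h : i = l ∧ j = k
    · obtain ⟨rfl, rfl⟩ := h
      have e : sgn (par j * par j) * sgn (par j) = 1 := by
        rw [← sgn_add, ← sgn_zero]
        congr 1
        generalize par j = b; revert b; decide
      by_cases hk : j < i
      · simp only [if_pos hk, and_self, if_true]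
        linear_combination ((q - q⁻¹)) * e
      · simp [hk]
    · rw [if_neg h, if_neg (c := i = l ∧ k = j) (fun h' => h ⟨h'.1, h'.2.symm⟩)]
      simp
  have h3 : (if -k < l then (if i = -l ∧ j = -k then sgn (par k) * (q - q⁻¹) else 0) else 0) =
      sgn (par j * par k) * ((q⁻¹ - q) *
        (if j < l then sgn (par j) * (if i = -l ∧ k = -j then 1 else 0) else 0)) := by
    by_cases h : i = -l ∧ j = -k
    · obtain ⟨rfl, rfl⟩ := h
      have e : sgn (par (-k) * par k) * sgn (par (-k)) = - sgn (par k) := by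
        rw [par_neg]
        rcases par_cases k with h | h <;> rw [h] <;> simp [sgn, add_self_two]
      by_cases hk : -k < l
      · simp only [if_pos hk, neg_neg_idx, and_self, if_true]
        linear_combination ((q - q⁻¹)) * e
      · simp [hk]
    · rw [if_neg h, if_neg (c := i = -l ∧ k = -j) (fun h' => h ⟨h'.1, neg_idx_eq_comm.1 h'.2⟩)]
      simp
  rw [h1, h2, h3, rMatInv, Sinv, sMatrix, inv_inv]
  split_ifs <;> ring

/-! ### Formal computation with the R-matrix

Linear combinations of basis vectors of a triple tensor product are represented by lists of terms;
coefficients are integer polynomials in `q`, given by their lists of coefficients. -/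

/-- Sum of polynomials. -/
def polyAdd : List ℤ → List ℤ → List ℤ
  | [], r => r
  | a :: p, [] => a :: p
  | a :: p, b :: r => (a + b) :: polyAdd p r

/-- Product of polynomials. -/
def polyMul : List ℤ → List ℤ → List ℤ
  | [], _ => []
  | a :: p, r => polyAdd (r.map (a * ·)) (0 :: polyMul p r)

/-- Value of a polynomial at `q`. -/
def polyEval : List ℤ → K
  | [] => 0
  | a :: p => (a : K) + q * polyEval p

theorem polyEval_add (p r : List ℤ) : polyEval (polyAdd p r) = polyEval p + polyEval r := by
  induction p generalizing r with
  | nil => simp [polyAdd, polyEval]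
  | cons a p ih =>
    cases r with
    | nil => simp [polyAdd, polyEval]
    | cons b r =>
      simp only [polyAdd, polyEval, ih]
      push_cast
      ring

theorem polyEval_map (a : ℤ) (r : List ℤ) : polyEval (r.map (a * ·)) = a * polyEval r := by
  induction r with
  | nil => simp [polyEval]
  | cons b r ih =>
    simp only [List.map_cons, polyEval, ih]
    push_cast
    ring

theorem polyEval_mul (p r : List ℤ) : polyEval (polyMul p r) = polyEval p * polyEval r := by
  induction p with
  | nil => simp [polyMul, polyEval]
  | cons a p ih =>
    simp only [polyMul, polyEval_add, polyEval_map, polyEval, ih]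
    push_cast
    ring

theorem polyEval_eq_zero (p : List ℤ) (h : p.all (· == 0) = true) : polyEval p = 0 := by
  induction p with
  | nil => rfl
  | cons a p ih =>
    simp only [List.all_cons, Bool.and_eq_true, beq_iff_eq] at h
    simp [polyEval, h.1, ih h.2]

/-- A term of a formal linear combination of basis vectors `e_a ⊗ e_b ⊗ e_c`. -/
abbrev Term (m : ℕ) : Type := (Fin m × Fin m × Fin m) × List ℤ

/-- `e_a ⊗ e_b ⊗ e_c`. -/
def basisVec {N : ℕ} (a b c : Idx N) : Idx N → Idx N → Idx N → K :=
  fun i j k => if i = a ∧ j = b ∧ k = c then 1 else 0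

/-- The vector represented by a list of terms. -/
def listVec {m N : ℕ} (f : Fin m → Idx N) : List (Term m) → Idx N → Idx N → Idx N → K
  | [] => 0
  | x :: v => polyEval x.2 • basisVec (f x.1.1) (f x.1.2.1) (f x.1.2.2) + listVec f v

theorem listVec_append {m N : ℕ} (f : Fin m → Idx N) (v w : List (Term m)) :
    listVec f (v ++ w) = listVec f v + listVec f w := by
  induction v with
  | nil => simp [listVec]
  | cons x v ih => simp [listVec, ih, add_assoc]

/-- Add a term to a linear combination. -/
def insertTerm {m : ℕ} (x : Term m) : List (Term m) → List (Term m)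
  | [] => [x]
  | y :: v => if x.1 = y.1 then (y.1, polyAdd x.2 y.2) :: v else y :: insertTerm x v

theorem listVec_insertTerm {m N : ℕ} (f : Fin m → Idx N) (x : Term m) (v : List (Term m)) :
    listVec f (insertTerm x v) = listVec f (x :: v) := by
  induction v with
  | nil => rfl
  | cons y v ih =>
    unfold insertTerm
    split
    · next h => simp only [listVec, polyEval_add, add_smul, h, add_assoc]
    · rw [listVec, ih]
      simp only [listVec]
      abel

/-- Whether a formal linear combination is zero. -/
def isZeroList {m : ℕ} (v : List (Term m)) : Bool :=
  (v.foldr insertTerm []).all fun x => x.2.all (· == 0)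

theorem listVec_eq_zero {m N : ℕ} (f : Fin m → Idx N) (v : List (Term m))
    (h : isZeroList v = true) : listVec f v = 0 := by
  have h1 : listVec f (v.foldr insertTerm []) = listVec f v := by
    clear h
    induction v with
    | nil => rfl
    | cons x v ih => rw [List.foldr_cons, listVec_insertTerm, listVec, ih, listVec]
  rw [← h1]
  unfold isZeroList at h
  generalize v.foldr insertTerm [] = w at h
  clear h1
  induction w with
  | nil => rfl
  | cons x w ih =>
    rw [List.all_cons, Bool.and_eq_true] at h
    rw [listVec, ih h.2, polyEval_eq_zero _ h.1]
    simp

/-- The coefficient `± q^{1 ± φ}`; the sign in the exponent is positive iff `s`. -/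
def diagPoly {m : ℕ} (s : Bool) (k l : Fin m) : List ℤ :=
  -- An index of `Fin m` is placed symmetrically about zero, so `k < k.rev` says that k is negative,
  -- and e is (-1)^{|k||l|}.
  let e : ℤ := if k < k.rev ∧ l < l.rev then -1 else 1
  -- The three lists are e, e q² and e q, that is q times e q⁻¹, e q and e; the extra factor q keeps
  -- all coefficients polynomial.
  if k = l ∨ k = l.rev then (if decide (l < l.rev) = s then [e] else [0, 0, e]) else [0, e]

/-- `q R (e_k ⊗ e_l)`. -/
def stepR {m : ℕ} (k l : Fin m) : List (Fin m × Fin m × List ℤ) :=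
  (k, l, diagPoly true k l) :: ((if k < l then [(l, k, [-1, 0, 1])] else []) ++
    if k.rev < l then [(l.rev, k.rev, if l < l.rev then [1, 0, -1] else [-1, 0, 1])] else [])

/-- `q R⁻¹ (e_k ⊗ e_l)`. -/
def stepRInv {m : ℕ} (k l : Fin m) : List (Fin m × Fin m × List ℤ) :=
  (k, l, diagPoly false k l) :: ((if k < l then [(l, k, [1, 0, -1])] else []) ++
    if k.rev < l then [(l.rev, k.rev, if k < k.rev then [1, 0, -1] else [-1, 0, 1])] else [])

section Apply

variable {m : ℕ} (st : Fin m → Fin m → List (Fin m × Fin m × List ℤ))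

/-- With `st` equal to `stepR` or `stepRInv`, these three functions multiply by q R or q R⁻¹ in the
two factors named, without collecting equal terms. -/
def apply12 (v : List (Term m)) : List (Term m) :=
  v.flatMap fun x => (st x.1.1 x.1.2.1).map fun y => ((y.1, y.2.1, x.1.2.2), polyMul x.2 y.2.2)

def apply13 (v : List (Term m)) : List (Term m) :=
  v.flatMap fun x => (st x.1.1 x.1.2.2).map fun y => ((y.1, x.1.2.1, y.2.1), polyMul x.2 y.2.2)

def apply23 (v : List (Term m)) : List (Term m) :=
  v.flatMap fun x => (st x.1.2.1 x.1.2.2).map fun y => ((x.1.1, y.1, y.2.1), polyMul x.2 y.2.2)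

end Apply

def negTerms {m : ℕ} (v : List (Term m)) : List (Term m) := v.map fun x => (x.1, x.2.map (-1 * ·))

/-- Whether every index is one of `a`, `b`, `c` up to reversal. -/
def covers {m : ℕ} (a b c : Fin m) : Bool :=
  (List.finRange m).all fun k =>
    k == a || k == b || k == c || k == a.rev || k == b.rev || k == c.rev

/-- The Yang–Baxter equation on the basis vectors which involve all indices up to reversal. -/
def checkYBE (m : ℕ) : Bool :=
  (List.finRange m).all fun a => (List.finRange m).all fun b => (List.finRange m).all fun c =>
    -- Vectors that miss some index up to reversal live on a smaller symmetric set and belong to a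
    -- smaller `m`. Both sides carry the same factor q³.
    !covers a b c || isZeroList (apply12 stepR (apply13 stepR (apply23 stepR [((a, b, c), [1])])) ++
      negTerms (apply23 stepR (apply13 stepR (apply12 stepR [((a, b, c), [1])]))))

/-- The equations `(q R⁻¹) (q R) = q² = (q R) (q R⁻¹)` on all basis vectors. -/
def checkInv (m : ℕ) : Bool :=
  (List.finRange m).all fun a => (List.finRange m).all fun b =>
    -- The third factor is idle and is filled with `a`, so that the machinery for three factors
    -- applies; the list `[0, 0, -1]` is -q².
    isZeroList (apply12 stepRInv (apply12 stepR [((a, b, a), [1])]) ++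
      [((a, b, a), [0, 0, -1])]) &&
    isZeroList (apply12 stepR (apply12 stepRInv [((a, b, a), [1])]) ++
      [((a, b, a), [0, 0, -1])])

-- Only these sizes are needed: three indices and their negatives form a set of at most six
-- elements, and zero is not an index, so the size is even. The size 0 contains no vector to test.
set_option maxRecDepth 100000 in
theorem checkYBE_two : checkYBE 2 = true := by decide +kernel
set_option maxRecDepth 100000 in
theorem checkYBE_four : checkYBE 4 = true := by decide +kernel
set_option maxRecDepth 100000 in
theorem checkYBE_six : checkYBE 6 = true := by decide +kernel
set_option maxRecDepth 100000 in
theorem checkInv_two : checkInv 2 = true := by decide +kernel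
set_option maxRecDepth 100000 in
theorem checkInv_four : checkInv 4 = true := by decide +kernel

/-! ### The Yang–Baxter equation -/

section Op

variable {N : ℕ} (R : Idx N → Idx N → Idx N → Idx N → K)

/-- Action on the first two tensor factors. -/
def op12 : (Idx N → Idx N → Idx N → K) →ₗ[K] (Idx N → Idx N → Idx N → K) where
  toFun v i₁ i₂ i₃ := ∑ j₁, ∑ j₂, R i₁ i₂ j₁ j₂ * v j₁ j₂ i₃
  map_add' v w := by
    funext i₁ i₂ i₃
    simp only [Pi.add_apply, mul_add, Finset.sum_add_distrib]
  map_smul' c v := by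
    funext i₁ i₂ i₃
    simp only [Pi.smul_apply, smul_eq_mul, Finset.mul_sum, RingHom.id_apply]
    exact Finset.sum_congr rfl fun _ _ => Finset.sum_congr rfl fun _ _ => by ring

/-- Action on the first and third tensor factors. -/
def op13 : (Idx N → Idx N → Idx N → K) →ₗ[K] (Idx N → Idx N → Idx N → K) where
  toFun v i₁ i₂ i₃ := ∑ j₁, ∑ j₃, R i₁ i₃ j₁ j₃ * v j₁ i₂ j₃
  map_add' v w := by
    funext i₁ i₂ i₃
    simp only [Pi.add_apply, mul_add, Finset.sum_add_distrib]
  map_smul' c v := by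
    funext i₁ i₂ i₃
    simp only [Pi.smul_apply, smul_eq_mul, Finset.mul_sum, RingHom.id_apply]
    exact Finset.sum_congr rfl fun _ _ => Finset.sum_congr rfl fun _ _ => by ring

/-- Action on the last two tensor factors. -/
def op23 : (Idx N → Idx N → Idx N → K) →ₗ[K] (Idx N → Idx N → Idx N → K) where
  toFun v i₁ i₂ i₃ := ∑ j₂, ∑ j₃, R i₂ i₃ j₂ j₃ * v i₁ j₂ j₃
  map_add' v w := by
    funext i₁ i₂ i₃
    simp only [Pi.add_apply, mul_add, Finset.sum_add_distrib]
  map_smul' c v := by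
    funext i₁ i₂ i₃
    simp only [Pi.smul_apply, smul_eq_mul, Finset.mul_sum, RingHom.id_apply]
    exact Finset.sum_congr rfl fun _ _ => Finset.sum_congr rfl fun _ _ => by ring

theorem op12_basisVec (a b c i₁ i₂ i₃ : Idx N) :
    op12 R (basisVec a b c) i₁ i₂ i₃ = if i₃ = c then R i₁ i₂ a b else 0 := by
  change ∑ j₁, ∑ j₂, R i₁ i₂ j₁ j₂ * basisVec a b c j₁ j₂ i₃ = _
  rw [Finset.sum_eq_single a, Finset.sum_eq_single b]
  · simp [basisVec]
  · intro j _ h; simp [basisVec, h]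
  · simp
  · intro j _ h; simp [basisVec, h]
  · simp

theorem op13_basisVec (a b c i₁ i₂ i₃ : Idx N) :
    op13 R (basisVec a b c) i₁ i₂ i₃ = if i₂ = b then R i₁ i₃ a c else 0 := by
  change ∑ j₁, ∑ j₃, R i₁ i₃ j₁ j₃ * basisVec a b c j₁ i₂ j₃ = _
  rw [Finset.sum_eq_single a, Finset.sum_eq_single c]
  · simp [basisVec]
  · intro j _ h; simp [basisVec, h]
  · simp
  · intro j _ h; simp [basisVec, h]
  · simp

theorem op23_basisVec (a b c i₁ i₂ i₃ : Idx N) :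
    op23 R (basisVec a b c) i₁ i₂ i₃ = if i₁ = a then R i₂ i₃ b c else 0 := by
  change ∑ j₂, ∑ j₃, R i₂ i₃ j₂ j₃ * basisVec a b c i₁ j₂ j₃ = _
  rw [Finset.sum_eq_single b, Finset.sum_eq_single c]
  · simp [basisVec]
  · intro j _ h; simp [basisVec, h]
  · simp
  · intro j _ h; simp [basisVec, h]
  · simp

variable {m : ℕ} (f : Fin m → Idx N) (st : Fin m → Fin m → List (Fin m × Fin m × List ℤ))

/-- `st k l` is a list of terms with sum `q R (e_k ⊗ e_l)`. -/
def Represents : Prop := ∀ k l i j, q * R i j (f k) (f l) =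
  ((st k l).map fun y => if i = f y.1 ∧ j = f y.2.1 then polyEval y.2.2 else 0).sum

variable {R f st}

/-- The bridge between lists and operators. By linearity it is a statement about one basis vector,
where `Represents` gives the image as a list; nothing requires the listed basis vectors to be
distinct. -/
theorem op12_listVec (h : Represents R f st) (v : List (Term m)) :
    q • op12 R (listVec f v) = listVec f (apply12 st v) := by
  induction v with
  | nil =>
    change q • op12 R 0 = 0
    rw [LinearMap.map_zero, smul_zero]
  | cons x v ih =>
    rw [listVec, map_add, smul_add, ih]
    simp only [apply12, List.flatMap_cons]
    rw [listVec_append]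
    congr 1
    rw [map_smul]
    funext i₁ i₂ i₃
    rw [Pi.smul_apply, Pi.smul_apply, Pi.smul_apply, Pi.smul_apply, Pi.smul_apply, Pi.smul_apply,
      op12_basisVec]
    trans (polyEval x.2 * if i₃ = f x.1.2.2 then q * R i₁ i₂ (f x.1.1) (f x.1.2.1) else 0)
    · split <;> simp; ring
    rw [h]
    -- Once `h` is used, both sides depend only on the list of terms of the image, and the induction
    -- runs over that list.
    induction st x.1.1 x.1.2.1 with
    | nil => simp [listVec]
    | cons y w ihw =>
      rw [List.map_cons, List.map_cons, listVec, List.sum_cons, Pi.add_apply, Pi.add_apply,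
        Pi.add_apply, ← ihw]
      simp only [polyEval_mul, Pi.smul_apply, basisVec, smul_eq_mul]
      clear ihw ih h
      generalize (List.map (_ : _ → K) w).sum = z
      split_ifs <;> simp_all <;> ring

theorem op13_listVec (h : Represents R f st) (v : List (Term m)) :
    q • op13 R (listVec f v) = listVec f (apply13 st v) := by
  induction v with
  | nil =>
    change q • op13 R 0 = 0
    rw [LinearMap.map_zero, smul_zero]
  | cons x v ih =>
    rw [listVec, map_add, smul_add, ih]
    simp only [apply13, List.flatMap_cons]
    rw [listVec_append]
    congr 1
    rw [map_smul]
    funext i₁ i₂ i₃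
    rw [Pi.smul_apply, Pi.smul_apply, Pi.smul_apply, Pi.smul_apply, Pi.smul_apply, Pi.smul_apply,
      op13_basisVec]
    trans (polyEval x.2 * if i₂ = f x.1.2.1 then q * R i₁ i₃ (f x.1.1) (f x.1.2.2) else 0)
    · split <;> simp; ring
    rw [h]
    induction st x.1.1 x.1.2.2 with
    | nil => simp [listVec]
    | cons y w ihw =>
      rw [List.map_cons, List.map_cons, listVec, List.sum_cons, Pi.add_apply, Pi.add_apply,
        Pi.add_apply, ← ihw]
      simp only [polyEval_mul, Pi.smul_apply, basisVec, smul_eq_mul]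
      clear ihw ih h
      generalize (List.map (_ : _ → K) w).sum = z
      split_ifs <;> simp_all <;> ring

theorem op23_listVec (h : Represents R f st) (v : List (Term m)) :
    q • op23 R (listVec f v) = listVec f (apply23 st v) := by
  induction v with
  | nil =>
    change q • op23 R 0 = 0
    rw [LinearMap.map_zero, smul_zero]
  | cons x v ih =>
    rw [listVec, map_add, smul_add, ih]
    simp only [apply23, List.flatMap_cons]
    rw [listVec_append]
    congr 1
    rw [map_smul]
    funext i₁ i₂ i₃
    rw [Pi.smul_apply, Pi.smul_apply, Pi.smul_apply, Pi.smul_apply, Pi.smul_apply, Pi.smul_apply,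
      op23_basisVec]
    trans (polyEval x.2 * if i₁ = f x.1.1 then q * R i₂ i₃ (f x.1.2.1) (f x.1.2.2) else 0)
    · split <;> simp; ring
    rw [h]
    induction st x.1.2.1 x.1.2.2 with
    | nil => simp [listVec]
    | cons y w ihw =>
      rw [List.map_cons, List.map_cons, listVec, List.sum_cons, Pi.add_apply, Pi.add_apply,
        Pi.add_apply, ← ihw]
      simp only [polyEval_mul, Pi.smul_apply, basisVec, smul_eq_mul]
      clear ihw ih h
      generalize (List.map (_ : _ → K) w).sum = z
      split_ifs <;> simp_all <;> ring

end Op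

theorem listVec_negTerms {m N : ℕ} (f : Fin m → Idx N) (v : List (Term m)) :
    listVec f (negTerms v) = - listVec f v := by
  induction v with
  | nil => simp [negTerms, listVec]
  | cons x v ih =>
    have ih' := ih
    unfold negTerms at ih' ⊢
    rw [List.map_cons, listVec, ih', listVec, polyEval_map]
    simp only [Int.cast_neg, Int.cast_one, neg_mul, one_mul, neg_smul, neg_add]

/-! ### Transfer from `Fin m` to signed indices along odd increasing maps. -/

section Odd

variable {m N : ℕ} {f : Fin m → Idx N}

/-- For f odd and increasing, `k < k.rev` is f(k) < -f(k), i.e. f(k) < 0. -/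
theorem par_of_odd (hf : StrictMono f) (hodd : ∀ k, f k.rev = -f k)
    (k : Fin m) : par (f k) = if k < k.rev then 1 else 0 := by
  have h : (f k).1 < 0 ↔ k < k.rev := by
    rw [← hf.lt_iff_lt, hodd, ← Subtype.coe_lt_coe, neg_val]
    omega
  unfold par
  simp only [h]

theorem diagPoly_true (hf : StrictMono f) (hodd : ∀ k, f k.rev = -f k)
    (k l : Fin m) :
    polyEval (diagPoly true k l) = q * (sgn (par (f k) * par (f l)) * q ^ phi (f k) (f l)) := by
  have hq := q_ne_zero
  have hl : (f l).1 < 0 ↔ l < l.rev := by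
    rw [← hf.lt_iff_lt, hodd, ← Subtype.coe_lt_coe, neg_val]
    omega
  have hne : f l ≠ -f l := fun h => neg_idx_ne _ h.symm
  unfold phi diagPoly
  rw [par_of_odd hf hodd, par_of_odd hf hodd, ← hodd]
  simp only [hf.injective.eq_iff, hl]
  have hne' : l ≠ l.rev := fun h => hne (by rw [← hodd, ← h])
  by_cases h3 : k = l
  · subst h3
    by_cases h2 : k < k.rev <;> simp [h2, hne', polyEval, sgn, hq]
  by_cases h4 : k = l.rev
  · subst h4
    rw [Fin.rev_rev]
    by_cases h2 : l < l.rev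
    · simp [h2, h2.not_gt, hne'.symm, polyEval, sgn, hq]
    · simp [h2, hne'.symm, polyEval, sgn]
  · by_cases h1 : k < k.rev <;> by_cases h2 : l < l.rev <;> simp [h1, h2, h3, h4, polyEval, sgn]

theorem diagPoly_false (hf : StrictMono f) (hodd : ∀ k, f k.rev = -f k)
    (k l : Fin m) :
    polyEval (diagPoly false k l) =
      q * (sgn (par (f k) * par (f l)) * q ^ (-phi (f k) (f l))) := by
  have hq := q_ne_zero
  have hl : (f l).1 < 0 ↔ l < l.rev := by
    rw [← hf.lt_iff_lt, hodd, ← Subtype.coe_lt_coe, neg_val]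
    omega
  have hne : f l ≠ -f l := fun h => neg_idx_ne _ h.symm
  unfold phi diagPoly
  rw [par_of_odd hf hodd, par_of_odd hf hodd, ← hodd]
  simp only [hf.injective.eq_iff, hl]
  have hne' : l ≠ l.rev := fun h => hne (by rw [← hodd, ← h])
  by_cases h3 : k = l
  · subst h3
    by_cases h2 : k < k.rev <;> simp [h2, hne', polyEval, sgn, hq]
  by_cases h4 : k = l.rev
  · subst h4
    rw [Fin.rev_rev]
    by_cases h2 : l < l.rev
    · simp [h2, h2.not_gt, hne'.symm, polyEval, sgn]
    · simp [h2, hne'.symm, polyEval, sgn, hq]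
  · by_cases h1 : k < k.rev <;> by_cases h2 : l < l.rev <;> simp [h1, h2, h3, h4, polyEval, sgn]

/-- Entries of `rMat` see only comparison, equality, negation and parity of indices, and an odd
increasing map preserves all of these. Hence one computation over `Fin m` is valid for every N. -/
theorem represents_stepR (hf : StrictMono f) (hodd : ∀ k, f k.rev = -f k)
    : Represents (rMat N) f stepR := by
  intro k l i j
  have hq := q_ne_zero
  rw [rMat_apply, stepR, List.map_cons, List.sum_cons, List.map_append, List.sum_append, mul_add,
    mul_add]
  rw [diagPoly_true hf hodd, ← hodd, ← hodd, par_of_odd hf hodd l,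
    mul_ite, mul_zero]
  simp only [hf.lt_iff_lt]
  have hx : q * (q - q⁻¹) = q * q - 1 := by field_simp
  congr 2
  · split
    · simp only [List.map_cons, List.map_nil, List.sum_cons, List.sum_nil, add_zero, polyEval,
        mul_ite, mul_zero]
      split_ifs
      · push_cast; linear_combination hx
      · rfl
    · simp
  · split
    · simp only [List.map_cons, List.map_nil, List.sum_cons, List.sum_nil, add_zero,
        mul_ite, mul_zero]
      split_ifs
      · simp only [polyEval, sgn_one]; push_cast; linear_combination -hx
      · simp only [polyEval, sgn_zero]; push_cast; linear_combination hx
      · rfl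
    · simp

theorem represents_stepRInv (hf : StrictMono f) (hodd : ∀ k, f k.rev = -f k)
    : Represents (rMatInv N) f stepRInv := by
  intro k l i j
  have hq := q_ne_zero
  rw [rMatInv_apply, stepRInv, List.map_cons, List.sum_cons, List.map_append, List.sum_append,
    mul_add, mul_add]
  rw [diagPoly_false hf hodd, ← hodd, ← hodd, par_of_odd hf hodd k,
    mul_ite, mul_zero]
  simp only [hf.lt_iff_lt]
  have hx : q * (q - q⁻¹) = q * q - 1 := by field_simp
  congr 2
  · split
    · simp only [List.map_cons, List.map_nil, List.sum_cons, List.sum_nil, add_zero, polyEval,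
        mul_ite, mul_zero]
      split_ifs
      · push_cast; linear_combination -hx
      · rfl
    · simp
  · split
    · simp only [List.map_cons, List.map_nil, List.sum_cons, List.sum_nil, add_zero,
        mul_ite, mul_zero]
      split_ifs
      · simp only [polyEval, sgn_one]; push_cast; linear_combination -hx
      · simp only [polyEval, sgn_zero]; push_cast; linear_combination hx
      · rfl
    · simp

theorem listVec_eq_of_check {v w : List (Term m)} (h : isZeroList (v ++ negTerms w) = true) :
    listVec f v = listVec f w := by
  have h1 := listVec_eq_zero f _ h
  rwa [listVec_append, listVec_negTerms, add_neg_eq_zero] at h1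

theorem ybe_basisVec_of_odd (hf : StrictMono f) (hodd : ∀ k, f k.rev = -f k)
    (hc : checkYBE m = true) {a b c : Fin m} (habc : covers a b c = true) :
    op12 (rMat N) (op13 (rMat N) (op23 (rMat N) (basisVec (f a) (f b) (f c)))) =
      op23 (rMat N) (op13 (rMat N) (op12 (rMat N) (basisVec (f a) (f b) (f c)))) := by
  have h := represents_stepR hf hodd
  have e : basisVec (f a) (f b) (f c) = listVec f [((a, b, c), [1])] := by
    simp [listVec, polyEval]
  unfold checkYBE at hc
  simp only [List.all_eq_true, List.mem_finRange, true_imp_iff] at hc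
  have h0 := hc a b c
  rw [habc, Bool.not_true, Bool.false_or] at h0
  have h1 := listVec_eq_of_check (f := f) h0
  rw [← op12_listVec h, ← op13_listVec h, ← op23_listVec h, ← op23_listVec h, ← op13_listVec h,
    ← op12_listVec h] at h1
  simp only [map_smul, smul_smul] at h1
  rw [e]
  -- Each of the three factors contributed one q, and q³ is invertible.
  exact smul_right_injective _ (mul_ne_zero q_ne_zero (mul_ne_zero q_ne_zero q_ne_zero)) h1

theorem inv_basisVec_of_odd (hf : StrictMono f) (hodd : ∀ k, f k.rev = -f k)
    (hc : checkInv m = true) (a b : Fin m) :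
    op12 (rMatInv N) (op12 (rMat N) (basisVec (f a) (f b) (f a))) = basisVec (f a) (f b) (f a) ∧
    op12 (rMat N) (op12 (rMatInv N) (basisVec (f a) (f b) (f a))) = basisVec (f a) (f b) (f a) := by
  have h := represents_stepR hf hodd
  have h' := represents_stepRInv hf hodd
  have e : basisVec (f a) (f b) (f a) = listVec f [((a, b, a), [1])] := by
    simp [listVec, polyEval]
  have e' : listVec f [((a, b, a), [0, 0, -1])] = -((q * q) • listVec f [((a, b, a), [1])]) := by
    simp [listVec, polyEval]
  unfold checkInv at hc
  simp only [List.all_eq_true, List.mem_finRange, true_imp_iff, Bool.and_eq_true] at hc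
  have h1 := listVec_eq_zero f _ (hc a b).1
  have h2 := listVec_eq_zero f _ (hc a b).2
  rw [listVec_append, e', add_neg_eq_zero, ← op12_listVec h', ← op12_listVec h, map_smul,
    smul_smul] at h1
  rw [listVec_append, e', add_neg_eq_zero, ← op12_listVec h, ← op12_listVec h', map_smul,
    smul_smul] at h2
  rw [e]
  exact ⟨smul_right_injective _ (mul_ne_zero q_ne_zero q_ne_zero) h1,
    smul_right_injective _ (mul_ne_zero q_ne_zero q_ne_zero) h2⟩

end Odd

/-- A finite set of indices stable under negation is the image of an odd increasing map. -/
theorem exists_odd_strictMono {N : ℕ} (s : Finset (Idx N)) (hs : ∀ i ∈ s, -i ∈ s) :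
    ∃ f : Fin s.card → Idx N, StrictMono f ∧ (∀ k, f k.rev = -f k) ∧ (∀ k, f k ∈ s) ∧
      ∀ i ∈ s, ∃ k, f k = i := by
  refine ⟨s.orderEmbOfFin rfl, (s.orderEmbOfFin rfl).strictMono, ?_, s.orderEmbOfFin_mem rfl, ?_⟩
  · intro k
    -- The map k ↦ -f(rev k) is also an increasing enumeration of `s`, because negation and reversal
    -- both reverse the order and `s` is stable. There is only one such enumeration.
    have h := Finset.orderEmbOfFin_unique (s := s) rfl (f := fun k => -(s.orderEmbOfFin rfl k.rev))
      (fun k => hs _ (s.orderEmbOfFin_mem rfl _)) (by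
        intro k l hkl
        exact neg_idx_lt.2 ((s.orderEmbOfFin rfl).strictMono (Fin.rev_lt_rev.2 hkl)))
    have h1 : -(s.orderEmbOfFin rfl k.rev) = s.orderEmbOfFin rfl k := congrFun h k
    rw [← h1, neg_neg_idx]
  · intro i hi
    have h := Finset.range_orderEmbOfFin s rfl
    have : i ∈ Set.range (s.orderEmbOfFin rfl) := by rw [h]; exact hi
    exact this

/-- The middle element of an odd `Fin m` is fixed by reversal, so its image would equal its own
negative, whereas 0 is not an index. -/
theorem even_of_odd {m N : ℕ} {f : Fin m → Idx N} (hodd : ∀ k, f k.rev = -f k) (h : m % 2 = 1) :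
    False := by
  have hk : (⟨m / 2, by omega⟩ : Fin m).rev = ⟨m / 2, by omega⟩ := by
    ext
    simp only [Fin.rev]
    omega
  exact neg_idx_ne _ ((hodd _).symm.trans (congrArg f hk))

/-- Neither side leaves the span of basis vectors with indices among ±a, ±b, ±c. Enumerating this
set increasingly turns the claim into one of the finite checks. -/
theorem ybe_basisVec {N : ℕ} (a b c : Idx N) :
    op12 (rMat N) (op13 (rMat N) (op23 (rMat N) (basisVec a b c))) =
      op23 (rMat N) (op13 (rMat N) (op12 (rMat N) (basisVec a b c))) := by
  have hs : ∀ i ∈ ({a, b, c, -a, -b, -c} : Finset (Idx N)),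
      -i ∈ ({a, b, c, -a, -b, -c} : Finset (Idx N)) := by
    intro i hi
    simp only [Finset.mem_insert, Finset.mem_singleton] at hi ⊢
    rcases hi with rfl | rfl | rfl | rfl | rfl | rfl <;> simp [neg_neg_idx]
  have hcard : ({a, b, c, -a, -b, -c} : Finset (Idx N)).card ≤ 6 := Finset.card_le_six
  obtain ⟨f, hf, hodd, hmem, hsurj⟩ := exists_odd_strictMono _ hs
  obtain ⟨x, hx⟩ := hsurj a (by simp)
  obtain ⟨y, hy⟩ := hsurj b (by simp)
  obtain ⟨z, hz⟩ := hsurj c (by simp)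
  -- By construction the set consists of the three chosen indices and their negatives, which is the
  -- case covered by the check.
  have hcov : covers x y z = true := by
    simp only [covers, List.all_eq_true, List.mem_finRange, true_imp_iff, Bool.or_eq_true,
      beq_iff_eq]
    intro k
    have hk := hmem k
    simp only [Finset.mem_insert, Finset.mem_singleton, ← hx, ← hy, ← hz, ← hodd,
      hf.injective.eq_iff] at hk
    tauto
  rw [← hx, ← hy, ← hz]
  clear hmem hx hy hz
  generalize ({a, b, c, -a, -b, -c} : Finset (Idx N)).card = m at *
  refine ybe_basisVec_of_odd hf hodd ?_ hcov
  -- The size is at most six: 0 contradicts the existence of an index, odd sizes are impossible by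
  -- `even_of_odd`, and the others have been computed.
  interval_cases m
  · exact x.elim0
  · exact (even_of_odd hodd rfl).elim
  · exact checkYBE_two
  · exact (even_of_odd hodd rfl).elim
  · exact checkYBE_four
  · exact (even_of_odd hodd rfl).elim
  · exact checkYBE_six

theorem inv_basisVec {N : ℕ} (a b : Idx N) :
    op12 (rMatInv N) (op12 (rMat N) (basisVec a b a)) = basisVec a b a ∧
    op12 (rMat N) (op12 (rMatInv N) (basisVec a b a)) = basisVec a b a := by
  have hs : ∀ i ∈ ({a, b, -a, -b} : Finset (Idx N)), -i ∈ ({a, b, -a, -b} : Finset (Idx N)) := by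
    intro i hi
    simp only [Finset.mem_insert, Finset.mem_singleton] at hi ⊢
    rcases hi with rfl | rfl | rfl | rfl <;> simp [neg_neg_idx]
  have hcard : ({a, b, -a, -b} : Finset (Idx N)).card ≤ 4 := Finset.card_le_four
  obtain ⟨f, hf, hodd, -, hsurj⟩ := exists_odd_strictMono _ hs
  obtain ⟨x, hx⟩ := hsurj a (by simp)
  obtain ⟨y, hy⟩ := hsurj b (by simp)
  rw [← hx, ← hy]
  generalize ({a, b, -a, -b} : Finset (Idx N)).card = m at *
  refine inv_basisVec_of_odd hf hodd ?_ x y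
  interval_cases m
  · exact x.elim0
  · exact (even_of_odd hodd rfl).elim
  · exact checkInv_two
  · exact (even_of_odd hodd rfl).elim
  · exact checkInv_four

/-- The Yang–Baxter equation `R₁₂ R₁₃ R₂₃ = R₂₃ R₁₃ R₁₂`. -/
theorem rMat_ybe {N : ℕ} (i₁ i₂ i₃ k₁ k₂ k₃ : Idx N) :
    ∑ j₁, ∑ j₂, ∑ j₃, rMat N i₁ i₂ j₁ j₂ * rMat N j₁ i₃ k₁ j₃ * rMat N j₂ j₃ k₂ k₃ =
      ∑ j₁, ∑ j₂, ∑ j₃, rMat N i₂ i₃ j₂ j₃ * rMat N i₁ j₃ j₁ k₃ * rMat N j₁ j₂ k₁ k₂ := by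
  have h := congrFun (congrFun (congrFun (ybe_basisVec k₁ k₂ k₃) i₁) i₂) i₃
  have e1 : op12 (rMat N) (op13 (rMat N) (op23 (rMat N) (basisVec k₁ k₂ k₃))) i₁ i₂ i₃ =
      ∑ j₁, ∑ j₂, ∑ j₃, rMat N i₁ i₂ j₁ j₂ * rMat N j₁ i₃ k₁ j₃ * rMat N j₂ j₃ k₂ k₃ := by
    change ∑ j₁, ∑ j₂, rMat N i₁ i₂ j₁ j₂ * (∑ a, ∑ j₃, rMat N j₁ i₃ a j₃ *
      op23 (rMat N) (basisVec k₁ k₂ k₃) a j₂ j₃) = _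
    refine Finset.sum_congr rfl fun j₁ _ => Finset.sum_congr rfl fun j₂ _ => ?_
    rw [Finset.sum_eq_single k₁, Finset.mul_sum]
    · refine Finset.sum_congr rfl fun j₃ _ => ?_
      rw [op23_basisVec, if_pos rfl, mul_assoc]
    · intro a _ ha
      simp [op23_basisVec, ha]
    · simp
  have e2 : op23 (rMat N) (op13 (rMat N) (op12 (rMat N) (basisVec k₁ k₂ k₃))) i₁ i₂ i₃ =
      ∑ j₂, ∑ j₃, ∑ j₁, rMat N i₂ i₃ j₂ j₃ * rMat N i₁ j₃ j₁ k₃ * rMat N j₁ j₂ k₁ k₂ := by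
    change ∑ j₂, ∑ j₃, rMat N i₂ i₃ j₂ j₃ * (∑ j₁, ∑ a, rMat N i₁ j₃ j₁ a *
      op12 (rMat N) (basisVec k₁ k₂ k₃) j₁ j₂ a) = _
    refine Finset.sum_congr rfl fun j₂ _ => Finset.sum_congr rfl fun j₃ _ => ?_
    rw [Finset.mul_sum]
    refine Finset.sum_congr rfl fun j₁ _ => ?_
    rw [Finset.sum_eq_single k₃]
    · rw [op12_basisVec, if_pos rfl, mul_assoc]
    · intro a _ ha
      simp [op12_basisVec, ha]
    · simp
  rw [e1, e2] at h
  rw [h]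
  rw [Finset.sum_comm' (t' := Finset.univ) (s' := fun _ => Finset.univ) (by simp)]
  rw [Finset.sum_congr rfl fun j₃ _ => Finset.sum_comm, Finset.sum_comm]
  exact Finset.sum_congr rfl fun j₁ _ => Finset.sum_comm

theorem rMat_inv {N : ℕ} (i₁ i₂ k₁ k₂ : Idx N) :
    ∑ j₁, ∑ j₂, rMatInv N i₁ i₂ j₁ j₂ * rMat N j₁ j₂ k₁ k₂ =
        (if i₁ = k₁ ∧ i₂ = k₂ then 1 else 0) ∧
    ∑ j₁, ∑ j₂, rMat N i₁ i₂ j₁ j₂ * rMatInv N j₁ j₂ k₁ k₂ =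
        (if i₁ = k₁ ∧ i₂ = k₂ then 1 else 0) := by
  have h := inv_basisVec k₁ k₂
  have h1 := congrFun (congrFun (congrFun h.1 i₁) i₂) k₁
  have h2 := congrFun (congrFun (congrFun h.2 i₁) i₂) k₁
  constructor
  · refine Eq.trans ?_ (h1.trans (by simp [basisVec]))
    refine Finset.sum_congr rfl fun j₁ _ => Finset.sum_congr rfl fun j₂ _ => ?_
    rw [op12_basisVec, if_pos rfl]
  · refine Eq.trans ?_ (h2.trans (by simp [basisVec]))
    refine Finset.sum_congr rfl fun j₁ _ => Finset.sum_congr rfl fun j₂ _ => ?_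
    rw [op12_basisVec, if_pos rfl]

/-! ### Matrix relations in entries -/

/-- A scalar matrix with two legs is even. -/
def EvenScal {a b c d : ℕ} (Z : Mat2 a b c d K) : Prop :=
  ∀ i k j l, par i + par k + par j + par l ≠ 0 → Z i k j l = 0

theorem evenScal_S (N : ℕ) : EvenScal (S N) := fun i k j l h => sMatrix_eq_zero q i k j l h

theorem evenScal_Sinv (N : ℕ) : EvenScal (Sinv N) := fun i k j l h => sMatrix_eq_zero q⁻¹ i k j l h

theorem sgn_congr {x y : ZMod 2} (h : x = y) : sgn x = sgn y := by rw [h]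

section Relations

variable {B : Type} [Ring B] [Algebra K B]

/-- `Z T¹ U² = U² T¹ W`. -/
def Mix {a b c d : ℕ} (Z : Mat2 a a c c K) (T : Idx a → Idx b → B) (U : Idx c → Idx d → B)
    (W : Mat2 b b d d K) : Prop :=
  scal B Z ⋆ leg1 c T ⋆ leg2 b U = leg2 a U ⋆ leg1 d T ⋆ scal B W

/-- `T¹ T² Z' = Z T² T¹`. -/
def RLL {a b : ℕ} (Z : Mat2 a a a a K) (T : Idx a → Idx b → B) (Z' : Mat2 b b b b K) : Prop :=
  leg1 a T ⋆ leg2 b T ⋆ scal B Z' = scal B Z ⋆ leg2 a T ⋆ leg1 b T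

/-- The pattern for all entrywise formulas below: entries of `Z` vanish unless their total parity is
zero, so one parity can be eliminated, and the sign produced by the two products collapses to a
short one. The remaining identity is polynomial over `ZMod 2`. -/
theorem scal_dot_legs {a b c d : ℕ} {Z : Mat2 a a c c K} (hZ : EvenScal Z)
    (T : Idx a → Idx b → B) (U : Idx c → Idx d → B) (i : Idx a) (x : Idx b) (j : Idx c)
    (y : Idx d) : (scal B Z ⋆ leg1 c T ⋆ leg2 b U) i x j y =
      ∑ k, ∑ l, (sgn ((par k + par x) * (par j + par y)) * Z i k j l) • (T k x * U l y) := by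
  rw [dot_assoc, dot_apply]
  refine Finset.sum_congr rfl fun k _ => Finset.sum_congr rfl fun l _ => ?_
  rw [leg1_dot_leg2, scal, mul_smul_comm, ← Algebra.smul_def, smul_smul, smul_smul, ← sgn_add]
  by_cases h : par i + par k + par j + par l = 0
  · congr 2
    refine sgn_congr ?_
    rw [show par i = par k + par j + par l by linear_combination h - add_self_two (par k + par j + par l)]
    generalize par k = k, par x = x, par j = j, par y = y, par l = l
    revert k x j y l; decide
  · rw [hZ i k j l h]
    simp

theorem legs_dot_scal {a b c d : ℕ} {Z : Mat2 b b d d K} (hZ : EvenScal Z)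
    (T : Idx a → Idx b → B) (U : Idx c → Idx d → B) (i : Idx a) (x : Idx b) (j : Idx c)
    (y : Idx d) : (leg2 a U ⋆ leg1 d T ⋆ scal B Z) i x j y =
      ∑ k, ∑ l, (sgn ((par j + par l) * (par k + par x)) * Z k x l y) • (U j l * T i k) := by
  rw [dot_apply]
  refine Finset.sum_congr rfl fun k _ => Finset.sum_congr rfl fun l _ => ?_
  rw [leg2_dot_leg1, scal, ← Algebra.commutes, ← Algebra.smul_def, smul_smul]
  by_cases h : par k + par x + par l + par y = 0
  · congr 2
    refine sgn_congr ?_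
    linear_combination (par i + par k + par j + par l) * h
  · rw [hZ k x l y h]
    simp

theorem rll_left_apply {a b c d : ℕ} {Z : Mat2 b b d d K} (hZ : EvenScal Z)
    (T : Idx a → Idx b → B) (U : Idx c → Idx d → B) (i : Idx a) (x : Idx b) (j : Idx c)
    (y : Idx d) : (leg1 c T ⋆ leg2 b U ⋆ scal B Z) i x j y =
      ∑ k, ∑ l, (sgn ((par j + par l) * (par i + par x)) * Z k x l y) • (T i k * U j l) := by
  rw [dot_apply]
  refine Finset.sum_congr rfl fun k _ => Finset.sum_congr rfl fun l _ => ?_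
  rw [leg1_dot_leg2, scal, ← Algebra.commutes, mul_smul_comm, ← Algebra.smul_def, smul_smul,
    smul_smul, ← sgn_add]
  by_cases h : par k + par x + par l + par y = 0
  · congr 2
    refine sgn_congr ?_
    linear_combination (par i + par k + par j + par l) * h +
      (par j + par l) * add_self_two (par k)
  · rw [hZ k x l y h]
    simp

theorem rll_right_apply {a b c d : ℕ} {Z : Mat2 a a c c K} (hZ : EvenScal Z)
    (T : Idx a → Idx b → B) (U : Idx c → Idx d → B) (i : Idx a) (x : Idx b) (j : Idx c)
    (y : Idx d) : (scal B Z ⋆ leg2 a U ⋆ leg1 d T) i x j y =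
      ∑ k, ∑ l, (sgn ((par j + par l) * (par k + par x)) * Z i k j l) • (U l y * T k x) := by
  rw [dot_assoc, dot_apply]
  refine Finset.sum_congr rfl fun k _ => Finset.sum_congr rfl fun l _ => ?_
  rw [leg2_dot_leg1, scal, ← Algebra.smul_def, smul_smul]
  by_cases h : par i + par k + par j + par l = 0
  · congr 2
    refine sgn_congr ?_
    linear_combination (par k + par x + par l + par y) * h
  · rw [hZ i k j l h]
    simp

/-- A family of scalar-linear identities between products of two entries: this is the form in which
the relation passes through algebra homomorphisms and is compared with presentations, with operators
and with the Yang–Baxter equation. -/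
theorem mix_iff {a b c d : ℕ} {Z : Mat2 a a c c K} {Z' : Mat2 b b d d K} (hZ : EvenScal Z)
    (hZ' : EvenScal Z') (T : Idx a → Idx b → B) (U : Idx c → Idx d → B) :
    Mix Z T U Z' ↔ ∀ i x j y,
      ∑ k, ∑ l, (sgn ((par k + par x) * (par j + par y)) * Z i k j l) • (T k x * U l y) =
      ∑ k, ∑ l, (sgn ((par j + par l) * (par k + par x)) * Z' k x l y) • (U j l * T i k) := by
  simp only [← scal_dot_legs hZ, ← legs_dot_scal hZ', Mix, funext_iff]

theorem rll_iff {a b : ℕ} {Z : Mat2 a a a a K} {Z' : Mat2 b b b b K} (hZ : EvenScal Z)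
    (hZ' : EvenScal Z') (T : Idx a → Idx b → B) :
    RLL Z T Z' ↔ ∀ i x j y,
      ∑ k, ∑ l, (sgn ((par j + par l) * (par i + par x)) * Z' k x l y) • (T i k * T j l) =
      ∑ k, ∑ l, (sgn ((par j + par l) * (par k + par x)) * Z i k j l) • (T l y * T k x) := by
  simp only [← rll_left_apply hZ', ← rll_right_apply hZ, RLL, funext_iff]

/-- Entries which supercommute, as elements of parity `|i| + |j|`. -/
def SuperComm {a b c d : ℕ} (T : Idx a → Idx b → B) (U : Idx c → Idx d → B) : Prop :=
  ∀ i j k l, T i j * U k l = sgn ((par i + par j) * (par k + par l)) • (U k l * T i j)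

theorem SuperComm.leg1_leg2 {a b c d : ℕ} {T : Idx a → Idx b → B} {U : Idx c → Idx d → B}
    (h : SuperComm T U) : leg1 c T ⋆ leg2 b U = leg2 a U ⋆ leg1 d T := by
  funext i i' k k'
  rw [leg1_dot_leg2, leg2_dot_leg1, h, smul_smul, sgn_mul_self, one_smul]

theorem SuperComm.leg2_leg1 {a b c d : ℕ} {T : Idx a → Idx b → B} {U : Idx c → Idx d → B}
    (h : SuperComm T U) : leg2 c T ⋆ leg1 b U = leg1 a U ⋆ leg2 d T := by
  funext i i' k k'
  rw [leg1_dot_leg2, leg2_dot_leg1, h, mul_comm (par k + par k')]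

/-- The usual fusion argument: supercommutation moves the second leg of T past the first leg of U,
after which the relations for U and for T apply in turn, with Z' cancelling between them. -/
theorem RLL.dot1 {a b c : ℕ} {Z : Mat2 a a a a K} {T : Idx a → Idx b → B}
    {Z' : Mat2 b b b b K} {U : Idx b → Idx c → B} {Z'' : Mat2 c c c c K} (hT : RLL Z T Z')
    (hU : RLL Z' U Z'') (h : SuperComm U T) : RLL Z (dot1 T U) Z'' := by
  unfold RLL at *
  rw [leg1_dot1, leg1_dot1, leg2_dot1, leg2_dot1]
  calc leg1 a T ⋆ leg1 a U ⋆ (leg2 c T ⋆ leg2 c U) ⋆ scal B Z''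
      = leg1 a T ⋆ (leg1 a U ⋆ leg2 c T) ⋆ leg2 c U ⋆ scal B Z'' := by simp only [dot_assoc]
    _ = leg1 a T ⋆ leg2 b T ⋆ (leg1 b U ⋆ leg2 c U ⋆ scal B Z'') := by
      rw [h.leg1_leg2]; simp only [dot_assoc]
    _ = leg1 a T ⋆ leg2 b T ⋆ scal B Z' ⋆ leg2 b U ⋆ leg1 c U := by
      rw [hU]; simp only [dot_assoc]
    _ = scal B Z ⋆ leg2 a T ⋆ (leg1 b T ⋆ leg2 b U) ⋆ leg1 c U := by
      rw [hT]; simp only [dot_assoc]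
    _ = _ := by rw [← h.leg2_leg1]; simp only [dot_assoc]

theorem Mix.dot1 {a b c : ℕ} {Z : Mat2 a a a a K} {T : Idx a → Idx b → B}
    {Z' : Mat2 b b b b K} {U : Idx b → Idx c → B} {Z'' : Mat2 c c c c K} (hT : Mix Z T T Z')
    (hU : Mix Z' U U Z'') (h : SuperComm U T) : Mix Z (dot1 T U) (dot1 T U) Z'' := by
  unfold Mix at *
  rw [leg1_dot1, leg1_dot1, leg2_dot1, leg2_dot1]
  calc scal B Z ⋆ (leg1 a T ⋆ leg1 a U) ⋆ (leg2 c T ⋆ leg2 c U)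
      = scal B Z ⋆ leg1 a T ⋆ (leg1 a U ⋆ leg2 c T) ⋆ leg2 c U := by simp only [dot_assoc]
    _ = scal B Z ⋆ leg1 a T ⋆ leg2 b T ⋆ leg1 b U ⋆ leg2 c U := by
      rw [h.leg1_leg2]; simp only [dot_assoc]
    _ = leg2 a T ⋆ leg1 b T ⋆ (scal B Z' ⋆ leg1 b U ⋆ leg2 c U) := by
      rw [hT]; simp only [dot_assoc]
    _ = leg2 a T ⋆ (leg1 b T ⋆ leg2 b U) ⋆ leg1 c U ⋆ scal B Z'' := by
      rw [hU]; simp only [dot_assoc]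
    _ = _ := by rw [← h.leg2_leg1]; simp only [dot_assoc]

variable {C : Type} [Ring C] [Algebra K C]

theorem RLL.map {a b : ℕ} {Z : Mat2 a a a a K} {Z' : Mat2 b b b b K} (hZ : EvenScal Z)
    (hZ' : EvenScal Z') {T : Idx a → Idx b → B} (h : RLL Z T Z') (f : B →ₐ[K] C) :
    RLL Z (fun i j => f (T i j)) Z' := by
  rw [rll_iff hZ hZ'] at h ⊢
  intro i x j y
  have := congrArg f (h i x j y)
  simpa only [map_sum, map_smul, map_mul] using this

theorem Mix.map {a b c d : ℕ} {Z : Mat2 a a c c K} {Z' : Mat2 b b d d K} (hZ : EvenScal Z)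
    (hZ' : EvenScal Z') {T : Idx a → Idx b → B} {U : Idx c → Idx d → B} (h : Mix Z T U Z')
    (f : B →ₐ[K] C) : Mix Z (fun i j => f (T i j)) (fun i j => f (U i j)) Z' := by
  rw [mix_iff hZ hZ'] at h ⊢
  intro i x j y
  have := congrArg f (h i x j y)
  simpa only [map_sum, map_smul, map_mul] using this

/-! ### Units -/

/-- The identity with two matrix legs. -/
def one2 (B : Type) [Ring B] (a c : ℕ) : Mat2 a a c c B :=
  fun i j k l => if i = j then (if k = l then 1 else 0) else 0

/-- The identity with one matrix leg. -/
def one1 (B : Type) [Ring B] (a : ℕ) : Idx a → Idx a → B := fun i j => if i = j then 1 else 0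

theorem one2_dot {a b c d : ℕ} (X : Mat2 a b c d B) : one2 B a c ⋆ X = X := by
  funext i i' k k'
  rw [dot_apply, Finset.sum_eq_single i, Finset.sum_eq_single k]
  · have e : (par i + par i + par k + par k) * (par i + par i' + par k + par k')
        + (par k + par k) * (par i + par i') = 0 := by
      simp [add_self_two, add_assoc]
    simp [e, sgn, one2]
  · intro l _ h
    simp [Ne.symm h, one2]
  · simp
  · intro j _ h
    simp [Ne.symm h, one2]
  · simp

theorem dot_one2 {a b c d : ℕ} (X : Mat2 a b c d B) : X ⋆ one2 B b d = X := by
  funext i i' k k'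
  rw [dot_apply, Finset.sum_eq_single i', Finset.sum_eq_single k']
  · have e : (par i + par i' + par k + par k') * (par i' + par i' + par k' + par k')
        + (par k + par k') * (par i' + par i') = 0 := by
      simp [add_self_two, add_assoc]
    simp [e, sgn, one2]
  · intro l _ h
    simp [h, one2]
  · simp
  · intro j _ h
    simp [h, one2]
  · simp

theorem leg1_one1 (a c : ℕ) : leg1 c (one1 B a) = one2 B a c := by
  funext i j k l
  unfold leg1 one1 one2
  split_ifs <;> rfl

theorem leg2_one1 (a c : ℕ) : leg2 c (one1 B a) = one2 B c a := rfl

theorem legs_inv {N : ℕ} {T U : Idx N → Idx N → B} (h : QueerBraid.dot1 T U = one1 B N) (c : ℕ) :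
    leg1 c T ⋆ leg1 c U = one2 B N c ∧ leg2 c T ⋆ leg2 c U = one2 B c N := by
  rw [← leg1_dot1, ← leg2_dot1, h, leg1_one1, leg2_one1]
  exact ⟨rfl, rfl⟩

/-- The inverse of a solution of `T¹ T² Z = Z T² T¹` solves `Z U¹ U² = U² U¹ Z`. -/
theorem RLL.inv {N : ℕ} {Z : Mat2 N N N N K} {T U : Idx N → Idx N → B} (h : RLL Z T Z)
    (hTU : QueerBraid.dot1 T U = one1 B N) (hUT : QueerBraid.dot1 U T = one1 B N) :
    Mix Z U U Z := by
  unfold RLL at h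
  unfold Mix
  have hT1 := (legs_inv hTU N).1
  have hT2 := (legs_inv hTU N).2
  have hU1 := (legs_inv hUT N).1
  have hU2 := (legs_inv hUT N).2
  calc scal B Z ⋆ leg1 N U ⋆ leg2 N U
      = leg2 N U ⋆ (leg1 N U ⋆ leg1 N T) ⋆ leg2 N T ⋆ scal B Z ⋆ leg1 N U ⋆ leg2 N U := by
        rw [hU1, dot_one2, hU2, one2_dot]
    _ = leg2 N U ⋆ leg1 N U ⋆ (leg1 N T ⋆ leg2 N T ⋆ scal B Z) ⋆ leg1 N U ⋆ leg2 N U := by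
        simp only [dot_assoc]
    _ = leg2 N U ⋆ leg1 N U ⋆ scal B Z ⋆ leg2 N T ⋆ (leg1 N T ⋆ leg1 N U) ⋆ leg2 N U := by
        rw [h]; simp only [dot_assoc]
    _ = leg2 N U ⋆ leg1 N U ⋆ scal B Z ⋆ (leg2 N T ⋆ leg2 N U) := by
        rw [hT1, dot_one2]; simp only [dot_assoc]
    _ = _ := by rw [hT2, dot_one2]

/-- The converse passage to `RLL.inv`: surround the relation for T by the legs of its inverse on
both sides. -/
theorem Mix.inv {N : ℕ} {Z : Mat2 N N N N K} {T U : Idx N → Idx N → B} (h : Mix Z T T Z)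
    (hTU : QueerBraid.dot1 T U = one1 B N) (hUT : QueerBraid.dot1 U T = one1 B N) :
    RLL Z U Z := by
  unfold Mix at h
  unfold RLL
  have hT1 := (legs_inv hTU N).1
  have hT2 := (legs_inv hTU N).2
  have hU1 := (legs_inv hUT N).1
  have hU2 := (legs_inv hUT N).2
  calc leg1 N U ⋆ leg2 N U ⋆ scal B Z
      = leg1 N U ⋆ leg2 N U ⋆ scal B Z ⋆ leg1 N T ⋆ (leg2 N T ⋆ leg2 N U) ⋆ leg1 N U := by
        rw [hT2, dot_one2, dot_assoc _ (leg1 N T) (leg1 N U), hT1, dot_one2]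
    _ = leg1 N U ⋆ leg2 N U ⋆ (scal B Z ⋆ leg1 N T ⋆ leg2 N T) ⋆ leg2 N U ⋆ leg1 N U := by
        simp only [dot_assoc]
    _ = leg1 N U ⋆ (leg2 N U ⋆ leg2 N T) ⋆ leg1 N T ⋆ scal B Z ⋆ leg2 N U ⋆ leg1 N U := by
        rw [h]; simp only [dot_assoc]
    _ = leg1 N U ⋆ leg1 N T ⋆ scal B Z ⋆ leg2 N U ⋆ leg1 N U := by
        rw [hU2, dot_one2]
    _ = _ := by rw [hU1, one2_dot]

/-- The relation `T¹ T² Z = Z T² T¹` in terms of the inverse of `Z`. -/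
theorem rll_iff_mix {N : ℕ} {Z Z' : Mat2 N N N N K} {T : Idx N → Idx N → B}
    (h : scal B Z ⋆ scal B Z' = one2 B N N) (h' : scal B Z' ⋆ scal B Z = one2 B N N) :
    RLL Z T Z ↔ Mix Z' T T Z' := by
  unfold RLL Mix
  constructor
  · intro hT
    calc scal B Z' ⋆ leg1 N T ⋆ leg2 N T
        = scal B Z' ⋆ leg1 N T ⋆ leg2 N T ⋆ (scal B Z ⋆ scal B Z') := by rw [h, dot_one2]
      _ = scal B Z' ⋆ (leg1 N T ⋆ leg2 N T ⋆ scal B Z) ⋆ scal B Z' := by simp only [dot_assoc]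
      _ = scal B Z' ⋆ scal B Z ⋆ (leg2 N T ⋆ leg1 N T ⋆ scal B Z') := by
        rw [hT]; simp only [dot_assoc]
      _ = _ := by rw [h', one2_dot]
  · intro hT
    calc leg1 N T ⋆ leg2 N T ⋆ scal B Z
        = scal B Z ⋆ scal B Z' ⋆ (leg1 N T ⋆ leg2 N T ⋆ scal B Z) := by rw [h, one2_dot]
      _ = scal B Z ⋆ (scal B Z' ⋆ leg1 N T ⋆ leg2 N T) ⋆ scal B Z := by simp only [dot_assoc]
      _ = scal B Z ⋆ leg2 N T ⋆ leg1 N T ⋆ (scal B Z' ⋆ scal B Z) := by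
        rw [hT]; simp only [dot_assoc]
      _ = _ := by rw [h', dot_one2]

end Relations

/-! ### Signed forms of the Yang–Baxter equation and of the inverse -/

theorem rMat_sgn {N : ℕ} (i j k l : Idx N) :
    S N i k j l = sgn (par i * par j + par j * par k + par k * par l) * rMat N i j k l := by
  rw [rMat, ← mul_assoc, sgn_mul_self, one_mul]

theorem rMatInv_sgn {N : ℕ} (i j k l : Idx N) :
    Sinv N i k j l = sgn (par j * par k) * rMatInv N i j k l := by
  rw [rMatInv, ← mul_assoc, sgn_mul_self, one_mul]

theorem rMat_eq_zero {N : ℕ} {i j k l : Idx N} (h : par i + par k + par j + par l ≠ 0) :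
    rMat N i j k l = 0 := by
  rw [rMat, evenScal_S N i k j l h, mul_zero]

theorem rMatInv_eq_zero {N : ℕ} {i j k l : Idx N} (h : par i + par k + par j + par l ≠ 0) :
    rMatInv N i j k l = 0 := by
  rw [rMatInv, evenScal_Sinv N i k j l h, mul_zero]

/-- Each matrix form of the Yang–Baxter equation comes with its own signs `sl` and `sr`. The
hypothesis says that, on the terms allowed by evenness, they differ from the signs relating `S` to
`rMat` by a constant c independent of the summation indices. It involves parities only, so in every
application it is decided over `ZMod 2`. -/
theorem S_ybe {N : ℕ} (i₁ i₂ i₃ k₁ k₂ k₃ : Idx N) (sl sr : ZMod 2 → ZMod 2 → ZMod 2 → ZMod 2)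
    (h : ∃ c : ZMod 2, (∀ x y z : ZMod 2, par i₁ + x + par i₂ + y = 0 →
        x + par k₁ + par i₃ + z = 0 → y + par k₂ + z + par k₃ = 0 →
        sl x y z + (par i₁ * par i₂ + par i₂ * x + x * y) + (x * par i₃ + par i₃ * par k₁ +
          par k₁ * z) + (y * z + z * par k₂ + par k₂ * par k₃) = c) ∧
      (∀ x y z : ZMod 2, par i₂ + y + par i₃ + z = 0 → par i₁ + x + z + par k₃ = 0 →
        x + par k₁ + y + par k₂ = 0 →
        sr x y z + (par i₂ * par i₃ + par i₃ * y + y * z) + (par i₁ * z + z * x + x * par k₃) +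
          (x * y + y * par k₁ + par k₁ * par k₂) = c)) :
    ∑ j₁, ∑ j₂, ∑ j₃, sgn (sl (par j₁) (par j₂) (par j₃)) *
        (S N i₁ j₁ i₂ j₂ * S N j₁ k₁ i₃ j₃ * S N j₂ k₂ j₃ k₃) =
      ∑ j₁, ∑ j₂, ∑ j₃, sgn (sr (par j₁) (par j₂) (par j₃)) *
        (S N i₂ j₂ i₃ j₃ * S N i₁ j₁ j₃ k₃ * S N j₁ k₁ j₂ k₂) := by
  obtain ⟨c, hl, hr⟩ := h
  have e := congrArg (sgn c * ·) (rMat_ybe i₁ i₂ i₃ k₁ k₂ k₃)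
  simp only [Finset.mul_sum] at e
  refine Eq.trans ?_ (e.trans ?_)
  · refine Finset.sum_congr rfl fun j₁ _ => Finset.sum_congr rfl fun j₂ _ =>
      Finset.sum_congr rfl fun j₃ _ => ?_
    by_cases h1 : par i₁ + par j₁ + par i₂ + par j₂ = 0
    · by_cases h2 : par j₁ + par k₁ + par i₃ + par j₃ = 0
      · by_cases h3 : par j₂ + par k₂ + par j₃ + par k₃ = 0
        · rw [← hl _ _ _ h1 h2 h3, rMat_sgn, rMat_sgn, rMat_sgn]
          simp only [sgn_add _ _]
          ring
        · rw [evenScal_S N _ _ _ _ h3, rMat_eq_zero h3]; simp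
      · rw [evenScal_S N _ _ _ _ h2, rMat_eq_zero h2]; simp
    · rw [evenScal_S N _ _ _ _ h1, rMat_eq_zero h1]; simp
  · refine Finset.sum_congr rfl fun j₁ _ => Finset.sum_congr rfl fun j₂ _ =>
      Finset.sum_congr rfl fun j₃ _ => ?_
    by_cases h1 : par i₂ + par j₂ + par i₃ + par j₃ = 0
    · by_cases h2 : par i₁ + par j₁ + par j₃ + par k₃ = 0
      · by_cases h3 : par j₁ + par k₁ + par j₂ + par k₂ = 0
        · rw [← hr _ _ _ h1 h2 h3, rMat_sgn, rMat_sgn, rMat_sgn]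
          simp only [sgn_add _ _]
          ring
        · rw [evenScal_S N _ _ _ _ h3, rMat_eq_zero h3]; simp
      · rw [evenScal_S N _ _ _ _ h2, rMat_eq_zero h2]; simp
    · rw [evenScal_S N _ _ _ _ h1, rMat_eq_zero h1]; simp

/-- As for `S_ybe`, the sign has to be constant along the sum; in addition it must be trivial on the
diagonal, the only place where the right-hand side is nonzero. -/
theorem S_inv_right {N : ℕ} (i₁ i₂ k₁ k₂ : Idx N) (sl : ZMod 2 → ZMod 2 → ZMod 2)
    (h : ∃ c : ZMod 2, (par i₁ = par k₁ → par i₂ = par k₂ → c = 0) ∧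
      ∀ x y : ZMod 2, par i₁ + x + par i₂ + y = 0 → x + par k₁ + y + par k₂ = 0 →
        sl x y + (par i₁ * par i₂ + par i₂ * x + x * y) + y * par k₁ = c) :
    ∑ j₁, ∑ j₂, sgn (sl (par j₁) (par j₂)) * (S N i₁ j₁ i₂ j₂ * Sinv N j₁ k₁ j₂ k₂) =
      if i₁ = k₁ ∧ i₂ = k₂ then 1 else 0 := by
  obtain ⟨c, hc, hl⟩ := h
  have e := congrArg (sgn c * ·) (rMat_inv i₁ i₂ k₁ k₂).2
  simp only [Finset.mul_sum] at e
  refine Eq.trans ?_ (e.trans ?_)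
  · refine Finset.sum_congr rfl fun j₁ _ => Finset.sum_congr rfl fun j₂ _ => ?_
    by_cases h1 : par i₁ + par j₁ + par i₂ + par j₂ = 0
    · by_cases h2 : par j₁ + par k₁ + par j₂ + par k₂ = 0
      · rw [← hl _ _ h1 h2, rMat_sgn, rMatInv_sgn]
        simp only [sgn_add _ _]
        ring
      · rw [evenScal_Sinv N _ _ _ _ h2, rMatInv_eq_zero h2]; simp
    · rw [evenScal_S N _ _ _ _ h1, rMat_eq_zero h1]; simp
  · split
    · next h => rw [hc (by rw [h.1]) (by rw [h.2]), sgn_zero, one_mul]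
    · rw [mul_zero]

theorem S_inv_left {N : ℕ} (i₁ i₂ k₁ k₂ : Idx N) (sl : ZMod 2 → ZMod 2 → ZMod 2)
    (h : ∃ c : ZMod 2, (par i₁ = par k₁ → par i₂ = par k₂ → c = 0) ∧
      ∀ x y : ZMod 2, par i₁ + x + par i₂ + y = 0 → x + par k₁ + y + par k₂ = 0 →
        sl x y + par i₂ * x + (x * y + y * par k₁ + par k₁ * par k₂) = c) :
    ∑ j₁, ∑ j₂, sgn (sl (par j₁) (par j₂)) * (Sinv N i₁ j₁ i₂ j₂ * S N j₁ k₁ j₂ k₂) =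
      if i₁ = k₁ ∧ i₂ = k₂ then 1 else 0 := by
  obtain ⟨c, hc, hl⟩ := h
  have e := congrArg (sgn c * ·) (rMat_inv i₁ i₂ k₁ k₂).1
  simp only [Finset.mul_sum] at e
  refine Eq.trans ?_ (e.trans ?_)
  · refine Finset.sum_congr rfl fun j₁ _ => Finset.sum_congr rfl fun j₂ _ => ?_
    by_cases h1 : par i₁ + par j₁ + par i₂ + par j₂ = 0
    · by_cases h2 : par j₁ + par k₁ + par j₂ + par k₂ = 0
      · rw [← hl _ _ h1 h2, rMat_sgn, rMatInv_sgn]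
        simp only [sgn_add _ _]
        ring
      · rw [evenScal_S N _ _ _ _ h2, rMat_eq_zero h2]; simp
    · rw [evenScal_Sinv N _ _ _ _ h1, rMatInv_eq_zero h1]; simp
  · split
    · next h => rw [hc (by rw [h.1]) (by rw [h.2]), sgn_zero, one_mul]
    · rw [mul_zero]

/-! ### One leg of `S` as a matrix over the other -/

/-- The second leg as a matrix. -/
def xMat {N : ℕ} (Z : Mat2 N N N N K) (j c : Idx N) : Matrix (Idx N) (Idx N) K :=
  Matrix.of fun a b => Z j c a b

/-- The first leg as a matrix. -/
def yMat {N : ℕ} (Z : Mat2 N N N N K) (a b : Idx N) : Matrix (Idx N) (Idx N) K :=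
  Matrix.of fun j c => Z j c a b

theorem sum_congr₃ {α β γ M : Type} [Fintype α] [Fintype β] [Fintype γ] [AddCommMonoid M]
    {f g : α → β → γ → M} (h : ∀ a b c, f a b c = g a b c) :
    ∑ a, ∑ b, ∑ c, f a b c = ∑ a, ∑ b, ∑ c, g a b c :=
  Finset.sum_congr rfl fun a _ => Finset.sum_congr rfl fun b _ => Finset.sum_congr rfl
    fun c _ => h a b c

theorem sum_congr₂ {α β M : Type} [Fintype α] [Fintype β] [AddCommMonoid M]
    {f g : α → β → M} (h : ∀ a b, f a b = g a b) : ∑ a, ∑ b, f a b = ∑ a, ∑ b, g a b :=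
  Finset.sum_congr rfl fun a _ => Finset.sum_congr rfl fun b _ => h a b

theorem sum_rotate {α β γ M : Type} [Fintype α] [Fintype β] [Fintype γ] [AddCommMonoid M]
    (f : α → β → γ → M) : ∑ a, ∑ b, ∑ c, f a b c = ∑ c, ∑ a, ∑ b, f a b c := by
  rw [Finset.sum_congr rfl fun a _ => Finset.sum_comm, Finset.sum_comm]

theorem sum_swap₂₃ {α β γ M : Type} [Fintype α] [Fintype β] [Fintype γ] [AddCommMonoid M]
    (f : α → β → γ → M) : ∑ a, ∑ b, ∑ c, f a b c = ∑ a, ∑ c, ∑ b, f a b c :=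
  Finset.sum_congr rfl fun _ _ => Finset.sum_comm

/-- The Yang–Baxter equation with the third tensor factor read as the matrix space. -/
theorem mix_xMat (N : ℕ) : Mix (S N) (xMat (S N)) (xMat (S N)) (S N) := by
  rw [mix_iff (evenScal_S N) (evenScal_S N)]
  intro i x j y
  ext p m
  simp only [Matrix.sum_apply, Matrix.smul_apply, Matrix.mul_apply, xMat, Matrix.of_apply,
    smul_eq_mul, Finset.mul_sum]
  have h := S_ybe i j p x y m (fun k _ _ => (k + par x) * (par j + par y))
    (fun k l _ => (par j + l) * (k + par x)) (by
      generalize par i = i, par x = x, par j = j, par y = y, par p = p, par m = m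
      revert i x j y p m
      decide +kernel)
  exact (sum_congr₃ fun k l o => by ring).trans (h.trans (sum_congr₃ fun k l o => by ring))

/-- The Yang–Baxter equation with the first tensor factor read as the matrix space. -/
theorem rll_yMat (N : ℕ) : RLL (S N) (yMat (S N)) (S N) := by
  rw [rll_iff (evenScal_S N) (evenScal_S N)]
  intro i x j y
  ext p m
  simp only [Matrix.sum_apply, Matrix.smul_apply, Matrix.mul_apply, yMat, Matrix.of_apply,
    smul_eq_mul, Finset.mul_sum]
  have h := S_ybe p i j m x y (fun _ _ l => (par j + l) * (par i + par x))
    (fun _ k l => (par j + l) * (k + par x)) (by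
      generalize par i = i, par x = x, par j = j, par y = y, par p = p, par m = m
      revert i x j y p m
      decide +kernel)
  rw [sum_rotate, sum_rotate (f := fun k l o => _ * (S N p o l y * S N o m k x))]
  exact (sum_congr₃ fun k l o => by ring).trans (h.trans (sum_congr₃ fun k l o => by ring))

theorem leg1_scal_leg2_apply {B : Type} [Ring B] [Algebra K B] {N : ℕ} {Z : Mat2 N N N N K}
    (hZ : EvenScal Z) (T U : Idx N → Idx N → B) (i x j y : Idx N) :
    (leg1 N T ⋆ scal B Z ⋆ leg2 N U) i x j y =
      ∑ k, ∑ l, (sgn ((par i + par k) * (par l + par y)) * Z k x j l) • (T i k * U l y) := by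
  rw [dot_apply, Finset.sum_eq_single x]
  · rw [Finset.sum_comm]
    refine Finset.sum_congr rfl fun l _ => ?_
    rw [dot_apply, Finset.sum_mul, Finset.smul_sum]
    refine Finset.sum_congr rfl fun k _ => ?_
    rw [Finset.sum_eq_single j]
    · simp only [leg1, leg2, if_true, scal]
      rw [smul_mul_assoc, ← Algebra.commutes, ← Algebra.smul_def, smul_smul, smul_mul_assoc,
        smul_smul]
      by_cases h : par k + par x + par j + par l = 0
      · rw [← sgn_add]
        congr 2
        refine sgn_congr ?_
        rw [show par x = par k + par j + par l by
          linear_combination h - add_self_two (par k + par j + par l)]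
        generalize par k = k, par i = i, par j = j, par y = y, par l = l
        revert k i j y l; decide
      · rw [hZ k x j l h]
        simp
    · intro o _ ho
      simp [leg1, Ne.symm ho]
    · simp
  · intro k _ hk
    simp [leg2, hk]
  · simp

theorem leg2_scal_leg1_apply {B : Type} [Ring B] [Algebra K B] {N : ℕ} {Z : Mat2 N N N N K}
    (hZ : EvenScal Z) (T U : Idx N → Idx N → B) (i x j y : Idx N) :
    (leg2 N U ⋆ scal B Z ⋆ leg1 N T) i x j y =
      ∑ k, ∑ l, (sgn ((par j + par l) * (par i + par k) + (par i + par k) * (par k + par x)) *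
        Z i k l y) • (U j l * T k x) := by
  rw [dot_apply]
  refine Finset.sum_congr rfl fun k _ => ?_
  rw [Finset.sum_eq_single y]
  · rw [dot_apply, Finset.sum_eq_single i, Finset.sum_mul, Finset.smul_sum]
    · refine Finset.sum_congr rfl fun l _ => ?_
      simp only [leg1, leg2, if_true, scal]
      rw [smul_mul_assoc, ← Algebra.commutes, ← Algebra.smul_def, smul_smul, smul_mul_assoc,
        smul_smul]
      by_cases h : par i + par k + par l + par y = 0
      · rw [← sgn_add]
        congr 2
        refine sgn_congr ?_
        rw [show par y = par i + par k + par l by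
          linear_combination h - add_self_two (par i + par k + par l)]
        generalize par k = k, par i = i, par j = j, par x = x, par l = l
        revert k i j x l; decide
      · rw [hZ i k l y h]
        simp
    · intro o _ ho
      simp [leg2, Ne.symm ho]
    · simp
  · intro l _ hl
    simp [leg1, hl]
  · simp

/-- The Yang–Baxter equation with the middle tensor factor read as the matrix space. That factor is
the second leg of one copy of `S` and the first leg of another; the sign in `genMat` compensates for
its position between the two legs. This is the source of the compatibility of the braiding with Φ.
-/
theorem xMat_S_yMat (N : ℕ) :
    leg1 N (genMat (xMat (S N))) ⋆ scal _ (S N) ⋆ leg2 N (yMat (S N)) =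
      leg2 N (yMat (S N)) ⋆ scal _ (S N) ⋆ leg1 N (genMat (xMat (S N))) := by
  funext i x j y
  rw [leg1_scal_leg2_apply (evenScal_S N), leg2_scal_leg1_apply (evenScal_S N)]
  ext p m
  simp only [Matrix.sum_apply, Matrix.smul_apply, Matrix.mul_apply, xMat, yMat, Matrix.of_apply,
    smul_eq_mul, Finset.mul_sum, genMat]
  have h := S_ybe i p j x m y (fun k _ l => (par i + k) * (l + par y) + (par i + k))
    (fun k _ l => (par j + l) * (par i + k) + (par i + k) * (k + par x) + (k + par x)) (by
      generalize par i = i, par x = x, par j = j, par y = y, par p = p, par m = m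
      revert i x j y p m
      decide +kernel)
  rw [sum_swap₂₃, sum_swap₂₃ (f := fun k l o => _ * (S N p o j l * _))]
  simp only [sgn_add ((_ : ZMod 2) * _) _, sgn_add (_ * _ + _ * _) _] at h ⊢
  exact (sum_congr₃ fun k l o => by ring).trans (h.trans (sum_congr₃ fun k l o => by ring))

/-! ### Inverses -/

theorem scal_S_inv (B : Type) [Ring B] [Algebra K B] (N : ℕ) :
    scal B (S N) ⋆ scal B (Sinv N) = one2 B N N ∧ scal B (Sinv N) ⋆ scal B (S N) = one2 B N N := by
  have hs : ∀ (i x j y : Idx N) (c : K), algebraMap K B (if i = x ∧ j = y then 1 else 0) =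
      one2 B N N i x j y := by
    intro i x j y c
    unfold one2
    split_ifs <;> simp_all
  constructor
  · funext i x j y
    have h := S_inv_right i j x y (fun k l => (par i + k + par j + l) * (k + par x + l + par y) +
      (par j + l) * (k + par x)) (by
        generalize par i = i, par x = x, par j = j, par y = y
        revert i x j y
        decide +kernel)
    rw [← hs i x j y 0, ← h, dot_apply, map_sum]
    refine Finset.sum_congr rfl fun k _ => ?_
    rw [map_sum]
    refine Finset.sum_congr rfl fun l _ => ?_
    simp only [scal, map_mul, Algebra.smul_def]
  · funext i x j y
    have h := S_inv_left i j x y (fun k l => (par i + k + par j + l) * (k + par x + l + par y) +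
      (par j + l) * (k + par x)) (by
        generalize par i = i, par x = x, par j = j, par y = y
        revert i x j y
        decide +kernel)
    rw [← hs i x j y 0, ← h, dot_apply, map_sum]
    refine Finset.sum_congr rfl fun k _ => ?_
    rw [map_sum]
    refine Finset.sum_congr rfl fun l _ => ?_
    simp only [scal, map_mul, Algebra.smul_def]

theorem one1_matrix_apply {N : ℕ} (i j p m : Idx N) :
    one1 (Matrix (Idx N) (Idx N) K) N i j p m = if i = j ∧ p = m then 1 else 0 := by
  unfold one1
  by_cases h : i = j
  · rw [if_pos h, Matrix.one_apply]
    simp [h]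
  · rw [if_neg h, Matrix.zero_apply]
    simp [h]

theorem one1_matrix_apply' {N : ℕ} (i j p m : Idx N) :
    one1 (Matrix (Idx N) (Idx N) K) N i j p m = if p = m ∧ i = j then 1 else 0 := by
  rw [one1_matrix_apply]
  simp only [and_comm]

/-- Again S S⁻¹ = 1 = S⁻¹ S, but with one leg multiplied as ordinary matrices, hence with different
signs than in `scal_S_inv`. -/
theorem xMat_inv (N : ℕ) :
    dot1 (xMat (S N)) (xMat (Sinv N)) = one1 _ N ∧ dot1 (xMat (Sinv N)) (xMat (S N)) = one1 _ N := by
  constructor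
  · funext i j
    ext p m
    rw [one1_matrix_apply, ← S_inv_right i p j m (fun k _ => (par i + k) * (k + par j)) (by
        generalize par i = i, par j = j, par p = p, par m = m
        revert i j p m
        decide +kernel)]
    simp only [dot1, Matrix.sum_apply, Matrix.smul_apply, Matrix.mul_apply, xMat, Matrix.of_apply,
      smul_eq_mul, Finset.mul_sum]
  · funext i j
    ext p m
    rw [one1_matrix_apply, ← S_inv_left i p j m (fun k _ => (par i + k) * (k + par j)) (by
        generalize par i = i, par j = j, par p = p, par m = m
        revert i j p m
        decide +kernel)]
    simp only [dot1, Matrix.sum_apply, Matrix.smul_apply, Matrix.mul_apply, xMat, Matrix.of_apply,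
      smul_eq_mul, Finset.mul_sum]

theorem yMat_inv (N : ℕ) :
    dot1 (yMat (S N)) (yMat (Sinv N)) = one1 _ N ∧ dot1 (yMat (Sinv N)) (yMat (S N)) = one1 _ N := by
  constructor
  · funext i j
    ext p m
    rw [one1_matrix_apply', ← S_inv_right p i m j (fun _ k => (par i + k) * (k + par j)) (by
        generalize par i = i, par j = j, par p = p, par m = m
        revert i j p m
        decide +kernel), Finset.sum_comm]
    simp only [dot1, Matrix.sum_apply, Matrix.smul_apply, Matrix.mul_apply, yMat, Matrix.of_apply,
      smul_eq_mul, Finset.mul_sum]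
  · funext i j
    ext p m
    rw [one1_matrix_apply', ← S_inv_left p i m j (fun _ k => (par i + k) * (k + par j)) (by
        generalize par i = i, par j = j, par p = p, par m = m
        revert i j p m
        decide +kernel), Finset.sum_comm]
    simp only [dot1, Matrix.sum_apply, Matrix.smul_apply, Matrix.mul_apply, yMat, Matrix.of_apply,
      smul_eq_mul, Finset.mul_sum]

theorem rll_xMat_inv (N : ℕ) : RLL (S N) (xMat (Sinv N)) (S N) :=
  (mix_xMat N).inv (xMat_inv N).1 (xMat_inv N).2

theorem mix_yMat_inv (N : ℕ) : Mix (S N) (yMat (Sinv N)) (yMat (Sinv N)) (S N) :=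
  (rll_yMat N).inv (yMat_inv N).1 (yMat_inv N).2

theorem dot1_genMat {B : Type} [Ring B] [Algebra K B] {N : ℕ} {T U : Idx N → Idx N → B}
    (h : dot1 T U = one1 B N) : dot1 (genMat T) (genMat U) = one1 B N := by
  funext i j
  have e : dot1 (genMat T) (genMat U) i j = sgn (par i + par j) • dot1 T U i j := by
    unfold dot1 genMat
    rw [Finset.smul_sum]
    refine Finset.sum_congr rfl fun k _ => ?_
    rw [smul_mul_smul_comm, smul_smul, smul_smul, ← sgn_add, ← sgn_add, ← sgn_add]
    congr 1
    exact sgn_congr (by linear_combination add_self_two (par k))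
  rw [e, h]
  unfold one1
  split
  · next h => rw [h, add_self_two, sgn_zero, one_smul]
  · rw [smul_zero]

/-- The mixed relation `S⁻¹ X⁻¹ Y = Y X⁻¹ S⁻¹`. -/
theorem mix_xMat_inv_yMat (N : ℕ) :
    Mix (Sinv N) (genMat (xMat (Sinv N))) (yMat (S N)) (Sinv N) := by
  have h := xMat_S_yMat N
  have hXU := (legs_inv (dot1_genMat (xMat_inv N).1) N).1
  have hUX := (legs_inv (dot1_genMat (xMat_inv N).2) N).1
  have hS := scal_S_inv (Matrix (Idx N) (Idx N) K) N
  unfold Mix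
  set X := leg1 N (genMat (xMat (S N)))
  set U := leg1 N (genMat (xMat (Sinv N)))
  set Y := leg2 N (yMat (S N))
  set s := scal (Matrix (Idx N) (Idx N) K) (S N)
  set s' := scal (Matrix (Idx N) (Idx N) K) (Sinv N)
  -- Here U is the inverse of X. Inserting S X X⁻¹ S⁻¹ on the right creates the word Y S X, which
  -- `xMat_S_yMat` turns into X S Y.
  calc s' ⋆ U ⋆ Y = s' ⋆ U ⋆ Y ⋆ s ⋆ (X ⋆ U) ⋆ s' := by
        rw [hXU, dot_one2, dot_assoc _ s s', hS.1, dot_one2]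
    _ = s' ⋆ U ⋆ (Y ⋆ s ⋆ X) ⋆ U ⋆ s' := by simp only [dot_assoc]
    _ = s' ⋆ (U ⋆ X) ⋆ s ⋆ Y ⋆ U ⋆ s' := by rw [← h]; simp only [dot_assoc]
    _ = Y ⋆ U ⋆ s' := by rw [hUX, dot_one2, hS.2, one2_dot]

/-! ### Gradings and parity involutions -/

section Twist

variable {X : Type} [Ring X] [Algebra K X] (gX : ZMod 2 → Submodule K X) [GradedAlgebra gX]

theorem twist_of_mem (d : ZMod 2) {e : ZMod 2} {x : X} (hx : x ∈ gX e) :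
    twist gX d x = sgn (d * e) • x := by
  simp only [twist, LinearMap.sum_apply, LinearMap.smul_apply, GradedAlgebra.proj_apply]
  rw [Finset.sum_eq_single e]
  · rw [DirectSum.decompose_of_mem_same gX hx]
  · intro e' _ h
    rw [DirectSum.decompose_of_mem_ne gX hx (Ne.symm h), smul_zero]
  · simp

theorem eq_sum_proj (x : X) : x = ∑ e : ZMod 2, GradedAlgebra.proj gX e x := by
  classical
  simp only [GradedAlgebra.proj_apply]
  exact (DirectSum.sum_support_decompose gX x).symm.trans
    (Finset.sum_subset (Finset.subset_univ _) fun i _ h => by simpa using h)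

theorem proj_mem (d : ZMod 2) (x : X) : GradedAlgebra.proj gX d x ∈ gX d := by
  rw [GradedAlgebra.proj_apply]
  exact SetLike.coe_mem _

/-- Linear maps which agree on homogeneous elements are equal. -/
theorem hom_ext_graded {M : Type} [AddCommGroup M] [Module K M] {f g : X →ₗ[K] M}
    (h : ∀ (d : ZMod 2) (x : X), x ∈ gX d → f x = g x) : f = g := by
  ext x
  rw [eq_sum_proj gX x, map_sum, map_sum]
  exact Finset.sum_congr rfl fun e _ => h e _ (proj_mem gX e x)

theorem twist_one (d : ZMod 2) : twist gX d 1 = 1 := by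
  rw [twist_of_mem gX d (SetLike.GradedOne.one_mem (A := gX)), mul_zero, sgn_zero, one_smul]

theorem twist_mul (d : ZMod 2) (x y : X) : twist gX d (x * y) = twist gX d x * twist gX d y := by
  rw [eq_sum_proj gX x, eq_sum_proj gX y]
  simp only [Finset.sum_mul_sum, map_sum]
  refine sum_congr₂ fun e e' => ?_
  have hx := proj_mem gX e x
  have hy := proj_mem gX e' y
  rw [twist_of_mem gX d hx, twist_of_mem gX d hy,
    twist_of_mem gX d (SetLike.GradedMul.mul_mem hx hy), mul_add, sgn_add, smul_mul_smul_comm]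

theorem twist_twist (d e : ZMod 2) (x : X) : twist gX d (twist gX e x) = twist gX (d + e) x := by
  have h : twist gX d ∘ₗ twist gX e = twist gX (d + e) := by
    refine hom_ext_graded gX fun f x hx => ?_
    rw [LinearMap.comp_apply, twist_of_mem gX e hx, map_smul, twist_of_mem gX d hx,
      twist_of_mem gX _ hx, smul_smul, ← sgn_add]
    congr 1
    exact sgn_congr (by ring)
  exact congrArg (fun f => f x) h

theorem twist_zero (x : X) : twist gX 0 x = x := by
  have h : twist gX 0 = LinearMap.id := by
    refine hom_ext_graded gX fun f x hx => ?_
    rw [twist_of_mem gX 0 hx, zero_mul, sgn_zero, one_smul, LinearMap.id_apply]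
  exact congrArg (fun f => f x) h

theorem twist_self (d : ZMod 2) (x : X) : twist gX d (twist gX d x) = x := by
  rw [twist_twist, add_self_two, twist_zero]

end Twist

theorem zmod_two_ne {d e : ZMod 2} (h : d ≠ e) : d = e + 1 := by
  revert d e; decide

theorem two_ne_zero_K : (2 : K) ≠ 0 := two_ne_zero

section Parity

variable {M : Type} [AddCommGroup M] [Module K M] {gM : ZMod 2 → Submodule K M}
  {γ : ZMod 2 → M →ₗ[K] M}

/-- The homogeneous components of `M` are the eigenspaces of the parity involution `γ 1`. -/
structure Parity (gM : ZMod 2 → Submodule K M) (γ : ZMod 2 → M →ₗ[K] M) : Prop where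
  zero : ∀ x, γ 0 x = x
  add : ∀ d e x, γ d (γ e x) = γ (d + e) x
  mem_iff : ∀ d x, x ∈ gM d ↔ γ 1 x = sgn d • x

theorem Parity.apply (h : Parity gM γ) (d : ZMod 2) {e : ZMod 2} {x : M} (hx : x ∈ gM e) :
    γ d x = sgn (d * e) • x := by
  rcases zmod_two_cases d with rfl | rfl
  · rw [h.zero, zero_mul, sgn_zero, one_smul]
  · rw [(h.mem_iff _ _).1 hx, one_mul]

theorem Parity.self (h : Parity gM γ) (d : ZMod 2) (x : M) : γ d (γ d x) = x := by
  rw [h.add, add_self_two, h.zero]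

/-- The homogeneous component of parity `d`. -/
def Parity.part (γ : ZMod 2 → M →ₗ[K] M) (d : ZMod 2) (x : M) : M :=
  (2⁻¹ : K) • (x + sgn d • γ 1 x)

theorem Parity.part_mem (h : Parity gM γ) (d : ZMod 2) (x : M) : Parity.part γ d x ∈ gM d := by
  rw [h.mem_iff, Parity.part, map_smul, map_add, map_smul, h.self, smul_comm (sgn d), smul_add (sgn d),
    smul_smul (sgn d), sgn_mul_self, one_smul, add_comm]

theorem Parity.part_add (x : M) :
    Parity.part γ 0 x + Parity.part γ 1 x = x := by
  rw [Parity.part, Parity.part, ← smul_add, sgn_zero, sgn_one, one_smul, neg_one_smul]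
  rw [show x + γ 1 x + (x + -γ 1 x) = (2 : K) • x by rw [two_smul]; abel, smul_smul,
    inv_mul_cancel₀ two_ne_zero_K, one_smul]

theorem Parity.induction (h : Parity gM γ) {P : M → Prop} (hadd : ∀ x y, P x → P y → P (x + y))
    (hom : ∀ d x, x ∈ gM d → P x) (x : M) : P x := by
  rw [← Parity.part_add (γ := γ) x]
  exact hadd _ _ (hom 0 _ (h.part_mem 0 x)) (hom 1 _ (h.part_mem 1 x))

/-- Since 2 is invertible, the space is the direct sum of the eigenspaces of an involution for the
eigenvalues 1 and -1. -/
theorem Parity.isInternal (h : Parity gM γ) : DirectSum.IsInternal gM := by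
  rw [DirectSum.isInternal_submodule_iff_isCompl gM (i := 0) (j := 1) (by decide)
    (by ext d; rcases zmod_two_cases d with rfl | rfl <;> simp)]
  constructor
  · rw [Submodule.disjoint_def]
    intro x h0 h1
    have e := ((h.mem_iff _ _).1 h0).symm.trans ((h.mem_iff _ _).1 h1)
    rw [sgn_zero, sgn_one, one_smul, neg_one_smul] at e
    have e2 : (2 : K) • x = 0 := by rw [two_smul]; nth_rewrite 1 [e]; simp
    exact (smul_eq_zero.1 e2).resolve_left two_ne_zero_K
  · rw [codisjoint_iff, eq_top_iff]
    intro x _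
    rw [← Parity.part_add (γ := γ) x]
    exact Submodule.add_mem_sup (h.part_mem 0 x) (h.part_mem 1 x)

/-- A map compatible with the parity involutions preserves degrees. -/
theorem Parity.map_mem (h : Parity gM γ) {M' : Type} [AddCommGroup M'] [Module K M']
    {gM' : ZMod 2 → Submodule K M'} {γ' : ZMod 2 → M' →ₗ[K] M'} (h' : Parity gM' γ')
    {f : M →ₗ[K] M'} (hf : ∀ x, f (γ 1 x) = γ' 1 (f x)) {d : ZMod 2} {x : M} (hx : x ∈ gM d) :
    f x ∈ gM' d := by
  rw [h'.mem_iff, ← hf, (h.mem_iff _ _).1 hx, map_smul]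

theorem Parity.map_of_one (h : Parity gM γ) {M' : Type} [AddCommGroup M'] [Module K M']
    {gM' : ZMod 2 → Submodule K M'} {γ' : ZMod 2 → M' →ₗ[K] M'} (h' : Parity gM' γ')
    {f : M →ₗ[K] M'} (hf : ∀ x, f (γ 1 x) = γ' 1 (f x)) (d : ZMod 2) (x : M) :
    f (γ d x) = γ' d (f x) := by
  rcases zmod_two_cases d with rfl | rfl
  · rw [h.zero, h'.zero]
  · exact hf x

end Parity

/-! ### Parity involutions of superalgebras and of their tensor products. -/

section ParityExamples

variable {X : Type} [Ring X] [Algebra K X] (gX : ZMod 2 → Submodule K X) [GradedAlgebra gX]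
variable {Y : Type} [Ring Y] [Algebra K Y] (gY : ZMod 2 → Submodule K Y) [GradedAlgebra gY]

theorem parity_twist : Parity gX (twist gX) where
  zero := twist_zero gX
  add := twist_twist gX
  mem_iff d x := by
    constructor
    · intro h
      rw [twist_of_mem gX 1 h, one_mul]
    · intro h
      -- An eigenvector x is the average of x and (-1)^d γ(x), and the components of parity d + 1 of
      -- these two cancel.
      have hs : GradedAlgebra.proj gX (d + 1) x = 0 := by
        have e0 := eq_sum_proj gX x
        have e1 : x = (2⁻¹ : K) • (x + sgn d • twist gX 1 x) := by
          rw [h, smul_smul, sgn_mul_self, one_smul, ← two_smul K x, smul_smul,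
            inv_mul_cancel₀ two_ne_zero_K, one_smul]
        rw [e1, map_smul, map_add, map_smul]
        have e2 : GradedAlgebra.proj gX (d + 1) (twist gX 1 x) =
            sgn (d + 1) • GradedAlgebra.proj gX (d + 1) x := by
          have : GradedAlgebra.proj gX (d + 1) ∘ₗ twist gX 1 =
              sgn (d + 1) • GradedAlgebra.proj gX (d + 1) := by
            refine hom_ext_graded gX fun f x hx => ?_
            rw [LinearMap.comp_apply, LinearMap.smul_apply, twist_of_mem gX 1 hx, map_smul,
              one_mul, GradedAlgebra.proj_apply]
            by_cases hf : f = d + 1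
            · rw [hf]
            · rw [DirectSum.decompose_of_mem_ne gX hx hf, smul_zero, smul_zero]
          exact congrArg (fun f => f x) this
        rw [e2, smul_smul, sgn_add, ← mul_assoc, sgn_mul_self, sgn_one, one_mul, neg_one_smul,
          add_neg_cancel, smul_zero]
      have e0 := eq_sum_proj gX x
      have : x = GradedAlgebra.proj gX d x := by
        rw [Finset.sum_eq_single d] at e0
        · exact e0
        · intro b _ hb
          have : b = d + 1 := zmod_two_ne hb
          rw [this, hs]
        · simp
      rw [this]
      exact proj_mem gX d x

/-- The parity operators of a tensor product. -/
abbrev twist₂ (d : ZMod 2) : X ⊗[K] Y →ₗ[K] X ⊗[K] Y :=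
  TensorProduct.map (twist gX d) (twist gY d)

/-- Describing the grading of a tensor product by the involution γ ⊗ γ means that evenness of a map
becomes one equation, and that no decomposition map for the tensor product has to be constructed. -/
theorem parity_tensor : Parity (tensorGrade gX gY) (twist₂ gX gY) where
  zero z := by
    have h : twist₂ gX gY 0 = LinearMap.id := by
      ext x y
      simp [twist_zero]
    rw [h, LinearMap.id_apply]
  add d e z := by
    have h : twist₂ gX gY d ∘ₗ twist₂ gX gY e = twist₂ gX gY (d + e) := by
      ext x y
      simp [twist_twist]
    rw [← h, LinearMap.comp_apply]
  mem_iff d z := by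
    have hom : ∀ d, ∀ z ∈ tensorGrade gX gY d, twist₂ gX gY 1 z = sgn d • z := by
      intro d z hz
      induction hz using Submodule.span_induction with
      | mem z hz =>
        obtain ⟨e, f, rfl, x, hx, y, hy, rfl⟩ := hz
        rw [TensorProduct.map_tmul, twist_of_mem gX 1 hx, twist_of_mem gY 1 hy,
          TensorProduct.smul_tmul_smul, one_mul, one_mul, sgn_add]
      | zero => simp
      | add x y _ _ hx hy => rw [map_add, hx, hy, smul_add]
      | smul a x _ hx => rw [map_smul, hx, smul_comm]
    refine ⟨hom d z, fun h => ?_⟩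
    -- Pure tensors of homogeneous elements span, so z splits into a part of parity d and a part of
    -- parity d + 1; the eigenvalue equation then kills the second one.
    have hz : ∃ z₀ ∈ tensorGrade gX gY d, ∃ z₁ ∈ tensorGrade gX gY (d + 1), z = z₀ + z₁ := by
      clear h
      induction z using TensorProduct.induction_on with
      | zero => exact ⟨0, Submodule.zero_mem _, 0, Submodule.zero_mem _, by simp⟩
      | tmul x y =>
        induction x using (parity_twist gX).induction with
        | hadd x x' hx hx' =>
          obtain ⟨a, ha, b, hb, e⟩ := hx
          obtain ⟨a', ha', b', hb', e'⟩ := hx'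
          exact ⟨a + a', Submodule.add_mem _ ha ha', b + b', Submodule.add_mem _ hb hb', by
            rw [TensorProduct.add_tmul, e, e']; abel⟩
        | hom e x hx =>
        induction y using (parity_twist gY).induction with
        | hadd x x' hx hx' =>
          obtain ⟨a, ha, b, hb, e⟩ := hx
          obtain ⟨a', ha', b', hb', e'⟩ := hx'
          exact ⟨a + a', Submodule.add_mem _ ha ha', b + b', Submodule.add_mem _ hb hb', by
            rw [TensorProduct.tmul_add, e, e']; abel⟩
        | hom f y hy =>
          have hm : x ⊗ₜ[K] y ∈ tensorGrade gX gY (e + f) :=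
            Submodule.subset_span ⟨e, f, rfl, x, hx, y, hy, rfl⟩
          by_cases hd : e + f = d
          · exact ⟨_, hd ▸ hm, 0, Submodule.zero_mem _, by simp⟩
          · have : e + f = d + 1 := zmod_two_ne hd
            exact ⟨0, Submodule.zero_mem _, _, this ▸ hm, by simp⟩
      | add x x' hx hx' =>
        obtain ⟨a, ha, b, hb, e⟩ := hx
        obtain ⟨a', ha', b', hb', e'⟩ := hx'
        exact ⟨a + a', Submodule.add_mem _ ha ha', b + b', Submodule.add_mem _ hb hb', by
          rw [e, e']; abel⟩
    obtain ⟨z₀, h₀, z₁, h₁, rfl⟩ := hz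
    rw [map_add, hom _ _ h₀, hom _ _ h₁, smul_add, add_right_inj, sgn_add, sgn_one, mul_neg_one,
      neg_smul] at h
    have h2 : (2 : K) • (sgn d • z₁) = 0 := by rw [two_smul]; nth_rewrite 1 [← h]; simp
    have h3 := congrArg (sgn d • ·) ((smul_eq_zero.1 h2).resolve_left two_ne_zero_K)
    simp only [smul_smul, sgn_mul_self, one_smul, smul_zero] at h3
    rw [h3, add_zero]
    exact h₀

end ParityExamples

/-! ### Actions of superalgebras with a matrix comultiplication -/

section MatCoalg

variable {U : Type} [Ring U] [Algebra K U] (gU : ZMod 2 → Submodule K U) [GradedAlgebra gU]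

theorem gradedTensor_mul (a₁ b₂ : U) {d e : ZMod 2} {b₁ a₂ : U} (hb : b₁ ∈ gU d)
    (ha : a₂ ∈ gU e) :
    (GradedTensorProduct.of K gU gU (a₁ ⊗ₜ[K] b₁) * GradedTensorProduct.of K gU gU (a₂ ⊗ₜ[K] b₂)) =
      GradedTensorProduct.of K gU gU (sgn (d * e) • ((a₁ * a₂) ⊗ₜ[K] (b₁ * b₂))) := by
  have h := GradedTensorProduct.tmul_coe_mul_coe_tmul (R := K) gU gU a₁ ⟨b₁, hb⟩ ⟨a₂, ha⟩ b₂
  refine h.trans ?_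
  rcases zmod_two_cases (d * e) with h | h <;> rw [h] <;> simp [sgn]

/-- A superalgebra generated by the entries of a matrix `ℓ` with `Δ(ℓ) = ℓ ⊗ ℓ` and `ε(ℓ) = 1`. -/
structure MatCoalg (N : ℕ) where
  gen : Idx N → Idx N → U
  gen_mem : ∀ a b, gen a b ∈ gU (par a + par b)
  adjoin_gen : Algebra.adjoin K {u | ∃ a b, u = gen a b} = ⊤
  comulHom : U →ₐ[K] GradedTensorProduct K gU gU
  comulHom_gen : ∀ a b, (GradedTensorProduct.of K gU gU).symm (comulHom (gen a b)) =
    ∑ c, gen a c ⊗ₜ[K] gen c b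
  counitHom : U →ₐ[K] K
  counitHom_gen : ∀ a b, counitHom (gen a b) = if a = b then 1 else 0

variable {gU} {N : ℕ} (C : MatCoalg gU N)

/-- The comultiplication as a linear map. -/
def MatCoalg.Δ : U →ₗ[K] U ⊗[K] U :=
  (GradedTensorProduct.of K gU gU).symm.toLinearMap ∘ₗ C.comulHom.toLinearMap

theorem MatCoalg.Δ_apply (u : U) : C.Δ u = (GradedTensorProduct.of K gU gU).symm (C.comulHom u) :=
  rfl

theorem MatCoalg.induction {P : U → Prop} (hgen : ∀ a b, P (C.gen a b))
    (hmap : ∀ r, P (algebraMap K U r)) (hadd : ∀ u v, P u → P v → P (u + v))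
    (hmul : ∀ u v, P u → P v → P (u * v)) (u : U) : P u := by
  have hu : u ∈ Algebra.adjoin K {u | ∃ a b, u = C.gen a b} := by
    rw [C.adjoin_gen]; exact Algebra.mem_top
  induction hu using Algebra.adjoin_induction with
  | mem x hx => obtain ⟨a, b, rfl⟩ := hx; exact hgen a b
  | algebraMap r => exact hmap r
  | add x y _ _ hx hy => exact hadd x y hx hy
  | mul x y _ _ hx hy => exact hmul x y hx hy

variable {M : Type} [AddCommGroup M] [Module K M] {gM : ZMod 2 → Submodule K M}
  {γ : ZMod 2 → M →ₗ[K] M}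

/-- The action `ρ` is compatible with parities. -/
def EvenAct (gU : ZMod 2 → Submodule K U) [GradedAlgebra gU] (γ : ZMod 2 → M →ₗ[K] M)
    (ρ : U →ₗ[K] Module.End K M) : Prop :=
  ∀ u d x, γ d (ρ u x) = ρ (twist gU d u) (γ d x)

theorem EvenAct.act_mem {ρ : U →ₗ[K] Module.End K M} (h : EvenAct gU γ ρ) (hP : Parity gM γ)
    {d e : ZMod 2} {u : U} {x : M} (hu : u ∈ gU d) (hx : x ∈ gM e) : ρ u x ∈ gM (d + e) := by
  rw [hP.mem_iff, h, twist_of_mem gU 1 hu, (hP.mem_iff _ _).1 hx, map_smul ρ,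
    LinearMap.smul_apply, map_smul, smul_smul, one_mul, sgn_add]

theorem evenAct_of_gen (C : MatCoalg gU N) (hP : Parity gM γ) (ρ : U →ₐ[K] Module.End K M)
    (h : ∀ a b x, γ 1 (ρ (C.gen a b) x) = sgn (par a + par b) • ρ (C.gen a b) (γ 1 x)) :
    EvenAct gU γ ρ.toLinearMap := by
  have h1 : ∀ u x, γ 1 (ρ u x) = ρ (twist gU 1 u) (γ 1 x) := by
    intro u
    induction u using C.induction with
    | hgen a b =>
      intro x
      rw [h, twist_of_mem gU 1 (C.gen_mem a b), one_mul, map_smul, LinearMap.smul_apply]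
    | hmap r =>
      intro x
      rw [Algebra.algebraMap_eq_smul_one, map_smul, map_smul, twist_one, map_one, map_smul, map_one]
      simp
    | hadd u v hu hv =>
      intro x
      simp only [map_add, LinearMap.add_apply, hu, hv]
    | hmul u v hu hv =>
      intro x
      rw [map_mul, twist_mul, map_mul, Module.End.mul_apply, Module.End.mul_apply, hu, hv]
  intro u d x
  rcases zmod_two_cases d with rfl | rfl
  · rw [hP.zero, hP.zero, twist_zero]
  · exact h1 u x

theorem EvenAct.isSupermodule {ρ : U →ₐ[K] Module.End K M} (h : EvenAct gU γ ρ.toLinearMap)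
    (hP : Parity gM γ) : IsSupermodule gU gM ρ.toLinearMap where
  isInternal := hP.isInternal
  act_mem := h.act_mem hP
  one_act x := by simp
  mul_act u v x := by simp

variable {M' : Type} [AddCommGroup M'] [Module K M']
variable {W : Type} [AddCommGroup W] [Module K W]

/-- `u ⊗ v ↦ (-1)^{d|v|} μ(ρ_u(x), σ_v(y))`. -/
def actPair (gU : ZMod 2 → Submodule K U) [GradedAlgebra gU] (μ : M →ₗ[K] M' →ₗ[K] W)
    (ρ : U →ₗ[K] Module.End K M) (σ : U →ₗ[K] Module.End K M') (d : ZMod 2) (x : M) (y : M') :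
    U ⊗[K] U →ₗ[K] W :=
  TensorProduct.lift (μ.compl₁₂ (ρ.flip x) (σ.flip y ∘ₗ twist gU d))

theorem actPair_tmul (μ : M →ₗ[K] M' →ₗ[K] W) (ρ : U →ₗ[K] Module.End K M)
    (σ : U →ₗ[K] Module.End K M') (d : ZMod 2) (x : M) (y : M') (u v : U) :
    actPair gU μ ρ σ d x y (u ⊗ₜ v) = μ (ρ u x) (σ (twist gU d v) y) := rfl

theorem actPair_gen (C : MatCoalg gU N) (μ : M →ₗ[K] M' →ₗ[K] W) (ρ : U →ₗ[K] Module.End K M)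
    (σ : U →ₗ[K] Module.End K M') (d : ZMod 2) (x : M) (y : M') (a b : Idx N) :
    actPair gU μ ρ σ d x y (C.Δ (C.gen a b)) =
      ∑ c, sgn (d * (par c + par b)) • μ (ρ (C.gen a c) x) (σ (C.gen c b) y) := by
  rw [C.Δ_apply, C.comulHom_gen, map_sum]
  refine Finset.sum_congr rfl fun c _ => ?_
  rw [actPair_tmul, twist_of_mem gU d (C.gen_mem c b), map_smul, LinearMap.smul_apply, map_smul]

theorem actPair_algebraMap (C : MatCoalg gU N) (μ : M →ₗ[K] M' →ₗ[K] W)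
    (ρ : U →ₐ[K] Module.End K M) (σ : U →ₐ[K] Module.End K M') (d : ZMod 2) (x : M) (y : M')
    (r : K) : actPair gU μ ρ.toLinearMap σ.toLinearMap d x y (C.Δ (algebraMap K U r)) =
      r • μ x y := by
  have h : C.Δ (algebraMap K U r) = r • (1 ⊗ₜ[K] 1) := by
    rw [C.Δ_apply, AlgHom.commutes, Algebra.algebraMap_eq_smul_one, map_smul]
    rfl
  rw [h, map_smul, actPair_tmul, twist_one]
  simp

/-- Here `G` is the operator by which z acts on the target. Acting with w first raises the parity of
the left argument, and the resulting change of `twist` is exactly the sign in the product of the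
super tensor square. Hence the set of elements whose action is compatible with a product is closed
under multiplication. -/
theorem actPair_mul {ρ : U →ₐ[K] Module.End K M} {σ : U →ₐ[K] Module.End K M'}
    (hP : Parity gM γ) (hρ : EvenAct gU γ ρ.toLinearMap) (μ : M →ₗ[K] M' →ₗ[K] W)
    (G : W →ₗ[K] W) (z w : GradedTensorProduct K gU gU)
    (hz : ∀ d x y, x ∈ gM d → G (μ x y) =
      actPair gU μ ρ.toLinearMap σ.toLinearMap d x y ((GradedTensorProduct.of K gU gU).symm z))
    (d : ZMod 2) (x : M) (y : M') (hx : x ∈ gM d) :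
    actPair gU μ ρ.toLinearMap σ.toLinearMap d x y
        ((GradedTensorProduct.of K gU gU).symm (z * w)) =
      G (actPair gU μ ρ.toLinearMap σ.toLinearMap d x y
        ((GradedTensorProduct.of K gU gU).symm w)) := by
  obtain ⟨w, rfl⟩ := (GradedTensorProduct.of K gU gU).surjective w
  induction w using TensorProduct.induction_on with
  | zero => simp
  | add w w' hw hw' => simp only [map_add, mul_add, hw, hw']
  | tmul a b =>
    induction a using (parity_twist gU).induction with
    | hadd a a' ha ha' => simp only [map_add, mul_add, TensorProduct.add_tmul, ha, ha']
    | hom e a ha =>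
      rw [LinearEquiv.symm_apply_apply, actPair_tmul, hz (e + d) _ _ (hρ.act_mem hP ha hx)]
      clear hz
      obtain ⟨z, rfl⟩ := (GradedTensorProduct.of K gU gU).surjective z
      induction z using TensorProduct.induction_on with
      | zero => simp
      | add w w' hw hw' => simp only [map_add, add_mul, hw, hw']
      | tmul c f =>
        induction f using (parity_twist gU).induction with
        | hadd a a' ha ha' => simp only [map_add, add_mul, TensorProduct.tmul_add, ha, ha']
        | hom h f hf =>
          rw [gradedTensor_mul gU c b hf ha, LinearEquiv.symm_apply_apply,
            LinearEquiv.symm_apply_apply, map_smul, actPair_tmul, actPair_tmul, twist_mul,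
            twist_of_mem gU _ hf, twist_of_mem gU _ hf]
          simp only [AlgHom.toLinearMap_apply, map_mul, map_smul, LinearMap.smul_apply,
            smul_mul_assoc, Module.End.mul_apply, smul_smul]
          rw [← sgn_add]
          congr 1
          exact sgn_congr (by ring)

/-- A matrix condition for supermodule superalgebras. -/
theorem isSupermoduleSuperalgebra_of_gen {μ : M →ₗ[K] M →ₗ[K] M} {one : M}
    (hA : IsSuperalgebra gM μ one) (hP : Parity gM γ) {ρ : U →ₐ[K] Module.End K M}
    (hρ : EvenAct gU γ ρ.toLinearMap)
    (h1 : ∀ a b, ρ (C.gen a b) one = if a = b then one else 0)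
    (hμ : ∀ a b x y, ρ (C.gen a b) (γ (par b) (μ x y)) =
      ∑ c, μ (ρ (C.gen a c) (γ (par c) x)) (ρ (C.gen c b) (γ (par b) y))) :
    IsSupermoduleSuperalgebra gU gM C.Δ C.counitHom.toLinearMap μ one ρ.toLinearMap where
  isSuperalgebra := hA
  isSupermodule := hρ.isSupermodule hP
  act_one u := by
    simp only [AlgHom.toLinearMap_apply]
    induction u using C.induction with
    | hgen a b => rw [h1, C.counitHom_gen]; split_ifs <;> simp
    | hmap r => simp
    | hadd u v hu hv => simp only [map_add, LinearMap.add_apply, hu, hv, add_smul]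
    | hmul u v hu hv =>
      rw [map_mul, map_mul, Module.End.mul_apply, hv, map_smul, hu, smul_smul, mul_comm]
  act_mul u := by
    change ∀ d x y, x ∈ gM d → _ = actPair gU μ ρ.toLinearMap ρ.toLinearMap d x y (C.Δ u)
    induction u using C.induction with
    | hgen a b =>
      intro d x y hx
      rw [actPair_gen]
      -- A power of γ is a multiplicative involution; both facts are read off on homogeneous
      -- elements.
      have hγ : γ (par b) (μ (γ (par b) x) (γ (par b) y)) = μ x y := by
        rw [hP.apply _ hx]
        induction y using hP.induction with
        | hadd y y' hy hy' => simp only [map_add, hy, hy']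
        | hom e y hy =>
          rw [hP.apply _ hy, map_smul, map_smul, map_smul, LinearMap.smul_apply, map_smul,
            hP.apply _ (hA.mul_mem hx hy), smul_smul, smul_smul, ← sgn_add, ← sgn_add]
          rw [show par b * e + par b * d + par b * (d + e) = 0 by
            linear_combination add_self_two (par b * e) + add_self_two (par b * d), sgn_zero,
            one_smul]
      -- Substituting γ^{|b|}x and γ^{|b|}y in the matrix condition leaves γ^{|c|+|b|} on x alone,
      -- which for x of parity d is the sign required by `actPair_gen`.
      have e := hμ a b (γ (par b) x) (γ (par b) y)
      rw [hγ] at e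
      refine e.trans (Finset.sum_congr rfl fun c _ => ?_)
      rw [hP.self, hP.add, hP.apply _ hx, map_smul, map_smul, LinearMap.smul_apply, mul_comm d]
      rfl
    | hmap r =>
      intro d x y _
      rw [actPair_algebraMap, AlgHom.toLinearMap_apply, AlgHom.commutes]
      simp
    | hadd u v hu hv =>
      intro d x y hx
      simp only [map_add, LinearMap.add_apply]
      rw [hu d x y hx, hv d x y hx]
    | hmul u v hu hv =>
      intro d x y hx
      rw [C.Δ_apply, map_mul C.comulHom, actPair_mul hP hρ μ (ρ u) (C.comulHom u) _ hu d x y hx,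
        ← C.Δ_apply, ← hv d x y hx]
      simp

/-- The matrix form of the conditions for a supermodule superalgebra. -/
theorem IsSupermoduleSuperalgebra.gen_mul {μ : M →ₗ[K] M →ₗ[K] M} {one : M} (hP : Parity gM γ)
    {ρ : U →ₗ[K] Module.End K M}
    (h : IsSupermoduleSuperalgebra gU gM C.Δ C.counitHom.toLinearMap μ one ρ) (a b : Idx N)
    (x y : M) : ρ (C.gen a b) (γ (par b) (μ x y)) =
      ∑ c, μ (ρ (C.gen a c) (γ (par c) x)) (ρ (C.gen c b) (γ (par b) y)) := by
  induction x using hP.induction with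
  | hadd x x' hx hx' =>
    simp only [map_add, LinearMap.add_apply, hx, hx', Finset.sum_add_distrib]
  | hom d x hx =>
    have hγ : γ (par b) (μ x y) = μ (γ (par b) x) (γ (par b) y) := by
      rw [hP.apply _ hx]
      induction y using hP.induction with
      | hadd y y' hy hy' => simp only [map_add, hy, hy']
      | hom e y hy =>
        rw [hP.apply _ hy, map_smul, map_smul, LinearMap.smul_apply,
          hP.apply _ (h.isSuperalgebra.mul_mem hx hy), smul_smul, ← sgn_add]
        congr 1
        exact sgn_congr (by ring)
    rw [hγ, hP.apply _ hx, map_smul, LinearMap.smul_apply, map_smul]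
    rw [h.act_mul _ d x _ hx]
    refine (congrArg _ (actPair_gen C μ ρ ρ d x _ a b)).trans ?_
    rw [Finset.smul_sum]
    refine Finset.sum_congr rfl fun c _ => ?_
    rw [hP.apply _ hx, map_smul, map_smul, LinearMap.smul_apply, smul_smul, ← sgn_add]
    congr 1
    refine sgn_congr ?_
    linear_combination add_self_two (par b * d)

end MatCoalg

/-! ### Actions on tensor products -/

section TensorActions

variable {U : Type} [Ring U] [Algebra K U] {gU : ZMod 2 → Submodule K U} [GradedAlgebra gU]
  {N : ℕ} (C : MatCoalg gU N)
  {X : Type} [Ring X] [Algebra K X] {gX : ZMod 2 → Submodule K X} [GradedAlgebra gX]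
  {Y : Type} [Ring Y] [Algebra K Y] {gY : ZMod 2 → Submodule K Y} [GradedAlgebra gY]

theorem tensorAct_apply (Δ : U →ₗ[K] U ⊗[K] U) (ρ : U →ₗ[K] Module.End K X)
    (σ : U →ₗ[K] Module.End K Y) (u : U) {d : ZMod 2} {x : X} (hx : x ∈ gX d) (y : Y) :
    tensorAct gU gX Δ ρ σ u (x ⊗ₜ y) = actPair gU (TensorProduct.mk K X Y) ρ σ d x y (Δ u) := by
  rw [tensorAct, LinearMap.comp_apply]
  generalize Δ u = z
  induction z using TensorProduct.induction_on with
  | zero => simp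
  | add z w hz hw => simp only [map_add, LinearMap.add_apply, hz, hw]
  | tmul u v =>
    rw [actPair_tmul, LinearMap.sum_apply, LinearMap.sum_apply, Finset.sum_eq_single d]
    · simp only [TensorProduct.lift.tmul, LinearMap.compl₁₂_apply, LinearMap.comp_apply,
        TensorProduct.mapBilinear_apply, TensorProduct.map_tmul, LinearMap.lcomp_apply',
        TensorProduct.mk_apply]
      rw [GradedAlgebra.proj_apply, DirectSum.decompose_of_mem_same gX hx]
    · intro e _ he
      simp only [TensorProduct.lift.tmul, LinearMap.compl₁₂_apply, LinearMap.comp_apply,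
        TensorProduct.mapBilinear_apply, TensorProduct.map_tmul, LinearMap.lcomp_apply']
      rw [GradedAlgebra.proj_apply, DirectSum.decompose_of_mem_ne gX hx (Ne.symm he), map_zero,
        TensorProduct.zero_tmul]
    · simp

theorem hom_ext_tensor {M : Type} [AddCommGroup M] [Module K M] {f g : X ⊗[K] Y →ₗ[K] M}
    (h : ∀ (d : ZMod 2) (x : X) (y : Y), x ∈ gX d → f (x ⊗ₜ y) = g (x ⊗ₜ y)) : f = g := by
  ext x y
  change f (x ⊗ₜ y) = g (x ⊗ₜ y)
  induction x using (parity_twist gX).induction with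
  | hadd x x' hx hx' => simp only [TensorProduct.add_tmul, map_add, hx, hx']
  | hom d x hx => exact h d x y hx

/-- The action on a tensor product as a homomorphism of algebras. -/
def tensorActHom {ρ : U →ₐ[K] Module.End K X} (hρ : EvenAct gU (twist gX) ρ.toLinearMap)
    (σ : U →ₐ[K] Module.End K Y) : U →ₐ[K] Module.End K (X ⊗[K] Y) :=
  AlgHom.ofLinearMap (tensorAct gU gX C.Δ ρ.toLinearMap σ.toLinearMap)
    (by
      refine hom_ext_tensor (gX := gX) fun d x y hx => ?_
      rw [tensorAct_apply _ _ _ _ hx, ← map_one (algebraMap K U), actPair_algebraMap, one_smul]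
      rfl)
    (by
      intro u v
      refine hom_ext_tensor (gX := gX) fun d x y hx => ?_
      rw [tensorAct_apply _ _ _ _ hx, C.Δ_apply, map_mul C.comulHom, actPair_mul (parity_twist gX) hρ _
        (tensorAct gU gX C.Δ ρ.toLinearMap σ.toLinearMap u) _ _
        (fun d x y hx => tensorAct_apply C.Δ ρ.toLinearMap σ.toLinearMap u hx y) d x y hx,
        Module.End.mul_apply, tensorAct_apply _ _ _ _ hx]
      rfl)

/-- Once γ^{|b|} is inserted before the action of the generator (a, b), the action on a tensor
product becomes a matrix product without signs. This is why the normalisation with γ^{|b|} is used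
throughout. -/
theorem tensorActHom_gen {ρ : U →ₐ[K] Module.End K X} (hρ : EvenAct gU (twist gX) ρ.toLinearMap)
    (σ : U →ₐ[K] Module.End K Y) (a b : Idx N) (z : X ⊗[K] Y) :
    tensorActHom C hρ σ (C.gen a b) (twist₂ gX gY (par b) z) =
      ∑ c, TensorProduct.map (ρ (C.gen a c) ∘ₗ twist gX (par c))
        (σ (C.gen c b) ∘ₗ twist gY (par b)) z := by
  have h : tensorActHom C hρ σ (C.gen a b) ∘ₗ twist₂ gX gY (par b) =
      ∑ c, TensorProduct.map (ρ (C.gen a c) ∘ₗ twist gX (par c))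
        (σ (C.gen c b) ∘ₗ twist gY (par b)) := by
    refine hom_ext_tensor (gX := gX) fun d x y hx => ?_
    rw [LinearMap.comp_apply, TensorProduct.map_tmul, twist_of_mem gX _ hx,
      ← TensorProduct.smul_tmul', map_smul]
    refine (congrArg _ ((tensorAct_apply _ _ _ _ hx _).trans (actPair_gen C _ _ _ _ _ _ _ _))).trans ?_
    rw [Finset.smul_sum, LinearMap.sum_apply]
    refine Finset.sum_congr rfl fun c _ => ?_
    rw [TensorProduct.map_tmul, LinearMap.comp_apply, LinearMap.comp_apply, twist_of_mem gX _ hx,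
      map_smul, ← TensorProduct.smul_tmul', smul_smul, ← sgn_add, TensorProduct.mk_apply]
    congr 1
    refine sgn_congr ?_
    linear_combination add_self_two (par b * d)
  rw [← LinearMap.comp_apply, h, LinearMap.sum_apply]

theorem tensorActHom_even {ρ : U →ₐ[K] Module.End K X} (hρ : EvenAct gU (twist gX) ρ.toLinearMap)
    {σ : U →ₐ[K] Module.End K Y} (hσ : EvenAct gU (twist gY) σ.toLinearMap) :
    EvenAct gU (twist₂ gX gY) (tensorActHom C hρ σ).toLinearMap := by
  refine evenAct_of_gen C (parity_tensor gX gY) _ fun a b z => ?_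
  rw [← (parity_tensor gX gY).self (par b) z, tensorActHom_gen,
    (parity_tensor gX gY).add 1, add_comm 1, ← (parity_tensor gX gY).add, tensorActHom_gen]
  generalize twist₂ gX gY (par b) z = z
  rw [map_sum, Finset.smul_sum]
  refine Finset.sum_congr rfl fun c _ => ?_
  rw [← LinearMap.comp_apply, ← LinearMap.comp_apply, ← LinearMap.smul_apply]
  congr 1
  ext x y
  change twist gX 1 (ρ _ (twist gX _ x)) ⊗ₜ[K] twist gY 1 (σ _ (twist gY _ y)) =
    sgn (par a + par b) • ((ρ _ (twist gX _ (twist gX 1 x))) ⊗ₜ[K] (σ _ (twist gY _ (twist gY 1 y))))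
  have h1 := hρ (C.gen a c) 1 (twist gX (par c) x)
  have h2 := hσ (C.gen c b) 1 (twist gY (par b) y)
  simp only [AlgHom.toLinearMap_apply] at h1 h2
  rw [h1, h2, twist_of_mem gU _ (C.gen_mem a c), twist_of_mem gU _ (C.gen_mem c b), map_smul,
    map_smul, LinearMap.smul_apply, LinearMap.smul_apply, TensorProduct.smul_tmul_smul,
    twist_twist, twist_twist, twist_twist, twist_twist, add_comm 1, add_comm 1, one_mul, one_mul,
    ← sgn_add]
  congr 1
  refine sgn_congr ?_
  linear_combination add_self_two (par c)

/-- The trivial action. -/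
def MatCoalg.trivAct (Y : Type) [Ring Y] [Algebra K Y] : U →ₐ[K] Module.End K Y :=
  (Algebra.ofId K (Module.End K Y)).comp C.counitHom

theorem MatCoalg.trivAct_apply (u : U) (y : Y) : C.trivAct Y u y = C.counitHom u • y := by
  simp [MatCoalg.trivAct, Algebra.ofId_apply]

theorem MatCoalg.trivAct_even : EvenAct gU (twist gY) (C.trivAct Y).toLinearMap := by
  refine evenAct_of_gen C (parity_twist gY) _ fun a b y => ?_
  rw [C.trivAct_apply, C.trivAct_apply, C.counitHom_gen, map_smul]
  split
  · next h => rw [h, add_self_two, sgn_zero, one_smul, one_smul]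
  · simp

/-- The action on the second factor is a tensor product action whose other factor is trivial, so the
results on tensor products cover `actSecond` as well. On a generator the counit leaves only one term
of the comultiplication. -/
theorem tensorActHom_triv_left (σ : U →ₐ[K] Module.End K Y) :
    (tensorActHom C (C.trivAct_even (gY := gX)) σ).toLinearMap =
      actSecond gU gX σ.toLinearMap := by
  have hs : ∀ (u : U) (d : ZMod 2) (x : X) (y : Y), x ∈ gX d →
      actSecond gU gX σ.toLinearMap u (x ⊗ₜ y) = x ⊗ₜ σ (twist gU d u) y := by
    intro u d x y hx
    rw [actSecond, LinearMap.sum_apply, LinearMap.sum_apply, Finset.sum_eq_single d]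
    · simp only [LinearMap.comp_apply, TensorProduct.mapBilinear_apply, TensorProduct.map_tmul]
      rw [GradedAlgebra.proj_apply, DirectSum.decompose_of_mem_same gX hx]
      rfl
    · intro e _ he
      simp only [LinearMap.comp_apply, TensorProduct.mapBilinear_apply, TensorProduct.map_tmul]
      rw [GradedAlgebra.proj_apply, DirectSum.decompose_of_mem_ne gX hx (Ne.symm he),
        TensorProduct.zero_tmul]
    · simp
  ext1 u
  refine hom_ext_tensor (gX := gX) fun d x y hx => ?_
  rw [hs u d x y hx, AlgHom.toLinearMap_apply]
  induction u using C.induction generalizing d x y with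
  | hgen a b =>
    refine ((tensorAct_apply _ _ _ _ hx _).trans (actPair_gen C _ _ _ _ _ _ _ _)).trans ?_
    rw [Finset.sum_eq_single a]
    · rw [AlgHom.toLinearMap_apply, C.trivAct_apply, C.counitHom_gen, if_pos rfl, one_smul,
        twist_of_mem gU _ (C.gen_mem a b), map_smul, LinearMap.smul_apply, TensorProduct.tmul_smul]
      rfl
    · intro c _ hc
      rw [AlgHom.toLinearMap_apply, C.trivAct_apply, C.counitHom_gen, if_neg (Ne.symm hc), zero_smul]
      simp
    · simp
  | hmap r =>
    have h1 : twist gU d (algebraMap K U r) = algebraMap K U r := by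
      rw [Algebra.algebraMap_eq_smul_one, map_smul, twist_one]
    rw [h1, AlgHom.commutes, AlgHom.commutes]
    simp
  | hadd u v hu hv => simp only [map_add, LinearMap.add_apply, TensorProduct.tmul_add, hu d x y hx,
      hv d x y hx]
  | hmul u v hu hv =>
    rw [map_mul, Module.End.mul_apply, hv d x y hx, hu d x _ hx, twist_mul, map_mul,
      Module.End.mul_apply]

theorem tensorActHom_triv_right {ρ : U →ₐ[K] Module.End K X}
    (hρ : EvenAct gU (twist gX) ρ.toLinearMap) :
    (tensorActHom C hρ (C.trivAct Y)).toLinearMap = actFirst ρ.toLinearMap := by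
  have hs : ∀ (u : U) (x : X) (y : Y), actFirst ρ.toLinearMap u (x ⊗ₜ y) = ρ u x ⊗ₜ y :=
    fun _ _ _ => rfl
  ext1 u
  refine hom_ext_tensor (gX := gX) fun d x y hx => ?_
  rw [hs u x y, AlgHom.toLinearMap_apply]
  clear hs
  have hx' : ∀ x : X, tensorActHom C hρ (C.trivAct Y) u (x ⊗ₜ y) = ρ u x ⊗ₜ y := by
    clear hx x
    induction u using C.induction generalizing y with
    | hgen a b =>
      intro x
      induction x using (parity_twist gX).induction with
      | hadd x x' hx hx' => simp only [map_add, TensorProduct.add_tmul, hx, hx']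
      | hom d x hx =>
      refine ((tensorAct_apply _ _ _ _ hx _).trans (actPair_gen C _ _ _ _ _ _ _ _)).trans ?_
      rw [Finset.sum_eq_single b]
      · rw [AlgHom.toLinearMap_apply, AlgHom.toLinearMap_apply, C.trivAct_apply, C.counitHom_gen,
          if_pos rfl, one_smul, add_self_two, mul_zero, sgn_zero, one_smul]
        rfl
      · intro c _ hc
        rw [AlgHom.toLinearMap_apply, AlgHom.toLinearMap_apply, C.trivAct_apply, C.counitHom_gen,
          if_neg hc, zero_smul]
        simp
      · simp
    | hmap r =>
      intro x
      rw [AlgHom.commutes, AlgHom.commutes]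
      simp [TensorProduct.smul_tmul']
    | hadd u v hu hv =>
      intro x
      simp only [map_add, LinearMap.add_apply, TensorProduct.add_tmul, hu, hv]
    | hmul u v hu hv =>
      intro x
      rw [map_mul, Module.End.mul_apply, hv, hu, map_mul, Module.End.mul_apply]
  exact hx' x

/-- A map compatible with parities and with the generators is a homomorphism of supermodules. -/
theorem isSupermoduleHom_of_gen {M : Type} [AddCommGroup M] [Module K M]
    {gM : ZMod 2 → Submodule K M} {γ : ZMod 2 → M →ₗ[K] M} (hM : Parity gM γ)
    {M' : Type} [AddCommGroup M'] [Module K M'] {gM' : ZMod 2 → Submodule K M'}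
    {γ' : ZMod 2 → M' →ₗ[K] M'} (hM' : Parity gM' γ') {ρ : U →ₐ[K] Module.End K M}
    (hρ : EvenAct gU γ ρ.toLinearMap) {ρ' : U →ₐ[K] Module.End K M'}
    (hρ' : EvenAct gU γ' ρ'.toLinearMap) {f : M →ₗ[K] M'} (hf : ∀ x, f (γ 1 x) = γ' 1 (f x))
    (h : ∀ a b x, f (ρ (C.gen a b) (γ (par b) x)) = ρ' (C.gen a b) (γ' (par b) (f x))) :
    IsSupermoduleHom gU gM gM' ρ.toLinearMap ρ'.toLinearMap f where
  source := hρ.isSupermodule hM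
  target := hρ'.isSupermodule hM'
  map_mem := hM.map_mem hM' hf
  map_act u := by
    simp only [AlgHom.toLinearMap_apply]
    induction u using C.induction with
    | hgen a b =>
      intro x
      have := h a b (γ (par b) x)
      rwa [← hM.map_of_one hM' hf, hM.self] at this
    | hmap r => simp
    | hadd u v hu hv => intro x; simp only [map_add, LinearMap.add_apply, hu, hv]
    | hmul u v hu hv => intro x; simp only [map_mul, Module.End.mul_apply, hu, hv]

end TensorActions

/-! ### Generators and homomorphisms out of the presented superalgebras -/

theorem ringQuot_induction {X : Type} {rel : FreeAlgebra K X → FreeAlgebra K X → Prop}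
    {P : RingQuot rel → Prop} (hgen : ∀ x, P (RingQuot.mkAlgHom K rel (FreeAlgebra.ι K x)))
    (hmap : ∀ r, P (algebraMap K _ r)) (hadd : ∀ u v, P u → P v → P (u + v))
    (hmul : ∀ u v, P u → P v → P (u * v)) (u : RingQuot rel) : P u := by
  obtain ⟨u, rfl⟩ := RingQuot.mkAlgHom_surjective K rel u
  induction u using FreeAlgebra.induction with
  | grade0 r => rw [AlgHom.commutes]; exact hmap r
  | grade1 x => exact hgen x
  | mul a b ha hb => rw [map_mul]; exact hmul _ _ ha hb
  | add a b ha hb => rw [map_add]; exact hadd _ _ ha hb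

theorem uq_adjoin {N : ℕ} (c : Idx N → Idx N → K) (hc : ∀ a b, c a b ≠ 0) (S : Set (Uq N))
    (hS : ∀ a b, c a b • L a b ∈ S) : Algebra.adjoin K S = ⊤ := by
  rw [eq_top_iff]
  intro u _
  induction u using ringQuot_induction with
  | hgen x =>
    have h := Subalgebra.smul_mem _ (Algebra.subset_adjoin (R := K) (hS x.1.1 x.1.2)) (c x.1.1 x.1.2)⁻¹
    rw [smul_smul, inv_mul_cancel₀ (hc _ _), one_smul] at h
    convert h using 1
    simp [L, freeL, x.2]
  | hmap r => exact Subalgebra.algebraMap_mem _ r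
  | hadd u v hu hv => exact Subalgebra.add_mem _ (hu trivial) (hv trivial)
  | hmul u v hu hv => exact Subalgebra.mul_mem _ (hu trivial) (hv trivial)

theorem aq_induction {r n : ℕ} {P : Aq r n → Prop} (hgen : ∀ i a, P (t i a))
    (hmap : ∀ r, P (algebraMap K _ r)) (hadd : ∀ u v, P u → P v → P (u + v))
    (hmul : ∀ u v, P u → P v → P (u * v)) (u : Aq r n) : P u :=
  ringQuot_induction (fun x => hgen x.1 x.2) hmap hadd hmul u

theorem t_neg {r n : ℕ} (i : Idx r) (a : Idx n) : t (-i) (-a) = t i a :=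
  (RingQuot.mkAlgHom_rel K (ARel.sym i a)).symm

theorem t_mem {r n : ℕ} (i : Idx r) (a : Idx n) : t i a ∈ gradeA r n (par i + par a) :=
  mk_mem_quotGrade _ _ (freeT_mem i a)

/-- By t_{ia} = t_{-i,-a} the rows with positive index already generate. These are the rows on which
the braiding is prescribed. -/
theorem aq_induction_pos {r n : ℕ} {P : Aq r n → Prop} (hgen : ∀ i a, 0 < i.1 → P (t i a))
    (hmap : ∀ r, P (algebraMap K _ r)) (hadd : ∀ u v, P u → P v → P (u + v))
    (hmul : ∀ u v, P u → P v → P (u * v)) (u : Aq r n) : P u := by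
  refine aq_induction (fun i a => ?_) hmap hadd hmul u
  by_cases h : 0 < i.1
  · exact hgen i a h
  · rw [← t_neg]
    refine hgen (-i) (-a) ?_
    have := val_ne_zero i
    rw [neg_val]
    omega

theorem abar_induction {s n : ℕ} {P : Abar s n → Prop} (hgen : ∀ b α, P (barMat tbar b α))
    (hmap : ∀ r, P (algebraMap K _ r)) (hadd : ∀ u v, P u → P v → P (u + v))
    (hmul : ∀ u v, P u → P v → P (u * v)) (u : Abar s n) : P u := by
  refine ringQuot_induction (fun x => ?_) hmap hadd hmul u
  have h := hmul _ _ (hmap (sgn (par x.2 * (par x.1 + par x.2)))) (hgen x.2 x.1)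
  rwa [barMat, ← Algebra.smul_def, smul_smul, sgn_mul_self, one_smul] at h

/-- The sign in `barMat` turns the signed symmetry of t̄ into plain invariance under negating both
indices. -/
theorem barMat_neg {B : Type} [AddCommGroup B] [Module K B] {s n : ℕ} {T : Idx s → Idx n → B}
    (b : Idx n) (α : Idx s) (h : T α b = sgn (par α + par b) • T (-α) (-b)) :
    barMat T (-b) (-α) = barMat T b α := by
  rw [barMat, barMat, h, smul_smul, par_neg, par_neg, ← sgn_add]
  congr 1
  refine sgn_congr ?_
  generalize par b = b, par α = a
  revert a b; decide

theorem barMat_tbar_neg {s n : ℕ} (b : Idx n) (α : Idx s) :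
    barMat tbar (-b) (-α) = barMat tbar b α :=
  barMat_neg b α ((RingQuot.mkAlgHom_rel K (AbarRel.sym α b)).trans (map_smul _ _ _))

theorem barMat_tbar_mem {s n : ℕ} (b : Idx n) (α : Idx s) :
    barMat tbar b α ∈ gradeAbar s n (par b + par α) := by
  rw [add_comm]
  exact Submodule.smul_mem _ _ (mk_mem_quotGrade _ _ (freeT_mem α b))

theorem mix_t (r n : ℕ) : Mix (S r) (t (r := r) (n := n)) t (S n) := by
  rw [mix_iff (evenScal_S r) (evenScal_S n)]
  intro i x j y
  have h := RingQuot.mkAlgHom_rel K (ARel.rtt i x j y)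
  rw [scal_dot_legs (evenScal_S r), legs_dot_scal (evenScal_S n)] at h
  simp only [map_sum, map_smul, map_mul] at h
  exact h

theorem map_barMat {B C : Type} [Ring B] [Algebra K B] [Ring C] [Algebra K C] {s n : ℕ}
    (f : B →ₐ[K] C) (T : Idx s → Idx n → B) (b : Idx n) (α : Idx s) :
    f (barMat T b α) = barMat (fun α b => f (T α b)) b α := by
  rw [barMat, barMat, map_smul]

theorem rll_tbar (s n : ℕ) : RLL (S n) (barMat (tbar (s := s) (n := n))) (S s) := by
  rw [rll_iff (evenScal_S n) (evenScal_S s)]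
  intro i x j y
  have h := RingQuot.mkAlgHom_rel K (AbarRel.rtt i x j y)
  rw [rll_left_apply (evenScal_S s), rll_right_apply (evenScal_S n)] at h
  simp only [map_sum, map_smul, map_mul, map_barMat] at h
  exact h

/-- Homomorphisms out of `A_{r,n}`. -/
def liftA {r n : ℕ} {B : Type} [Ring B] [Algebra K B] (T : Idx r → Idx n → B)
    (hneg : ∀ i a, T (-i) (-a) = T i a) (hmix : Mix (S r) T T (S n)) : Aq r n →ₐ[K] B :=
  RingQuot.liftAlgHom K ⟨FreeAlgebra.lift K fun x : TGen r n => T x.1 x.2, by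
    have hT : ∀ i a, FreeAlgebra.lift K (fun x : TGen r n => T x.1 x.2) (freeT i a) = T i a :=
      fun i a => by simp [freeT]
    rintro _ _ (⟨i, a⟩ | ⟨i, a, j, b⟩)
    · rw [hT, hT, hneg]
    · rw [scal_dot_legs (evenScal_S r), legs_dot_scal (evenScal_S n)]
      simp only [map_sum, map_smul, map_mul, hT]
      exact (mix_iff (evenScal_S r) (evenScal_S n) T T).1 hmix i a j b⟩

theorem liftA_t {r n : ℕ} {B : Type} [Ring B] [Algebra K B] (T : Idx r → Idx n → B)
    (hneg : ∀ i a, T (-i) (-a) = T i a) (hmix : Mix (S r) T T (S n)) (i : Idx r) (a : Idx n) :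
    liftA T hneg hmix (t i a) = T i a :=
  (RingQuot.liftAlgHom_mkAlgHom_apply K _ _ _).trans (by simp [freeT])

/-- Homomorphisms out of `Ā_{s,n}`. -/
def liftAbar {s n : ℕ} {B : Type} [Ring B] [Algebra K B] (T : Idx n → Idx s → B)
    (hneg : ∀ b α, T (-b) (-α) = T b α) (hrll : RLL (S n) T (S s)) : Abar s n →ₐ[K] B :=
  RingQuot.liftAlgHom K ⟨FreeAlgebra.lift K fun x : TGen s n =>
      sgn (par x.2 * (par x.1 + par x.2)) • T x.2 x.1, by
    have hT : ∀ b α, FreeAlgebra.lift K (fun x : TGen s n =>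
        sgn (par x.2 * (par x.1 + par x.2)) • T x.2 x.1) (barMat freeT b α) = T b α := by
      intro b α
      simp only [freeT, barMat, map_smul, FreeAlgebra.lift_ι_apply, smul_smul, sgn_mul_self, one_smul]
    rintro _ _ (⟨α, b⟩ | ⟨a, α, b, β⟩)
    · simp only [freeT, map_smul, FreeAlgebra.lift_ι_apply, hneg, smul_smul, par_neg, ← sgn_add]
      congr 1
      refine sgn_congr ?_
      generalize par b = b, par α = a
      revert a b; decide
    · rw [rll_left_apply (evenScal_S s), rll_right_apply (evenScal_S n)]
      simp only [map_sum, map_smul, map_mul, hT]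
      exact (rll_iff (evenScal_S n) (evenScal_S s) T).1 hrll a α b β⟩

theorem liftAbar_tbar {s n : ℕ} {B : Type} [Ring B] [Algebra K B] (T : Idx n → Idx s → B)
    (hneg : ∀ b α, T (-b) (-α) = T b α) (hrll : RLL (S n) T (S s)) (b : Idx n) (α : Idx s) :
    liftAbar T hneg hrll (barMat tbar b α) = T b α := by
  rw [map_barMat, barMat]
  have h : liftAbar T hneg hrll (tbar α b) = sgn (par b * (par α + par b)) • T b α :=
    (RingQuot.liftAlgHom_mkAlgHom_apply K _ _ _).trans (by simp [freeT])
  rw [h, smul_smul, sgn_mul_self, one_smul]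

theorem liftU_L {N : ℕ} {B : Type} [Ring B] [Algebra K B] (M : Idx N → Idx N → B)
    (h0 : ∀ i j, ¬ i ≤ j → M i j = 0) (hinv : ∀ i, M i i * M (-i) (-i) = 1)
    (hrll : leg1 N (genMat M) ⋆ leg2 N (genMat M) ⋆ scal B (S N) =
      scal B (S N) ⋆ leg2 N (genMat M) ⋆ leg1 N (genMat M)) (i j : Idx N) :
    liftU M h0 hinv hrll (L i j) = M i j := by
  refine (RingQuot.liftAlgHom_mkAlgHom_apply K _ _ _).trans ?_
  unfold freeL
  split
  · simp
  · next h => rw [map_zero, h0 i j h]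

/-! ### The two comultiplications -/

theorem sgn_ne_zero (d : ZMod 2) : sgn d ≠ 0 := by
  intro h
  have := sgn_mul_self d
  rw [h, mul_zero] at this
  exact zero_ne_one this

theorem comulAlg_L {N : ℕ} (a b : Idx N) : comulAlg N (L a b) = comulGen a b :=
  liftU_L comulGen _ _ _ a b

/-- `U_q(𝔮_N)` with the generators `(-1)^{|a|(|b|+1)} L_{ab}`. -/
def coalgU (N : ℕ) : MatCoalg (gradeU N) N where
  gen a b := sgn (par a * (par b + 1)) • L a b
  gen_mem a b := Submodule.smul_mem _ _ (L_mem a b)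
  adjoin_gen := uq_adjoin (fun a b => sgn (par a * (par b + 1))) (fun _ _ => sgn_ne_zero _) _
    fun a b => ⟨a, b, rfl⟩
  comulHom := comulAlg N
  comulHom_gen a b := by
    rw [map_smul, comulAlg_L, comulGen, map_smul, map_sum, Finset.smul_sum]
    refine Finset.sum_congr rfl fun c _ => ?_
    rw [map_smul, TensorProduct.smul_tmul_smul, ← sgn_add, smul_smul, ← sgn_add]
    congr 1
    -- The normalising sign (-1)^{|a|(|b|+1)} is chosen for this identity: it absorbs the sign
    -- (-1)^{(|a|+|c|)(|c|+|b|)} of the comultiplication.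
    refine sgn_congr ?_
    generalize par a = a, par b = b, par c = c
    revert a b c; decide
  counitHom := counitAlg N
  counitHom_gen a b := by
    rw [map_smul, counitAlg, liftU_L]
    split
    · next h =>
      rw [h, show par b * (par b + 1) = 0 by generalize par b = b; revert b; decide, sgn_zero,
        one_smul]
    · rw [smul_zero]

theorem superFlip_tmul {U : Type} [Ring U] [Algebra K U] (gU : ZMod 2 → Submodule K U)
    [GradedAlgebra gU] {d e : ZMod 2} {u v : U} (hu : u ∈ gU d) (hv : v ∈ gU e) :
    superFlip gU (u ⊗ₜ v) = sgn (d * e) • v ⊗ₜ u := by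
  rw [superFlip, LinearMap.sum_apply, Finset.sum_eq_single d]
  · rw [LinearMap.comp_apply, TensorProduct.map_tmul, twist_of_mem gU _ hv,
      GradedAlgebra.proj_apply, DirectSum.decompose_of_mem_same gU hu]
    simp [TensorProduct.smul_tmul']
  · intro b _ hb
    rw [LinearMap.comp_apply, TensorProduct.map_tmul,
      GradedAlgebra.proj_apply, DirectSum.decompose_of_mem_ne gU hu (Ne.symm hb)]
    simp
  · simp

/-- The super flip is the commutativity isomorphism of the graded tensor product, hence
multiplicative; this makes the co-opposite comultiplication an algebra homomorphism. -/
theorem superFlip_eq {U : Type} [Ring U] [Algebra K U] (gU : ZMod 2 → Submodule K U)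
    [GradedAlgebra gU] (z : GradedTensorProduct K gU gU) :
    superFlip gU ((GradedTensorProduct.of K gU gU).symm z) =
      (GradedTensorProduct.of K gU gU).symm (GradedTensorProduct.comm gU gU z) := by
  obtain ⟨z, rfl⟩ := (GradedTensorProduct.of K gU gU).surjective z
  rw [LinearEquiv.symm_apply_apply]
  induction z using TensorProduct.induction_on with
  | zero => simp
  | add z w hz hw => simp only [map_add, hz, hw]
  | tmul u v =>
    induction u using (parity_twist gU).induction with
    | hadd u u' hu hu' => simp only [map_add, TensorProduct.add_tmul, hu, hu']
    | hom d u hu =>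
      induction v using (parity_twist gU).induction with
      | hadd u u' hu hu' => simp only [map_add, TensorProduct.tmul_add, hu, hu']
      | hom e v hv =>
        rw [superFlip_tmul gU hu hv]
        have h := GradedTensorProduct.comm_coe_tmul_coe (R := K) gU gU ⟨u, hu⟩ ⟨v, hv⟩
        refine Eq.trans ?_ (congrArg (GradedTensorProduct.of K gU gU).symm h).symm
        rw [mul_comm]
        rcases zmod_two_cases (e * d) with h | h <;> rw [h] <;> simp [sgn]

/-- `U_q(𝔮_N)^cop` with the generators `ℓ_{ab} = L_{ba}`. -/
def coalgUcop (N : ℕ) : MatCoalg (gradeU N) N where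
  gen a b := L b a
  gen_mem a b := by rw [add_comm]; exact L_mem b a
  adjoin_gen := uq_adjoin (fun _ _ => 1) (fun _ _ => one_ne_zero) _ fun a b => ⟨b, a, one_smul _ _⟩
  comulHom := (GradedTensorProduct.comm (gradeU N) (gradeU N)).toAlgHom.comp (comulAlg N)
  comulHom_gen a b := by
    refine (superFlip_eq (gradeU N) _).symm.trans ?_
    refine (congrArg (fun z => superFlip (gradeU N)
      ((GradedTensorProduct.of K (gradeU N) (gradeU N)).symm z)) (comulAlg_L b a)).trans ?_
    rw [comulGen, map_sum, map_sum]
    refine Finset.sum_congr rfl fun c _ => ?_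
    rw [map_smul, map_smul]
    refine (congrArg _ (superFlip_tmul (gradeU N) (L_mem b c) (L_mem c a))).trans ?_
    -- The super flip produces the same sign as the comultiplication already carries. The
    -- co-opposite generators therefore need no rescaling, only the exchange of indices.
    rw [smul_smul, sgn_mul_self, one_smul]
  counitHom := counitAlg N
  counitHom_gen a b := by
    rw [counitAlg, liftU_L]
    simp only [eq_comm]

theorem coalgUcop_Δ (N : ℕ) : (coalgUcop N).Δ = superFlip (gradeU N) ∘ₗ comul N := by
  ext1 u
  exact (superFlip_eq (gradeU N) _).symm

/-! ### Further matrix relations -/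

/-- For even Z the total parity of the two factors in each contributing term is fixed by the outer
indices, so the signs of `genMat` come out of the sums as a common factor. -/
theorem Mix.genMat {B : Type} [Ring B] [Algebra K B] {a c : ℕ} {Z : Mat2 a a c c K}
    (hZ : EvenScal Z) {T : Idx a → Idx a → B} {U : Idx c → Idx c → B}
    (h : Mix Z T U Z) : Mix Z (genMat T) (genMat U) Z := by
  rw [mix_iff hZ hZ] at h ⊢
  intro i x j y
  have e := congrArg (sgn (par i + par x + par j + par y) • ·) (h i x j y)
  simp only [Finset.smul_sum, smul_smul] at e
  refine Eq.trans (sum_congr₂ fun k l => ?_) (e.trans (sum_congr₂ fun k l => ?_))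
  · by_cases h : par i + par k + par j + par l = 0
    · simp only [QueerBraid.genMat, smul_mul_smul_comm, smul_smul]
      congr 1
      have hs : sgn (par k + par x) * sgn (par l + par y) = sgn (par i + par x + par j + par y) := by
        rw [← sgn_add]
        exact sgn_congr (by linear_combination h - add_self_two (par i + par j))
      rw [← hs]
      ring
    · rw [hZ i k j l h]
      simp
  · by_cases h : par k + par x + par l + par y = 0
    · simp only [QueerBraid.genMat, smul_mul_smul_comm, smul_smul]
      congr 1
      have hs : sgn (par j + par l) * sgn (par i + par k) = sgn (par i + par x + par j + par y) := by
        rw [← sgn_add]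
        exact sgn_congr (by linear_combination h - add_self_two (par x + par y))
      rw [← hs]
      ring
    · rw [hZ k x l y h]
      simp

theorem rll_iff_mix_S {B : Type} [Ring B] [Algebra K B] {N : ℕ} {T : Idx N → Idx N → B} :
    RLL (S N) T (S N) ↔ Mix (Sinv N) T T (Sinv N) :=
  rll_iff_mix (scal_S_inv B N).1 (scal_S_inv B N).2

theorem mix_iff_rll_S {B : Type} [Ring B] [Algebra K B] {N : ℕ} {T : Idx N → Idx N → B} :
    Mix (S N) T T (S N) ↔ RLL (Sinv N) T (Sinv N) :=
  (rll_iff_mix (scal_S_inv B N).2 (scal_S_inv B N).1).symm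

/-! ### Symmetries of `S` -/

/-- Negating the indices of the first leg exchanges the two off-diagonal terms, and φ depends on its
first index only up to sign. This is what makes the homomorphisms of the actions respect the
symmetry of the generators. -/
theorem sMatrix_neg_neg {N : ℕ} (Q : K) (i k j l : Idx N) :
    sMatrix N Q (-i) (-k) j l = sMatrix N Q i k j l := by
  have h1 : (-i = -k ∧ j = l) ↔ (i = k ∧ j = l) := by rw [neg_idx_inj]
  have h2 : (-i = l ∧ -k = j) ↔ (i = -l ∧ k = -j) := by
    rw [neg_idx_eq_comm (i := i), neg_idx_eq_comm (i := k)]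
    simp only [eq_comm]
  have h3 : (-i = -l ∧ -k = -j) ↔ (i = l ∧ k = j) := by rw [neg_idx_inj, neg_idx_inj]
  have h4 : phi (-i) j = phi i j := by
    unfold phi
    have e1 : (-i = j) ↔ (i = -j) := by rw [neg_idx_eq_comm (i := i)]; simp only [eq_comm]
    have e2 : (-i = -j) ↔ (i = j) := neg_idx_inj
    simp only [e1, e2]
    ring
  unfold sMatrix
  simp only [h1, h2, h3, h4]
  rw [add_comm (if i = -l ∧ k = -j then (1 : K) else 0)]

theorem S_neg_neg {N : ℕ} (i k j l : Idx N) : S N (-i) (-k) j l = S N i k j l :=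
  sMatrix_neg_neg q i k j l

theorem Sinv_neg_neg {N : ℕ} (i k j l : Idx N) : Sinv N (-i) (-k) j l = Sinv N i k j l :=
  sMatrix_neg_neg q⁻¹ i k j l

theorem phi_neg_right {N : ℕ} (i j : Idx N) : phi i (-j) = - phi i j := by
  have hj := val_ne_zero j
  unfold phi
  rw [neg_neg_idx, neg_val]
  split_ifs <;> omega

/-- Flipping both indices of the second leg. -/
theorem S_neg_second {N : ℕ} (i k j l : Idx N) : S N i k (-j) (-l) =
    S N i k j l - (q - q⁻¹) * (sgn (par j) * ((if i = l ∧ k = j then 1 else 0) +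
      (if i = -l ∧ k = -j then 1 else 0))) := by
  unfold S sMatrix
  rw [neg_neg_idx, neg_neg_idx, phi_neg_right, par_neg, sgn_add, sgn_one]
  have hlt : (-j < -l) ↔ (l < j) := neg_idx_lt
  have hjl : (-j = -l) ↔ (j = l) := neg_idx_inj
  simp only [hjl, hlt]
  -- For j ≠ l exactly one of the two entries can have an off-diagonal term, which is the correction
  -- term up to its sign. For j = l the correction is the difference of q^φ and q^{-φ} with φ ∈ {-1,
  -- 0, 1}.
  rcases lt_trichotomy j l with h | h | h
  · have h1 : j ≠ l := h.ne
    simp only [h, h1, not_lt_of_gt h, if_true, if_false, and_false]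
    ring
  · subst h
    simp only [lt_irrefl, if_false, mul_zero, add_zero, and_true]
    by_cases hik : i = k
    · subst hik
      simp only [if_true, and_self]
      have hs : sgn (par j) = if j.1 < 0 then -1 else 1 := by
        unfold sgn par; split_ifs <;> simp_all
      rw [hs]
      unfold phi
      by_cases h : i = j
      · have h' : i ≠ -j := fun h' => neg_idx_ne j (h'.symm.trans h)
        rw [if_pos h, if_neg h', if_pos h, if_neg h']
        split_ifs <;> simp
      · by_cases h' : i = -j
        · rw [if_neg h, if_pos h', if_neg h, if_pos h']
          split_ifs <;> simp
        · simp [h, h']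
    · rw [if_neg hik, if_neg (c := i = j ∧ k = j) (fun h => hik (h.1.trans h.2.symm)),
        if_neg (c := i = -j ∧ k = -j) (fun h => hik (h.1.trans h.2.symm))]
      simp [hik]
  · have h1 : j ≠ l := h.ne'
    simp only [h, h1, not_lt_of_gt h, if_true, if_false, and_false]
    ring

theorem sum_neg_idx {N : ℕ} {M : Type} [AddCommMonoid M] (f : Idx N → M) :
    ∑ i, f (-i) = ∑ i, f i :=
  Fintype.sum_equiv ⟨fun i => -i, fun i => -i, neg_neg_idx, neg_neg_idx⟩ _ _ fun _ => rfl

theorem dot1_neg {B : Type} [Ring B] [Algebra K B] {a b c : ℕ} {T : Idx a → Idx b → B}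
    {U : Idx b → Idx c → B} (hT : ∀ i j, T (-i) (-j) = T i j) (hU : ∀ i j, U (-i) (-j) = U i j)
    (i : Idx a) (j : Idx c) : dot1 T U (-i) (-j) = dot1 T U i j := by
  unfold dot1
  rw [← sum_neg_idx]
  refine Finset.sum_congr rfl fun k _ => ?_
  rw [hT, hU, par_neg, par_neg, par_neg]
  congr 1
  refine sgn_congr ?_
  linear_combination (par i + par k + par k + par j + 1 + 1) * add_self_two 1

/-! ### Reduction of the relation S T¹T² = T²T¹S to the rows with positive index. -/

section PositiveRows

variable {B : Type} [Ring B] [Algebra K B] {r n : ℕ}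

/-- The difference of the two sides of the entry of `S T¹ T² = T² T¹ S`. -/
def mixDefect (T : Idx r → Idx n → B) (i : Idx r) (x : Idx n) (j : Idx r) (y : Idx n) : B :=
  (∑ k, ∑ l, (sgn ((par k + par x) * (par j + par y)) * S r i k j l) • (T k x * T l y)) -
    ∑ k, ∑ l, (sgn ((par j + par l) * (par k + par x)) * S n k x l y) • (T j l * T i k)

theorem mixDefect_neg_left {T : Idx r → Idx n → B} (hT : ∀ i a, T (-i) (-a) = T i a)
    (i : Idx r) (x : Idx n) (j : Idx r) (y : Idx n) :
    mixDefect T (-i) (-x) j y = mixDefect T i x j y := by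
  unfold mixDefect
  congr 1
  · rw [← sum_neg_idx]
    refine sum_congr₂ fun k l => ?_
    rw [S_neg_neg, hT, par_neg, par_neg]
    congr 2
    refine sgn_congr ?_
    linear_combination (par j + par y) * add_self_two 1
  · rw [← sum_neg_idx]
    refine sum_congr₂ fun k l => ?_
    rw [S_neg_neg, hT, par_neg, par_neg]
    congr 2
    refine sgn_congr ?_
    linear_combination (par j + par l) * add_self_two 1

/-- The second leg of `S` is not invariant under negation. By `S_neg_second` both sides change, but
by the same combination of T_{jx}T_{iy} and T_{-j,x}T_{-i,y}, so their difference does not. -/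
theorem mixDefect_neg_right {T : Idx r → Idx n → B} (hT : ∀ i a, T (-i) (-a) = T i a)
    (i : Idx r) (x : Idx n) (j : Idx r) (y : Idx n) :
    mixDefect T i x (-j) (-y) = mixDefect T i x j y := by
  have e1 : ∑ k, ∑ l, (sgn ((par k + par x) * (par (-j) + par (-y))) * S r i k (-j) l) •
      (T k x * T l (-y)) =
      ∑ k, ∑ l, (sgn ((par k + par x) * (par j + par y)) * S r i k j l) • (T k x * T l y) -
      (q - q⁻¹) • (sgn (par j * par y + par j * par x + par x * par y) • (T j x * T i y) +
        sgn (par j * par y + par j * par x + par x * par y + par j + par y) •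
          (T (-j) x * T (-i) y)) := by
    have h1 : (q - q⁻¹) • (sgn (par j * par y + par j * par x + par x * par y) • (T j x * T i y)) =
        ∑ k, ∑ l, (if i = l ∧ k = j then (q - q⁻¹) * (sgn (par j + (par k + par x) *
          (par j + par y))) else 0) • (T k x * T l y) := by
      rw [Finset.sum_eq_single j, Finset.sum_eq_single i]
      · rw [if_pos ⟨rfl, rfl⟩, smul_smul]
        congr 2
        refine sgn_congr ?_
        generalize par j = j, par x = x, par y = y
        revert j x y; decide
      · intro l _ h
        rw [if_neg (fun h' => h h'.1.symm), zero_smul]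
      · simp
      · intro k _ h
        exact Finset.sum_eq_zero fun l _ => by rw [if_neg (fun h' => h h'.2), zero_smul]
      · simp
    have h2 : (q - q⁻¹) • (sgn (par j * par y + par j * par x + par x * par y + par j + par y) •
          (T (-j) x * T (-i) y)) =
        ∑ k, ∑ l, (if i = -l ∧ k = -j then (q - q⁻¹) * (sgn (par j + (par k + par x) *
          (par j + par y))) else 0) • (T k x * T l y) := by
      rw [Finset.sum_eq_single (-j), Finset.sum_eq_single (-i)]
      · rw [if_pos ⟨(neg_neg_idx i).symm, rfl⟩, smul_smul, par_neg]
        congr 2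
        refine sgn_congr ?_
        generalize par j = j, par x = x, par y = y
        revert j x y; decide
      · intro l _ h
        rw [if_neg (fun h' => h (neg_idx_eq_comm.1 h'.1)), zero_smul]
      · simp
      · intro k _ h
        exact Finset.sum_eq_zero fun l _ => by rw [if_neg (fun h' => h h'.2), zero_smul]
      · simp
    rw [smul_add, h1, h2, ← Finset.sum_add_distrib, ← Finset.sum_sub_distrib]
    refine Finset.sum_congr rfl fun k _ => ?_
    rw [← Finset.sum_add_distrib, ← Finset.sum_sub_distrib, ← sum_neg_idx]
    refine Finset.sum_congr rfl fun l _ => ?_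
    rw [S_neg_second, hT, ← add_smul, ← sub_smul, par_neg, par_neg]
    congr 1
    rw [show (par k + par x) * (par j + 1 + (par y + 1)) = (par k + par x) * (par j + par y) by
      linear_combination (par k + par x) * add_self_two 1]
    rw [sgn_add (par j)]
    split_ifs <;> ring
  have e2 : ∑ k, ∑ l, (sgn ((par (-j) + par l) * (par k + par x)) * S n k x l (-y)) •
      (T (-j) l * T i k) =
      ∑ k, ∑ l, (sgn ((par j + par l) * (par k + par x)) * S n k x l y) • (T j l * T i k) -
      (q - q⁻¹) • (sgn (par j * par y + par j * par x + par x * par y) • (T j x * T i y) +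
        sgn (par j * par y + par j * par x + par x * par y + par j + par y) •
          (T (-j) x * T (-i) y)) := by
    have h1 : (q - q⁻¹) • (sgn (par j * par y + par j * par x + par x * par y) • (T j x * T i y)) =
        ∑ k, ∑ l, (if k = y ∧ x = l then (q - q⁻¹) * (sgn (par l + (par j + par l) *
          (par k + par x))) else 0) • (T j l * T i k) := by
      rw [Finset.sum_eq_single y, Finset.sum_eq_single x]
      · rw [if_pos ⟨rfl, rfl⟩, smul_smul]
        congr 2
        refine sgn_congr ?_
        generalize par j = j, par x = x, par y = y
        revert j x y; decide
      · intro l _ h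
        rw [if_neg (fun h' => h h'.2.symm), zero_smul]
      · simp
      · intro k _ h
        exact Finset.sum_eq_zero fun l _ => by rw [if_neg (fun h' => h h'.1), zero_smul]
      · simp
    have h2 : (q - q⁻¹) • (sgn (par j * par y + par j * par x + par x * par y + par j + par y) •
          (T (-j) x * T (-i) y)) =
        ∑ k, ∑ l, (if k = -y ∧ x = -l then (q - q⁻¹) * (sgn (par l + (par j + par l) *
          (par k + par x))) else 0) • (T j l * T i k) := by
      rw [Finset.sum_eq_single (-y), Finset.sum_eq_single (-x)]
      · rw [if_pos ⟨rfl, (neg_neg_idx x).symm⟩, smul_smul, par_neg, par_neg, ← hT j (-x),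
          ← hT i (-y), neg_neg_idx, neg_neg_idx]
        congr 2
        refine sgn_congr ?_
        generalize par j = j, par x = x, par y = y
        revert j x y; decide
      · intro l _ h
        rw [if_neg (fun h' => h (neg_idx_eq_comm.1 h'.2)), zero_smul]
      · simp
      · intro k _ h
        exact Finset.sum_eq_zero fun l _ => by rw [if_neg (fun h' => h h'.1), zero_smul]
      · simp
    rw [smul_add, h1, h2, ← Finset.sum_add_distrib, ← Finset.sum_sub_distrib]
    refine Finset.sum_congr rfl fun k _ => ?_
    rw [← Finset.sum_add_distrib, ← Finset.sum_sub_distrib, ← sum_neg_idx]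
    refine Finset.sum_congr rfl fun l _ => ?_
    rw [S_neg_second, hT, ← add_smul, ← sub_smul, par_neg, par_neg]
    congr 1
    rw [show (par j + 1 + (par l + 1)) * (par k + par x) = (par j + par l) * (par k + par x) by
      linear_combination (par k + par x) * add_self_two 1]
    rw [sgn_add (par l)]
    split_ifs <;> ring
  unfold mixDefect
  rw [e1, e2]
  abel

/-- Negating (i, x) or (j, y) does not change the defect, so every pair of rows can be moved to a
pair of positive rows. -/
theorem mix_of_pos {T : Idx r → Idx n → B} (hT : ∀ i a, T (-i) (-a) = T i a)
    (h : ∀ i x j y, 0 < i.1 → 0 < j.1 → mixDefect T i x j y = 0) : Mix (S r) T T (S n) := by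
  rw [mix_iff (evenScal_S r) (evenScal_S n)]
  intro i x j y
  rw [← sub_eq_zero]
  change mixDefect T i x j y = 0
  have hn : ∀ {m : ℕ} (i : Idx m), ¬ 0 < i.1 → 0 < (-i).1 := by
    intro m i h
    have := val_ne_zero i
    rw [neg_val]
    omega
  have h' : ∀ i x j y, 0 < i.1 → mixDefect T i x j y = 0 := by
    intro i x j y hi
    by_cases hj : 0 < j.1
    · exact h i x j y hi hj
    · rw [← mixDefect_neg_right hT]
      exact h _ _ _ _ hi (hn j hj)
  by_cases hi : 0 < i.1
  · exact h' i x j y hi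
  · rw [← mixDefect_neg_left hT]
    exact h' _ _ _ _ (hn i hi)

/-- The only term that could lead from positive rows to a negative column has i = -l and j < l,
which is impossible for i, j > 0. So the relations in positive rows involve no other rows. -/
theorem S_pos_rows {N : ℕ} {i k j l : Idx N} (hi : 0 < i.1) (hj : 0 < j.1) (h : S N i k j l ≠ 0) :
    0 < k.1 ∧ 0 < l.1 := by
  by_contra hk
  apply h
  have h1 : ¬ (i = k ∧ j = l) := by
    rintro ⟨rfl, rfl⟩; exact hk ⟨hi, hj⟩
  have h2 : ¬ (i = l ∧ k = j) := by
    rintro ⟨rfl, rfl⟩; exact hk ⟨hj, hi⟩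
  unfold S sMatrix
  rw [if_neg h1, if_neg h2]
  by_cases hjl : j < l
  · rw [if_neg (c := i = -l ∧ k = -j)]
    · simp
    · rintro ⟨rfl, rfl⟩
      rw [neg_val] at hi
      have : j.1 < l.1 := hjl
      omega
  · rw [if_neg hjl]
    simp

/-- The rows with positive index of a solution extend to a symmetric solution. -/
theorem mix_symmetrize {F : Idx r → Idx n → B} (hF : Mix (S r) F F (S n)) :
    Mix (S r) (fun i a => if 0 < i.1 then F i a else F (-i) (-a))
      (fun i a => if 0 < i.1 then F i a else F (-i) (-a)) (S n) := by
  rw [mix_iff (evenScal_S r) (evenScal_S n)] at hF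
  refine mix_of_pos ?_ ?_
  · intro i a
    have := val_ne_zero i
    by_cases h : 0 < i.1
    · rw [if_pos h, if_neg (by rw [neg_val]; omega), neg_neg_idx, neg_neg_idx]
    · rw [if_neg h, if_pos (by rw [neg_val]; omega)]
  · intro i x j y hi hj
    rw [mixDefect, sub_eq_zero]
    -- On positive rows the symmetrised matrix is F itself, and by `S_pos_rows` only such rows
    -- contribute.
    refine Eq.trans (sum_congr₂ fun k l => ?_) ((hF i x j y).trans (sum_congr₂ fun k l => ?_))
    · by_cases h : S r i k j l = 0
      · rw [h]; simp
      · obtain ⟨hk, hl⟩ := S_pos_rows hi hj h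
        rw [if_pos hk, if_pos hl]
    · rw [if_pos hi, if_pos hj]

end PositiveRows

/-! ### Homomorphisms to matrices -/

section MatrixHoms

variable {X : Type} [Ring X] [Algebra K X] (gX : ZMod 2 → Submodule K X) [GradedAlgebra gX]
  (N : ℕ)

/-- `x ↦ diag((-1)^{|a||x|} x)`, the element `x` moved past matrix units. -/
def iotaMat : X →ₐ[K] Matrix (Idx N) (Idx N) X where
  toFun x := Matrix.diagonal fun a => twist gX (par a) x
  map_one' := by simp [twist_one]
  map_mul' x y := by simp [twist_mul]
  map_zero' := by simp
  map_add' x y := by simp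
  commutes' r := by
    rw [Matrix.algebraMap_eq_diagonal]
    congr 1
    funext a
    rw [Pi.algebraMap_apply, Algebra.algebraMap_eq_smul_one, map_smul, twist_one]

theorem iotaMat_apply (x : X) (a b : Idx N) :
    iotaMat gX N x a b = if a = b then twist gX (par a) x else 0 := by
  simp [iotaMat, Matrix.diagonal_apply]

variable (X) in
/-- Scalar matrices as matrices over `X`. -/
def cstMat : Matrix (Idx N) (Idx N) K →ₐ[K] Matrix (Idx N) (Idx N) X :=
  (Algebra.ofId K X).mapMatrix

theorem cstMat_apply (M : Matrix (Idx N) (Idx N) K) (a b : Idx N) :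
    cstMat X N M a b = algebraMap K X (M a b) := rfl

theorem iota_mul_cst (x : X) (M : Matrix (Idx N) (Idx N) K) (a b : Idx N) :
    (iotaMat gX N x * cstMat X N M) a b = M a b • twist gX (par a) x := by
  rw [iotaMat, AlgHom.coe_mk, RingHom.coe_mk, MonoidHom.coe_mk, OneHom.coe_mk,
    Matrix.diagonal_mul, cstMat_apply, ← Algebra.commutes, ← Algebra.smul_def]

theorem cst_mul_iota (x : X) (M : Matrix (Idx N) (Idx N) K) (a b : Idx N) :
    (cstMat X N M * iotaMat gX N x) a b = M a b • twist gX (par b) x := by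
  rw [iotaMat, AlgHom.coe_mk, RingHom.coe_mk, MonoidHom.coe_mk, OneHom.coe_mk]
  exact (Matrix.mul_diagonal _ _ a b).trans (Algebra.smul_def _ _).symm

-- The diagonal matrix of the elements γ^{|a|}x stands for x to the right of the matrix units. By
-- evenness of Z the usual rule of signs holds between it and the scalar matrices, although both
-- live in an ordinary matrix algebra.
variable {N} in
theorem superComm_cst_iota {Z : Mat2 N N N N K} (hZ : EvenScal Z) {m p : ℕ}
    {T : Idx m → Idx p → X} (hT : ∀ i j, T i j ∈ gX (par i + par j)) :
    SuperComm (fun j c => cstMat X N (xMat Z j c)) (fun i j => iotaMat gX N (T i j)) := by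
  intro j c i k
  ext a b
  rw [cst_mul_iota, Matrix.smul_apply, iota_mul_cst, twist_of_mem gX _ (hT i k),
    twist_of_mem gX _ (hT i k), xMat, Matrix.of_apply]
  by_cases h : par j + par c + par a + par b = 0
  · rw [smul_smul, smul_smul, smul_smul]
    congr 1
    have hs : sgn (par b * (par i + par k)) =
        sgn ((par j + par c) * (par i + par k)) * sgn (par a * (par i + par k)) := by
      rw [← sgn_add]
      refine sgn_congr ?_
      linear_combination (-(par i + par k)) * h + (par i + par k) * add_self_two (par b)
    rw [hs]
    ring
  · rw [hZ j c a b h]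
    simp

variable {N} in
theorem superComm_iota_cst {Z : Mat2 N N N N K} (hZ : EvenScal Z) {m p : ℕ}
    {T : Idx m → Idx p → X} (hT : ∀ i j, T i j ∈ gX (par i + par j)) :
    SuperComm (fun i j => iotaMat gX N (T i j)) (fun j c => cstMat X N (xMat Z j c)) := by
  intro i j k l
  rw [superComm_cst_iota gX hZ hT k l i j, smul_smul, mul_comm (par k + par l), sgn_mul_self,
    one_smul]

variable {gX N}

/-- The entries of `f(x)` have parity `|x| + |a| + |b|`. -/
def EvenHom (gX : ZMod 2 → Submodule K X) [GradedAlgebra gX]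
    (f : X →ₐ[K] Matrix (Idx N) (Idx N) X) : Prop :=
  ∀ d x a b, twist gX d (f x a b) = sgn (d * (par a + par b)) • f (twist gX d x) a b

/-- The parities |a| + |c| and |c| + |b| add up to |a| + |b|, so the condition survives matrix
multiplication. -/
theorem evenHom_of_gen {f : X →ₐ[K] Matrix (Idx N) (Idx N) X} {G : Set X}
    (hG : Algebra.adjoin K G = ⊤)
    (h : ∀ x ∈ G, ∃ d, x ∈ gX d ∧ ∀ a b, f x a b ∈ gX (d + par a + par b)) : EvenHom gX f := by
  intro d x
  have hx : x ∈ Algebra.adjoin K G := by rw [hG]; exact Algebra.mem_top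
  induction hx using Algebra.adjoin_induction with
  | mem x hx =>
    intro a b
    obtain ⟨e, hx, hf⟩ := h x hx
    rw [twist_of_mem gX d hx, twist_of_mem gX d (hf a b), map_smul, Matrix.smul_apply, smul_smul,
      ← sgn_add]
    congr 1
    exact sgn_congr (by ring)
  | algebraMap r =>
    intro a b
    have h1 : twist gX d (algebraMap K X r) = algebraMap K X r := by
      rw [Algebra.algebraMap_eq_smul_one, map_smul, twist_one]
    rw [h1, AlgHom.commutes, Matrix.algebraMap_matrix_apply]
    split
    · next h => rw [h1, h, add_self_two, mul_zero, sgn_zero, one_smul]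
    · simp
  | add x y _ _ hx hy =>
    intro a b
    rw [map_add f, Matrix.add_apply, map_add, map_add, map_add, Matrix.add_apply, hx, hy, smul_add]
  | mul x y _ _ hx hy =>
    intro a b
    rw [twist_mul, map_mul, map_mul, Matrix.mul_apply, Matrix.mul_apply, map_sum, Finset.smul_sum]
    refine Finset.sum_congr rfl fun c _ => ?_
    rw [twist_mul, hx, hy, smul_mul_smul_comm, ← sgn_add]
    congr 1
    refine sgn_congr ?_
    linear_combination d * add_self_two (par c)

/-- The operators `(-1)^{|b|(|a|+|b|)} f_{ab} γ^{|b|}`. -/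
def opMat (gX : ZMod 2 → Submodule K X) [GradedAlgebra gX]
    (f : X →ₐ[K] Matrix (Idx N) (Idx N) X) (a b : Idx N) : Module.End K X :=
  sgn (par b * (par a + par b)) •
    (Matrix.entryLinearMap K X a b ∘ₗ f.toLinearMap ∘ₗ twist gX (par b))

theorem opMat_apply (f : X →ₐ[K] Matrix (Idx N) (Idx N) X) (a b : Idx N) (x : X) :
    opMat gX f a b x = sgn (par b * (par a + par b)) • f (twist gX (par b) x) a b := rfl

/-- The operators `(-1)^{|a|+|b|} f_{ba} γ^{|a|}`. -/
def opMatT (gX : ZMod 2 → Submodule K X) [GradedAlgebra gX]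
    (f : X →ₐ[K] Matrix (Idx N) (Idx N) X) (a b : Idx N) : Module.End K X :=
  sgn (par a + par b) • (Matrix.entryLinearMap K X b a ∘ₗ f.toLinearMap ∘ₗ twist gX (par a))

theorem opMatT_apply (f : X →ₐ[K] Matrix (Idx N) (Idx N) X) (a b : Idx N) (x : X) :
    opMatT gX f a b x = sgn (par a + par b) • f (twist gX (par a) x) b a := rfl

theorem opMatT_eq (f : X →ₐ[K] Matrix (Idx N) (Idx N) X) (a b : Idx N) (x : X) :
    opMatT gX f a b x = sgn (par b * (par a + 1)) • opMat gX f b a x := by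
  rw [opMat_apply, opMatT_apply, smul_smul, ← sgn_add]
  congr 1
  refine sgn_congr ?_
  generalize par a = a, par b = b
  revert a b; decide

/-! ### Values on generators of the homomorphisms T ↦ TZ and T ↦ ZT. -/

section Generators

variable {m p : ℕ}

theorem right_apply {T : Idx m → Idx N → X} (hT : ∀ i j, T i j ∈ gX (par i + par j))
    {Z : Mat2 N N N N K} (hZ : EvenScal Z) (i : Idx m) (c : Idx N) (a b : Idx N) :
    dot1 (fun i j => iotaMat gX N (T i j)) (fun j c => cstMat X N (xMat Z j c)) i c a b =
      ∑ j, (sgn ((par i + par j) * par b) * Z j c a b) • T i j := by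
  rw [dot1, Matrix.sum_apply]
  refine Finset.sum_congr rfl fun j _ => ?_
  rw [Matrix.smul_apply, iota_mul_cst, twist_of_mem gX _ (hT i j), smul_smul, smul_smul, xMat,
    Matrix.of_apply]
  by_cases h : par j + par c + par a + par b = 0
  · congr 1
    have hs : sgn ((par i + par j) * par b) =
        sgn ((par i + par j) * (par j + par c)) * sgn (par a * (par i + par j)) := by
      rw [← sgn_add]
      refine sgn_congr ?_
      linear_combination (-(par i + par j)) * h + (par i + par j) * add_self_two (par b)
    rw [hs]
    ring
  · rw [hZ j c a b h]
    simp

theorem left_apply {T : Idx N → Idx p → X} (hT : ∀ i j, T i j ∈ gX (par i + par j))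
    {Z : Mat2 N N N N K} (hZ : EvenScal Z) (c : Idx N) (α : Idx p) (a b : Idx N) :
    dot1 (fun j c => cstMat X N (xMat Z j c)) (fun i j => iotaMat gX N (T i j)) c α a b =
      ∑ d, (sgn (par a * (par d + par α)) * Z c d a b) • T d α := by
  rw [dot1, Matrix.sum_apply]
  refine Finset.sum_congr rfl fun d _ => ?_
  rw [Matrix.smul_apply, cst_mul_iota, twist_of_mem gX _ (hT d α), smul_smul, smul_smul, xMat,
    Matrix.of_apply]
  by_cases h : par c + par d + par a + par b = 0
  · congr 1
    have hs : sgn (par a * (par d + par α)) =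
        sgn ((par c + par d) * (par d + par α)) * sgn (par b * (par d + par α)) := by
      rw [← sgn_add]
      refine sgn_congr ?_
      linear_combination (-(par d + par α)) * h + (par d + par α) * add_self_two (par a)
    rw [hs]
    ring
  · rw [hZ c d a b h]
    simp

theorem right_mem {T : Idx m → Idx N → X} (hT : ∀ i j, T i j ∈ gX (par i + par j))
    {Z : Mat2 N N N N K} (hZ : EvenScal Z) (i : Idx m) (c : Idx N) (a b : Idx N) :
    dot1 (fun i j => iotaMat gX N (T i j)) (fun j c => cstMat X N (xMat Z j c)) i c a b ∈
      gX (par i + par c + par a + par b) := by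
  rw [right_apply hT hZ]
  refine Submodule.sum_mem _ fun j _ => ?_
  by_cases h : par j + par c + par a + par b = 0
  · refine Submodule.smul_mem _ _ ?_
    convert hT i j using 2
    linear_combination h - add_self_two (par j)
  · rw [hZ j c a b h]
    simp

theorem left_mem {T : Idx N → Idx p → X} (hT : ∀ i j, T i j ∈ gX (par i + par j))
    {Z : Mat2 N N N N K} (hZ : EvenScal Z) (c : Idx N) (α : Idx p) (a b : Idx N) :
    dot1 (fun j c => cstMat X N (xMat Z j c)) (fun i j => iotaMat gX N (T i j)) c α a b ∈
      gX (par c + par α + par a + par b) := by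
  rw [left_apply hT hZ]
  refine Submodule.sum_mem _ fun d _ => ?_
  by_cases h : par c + par d + par a + par b = 0
  · refine Submodule.smul_mem _ _ ?_
    convert hT d α using 2
    linear_combination h - add_self_two (par d)
  · rw [hZ c d a b h]
    simp

/-- The sign in `opMat` is chosen so that on a row of T these operators act by scalar matrices
without any sign. -/
theorem opMat_right {f : X →ₐ[K] Matrix (Idx N) (Idx N) X} {T : Idx m → Idx N → X}
    (hT : ∀ i j, T i j ∈ gX (par i + par j)) {Z : Mat2 N N N N K} (hZ : EvenScal Z) {i : Idx m}
    {c : Idx N} (hf : f (T i c) =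
      dot1 (fun i j => iotaMat gX N (T i j)) (fun j c => cstMat X N (xMat Z j c)) i c)
    (a b : Idx N) : opMat gX f a b (T i c) = ∑ j, Z j c a b • T i j := by
  rw [opMat_apply, twist_of_mem gX _ (hT i c), map_smul, Matrix.smul_apply, hf, right_apply hT hZ,
    smul_smul, Finset.smul_sum, ← sgn_add]
  refine Finset.sum_congr rfl fun j _ => ?_
  rw [smul_smul, ← mul_assoc, ← sgn_add]
  by_cases h : par j + par c + par a + par b = 0
  · rw [show par b * (par a + par b) + par b * (par i + par c) + (par i + par j) * par b = 0 by
      linear_combination par b * h + par b * add_self_two (par i), sgn_zero, one_mul]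
  · rw [hZ j c a b h]
    simp

/-- Now the operators act on the left index of T. A sign remains, and composition corresponds to the
reversed product of matrices; `mixAt_of_antirep` is made for this situation. -/
theorem opMat_left {f : X →ₐ[K] Matrix (Idx N) (Idx N) X} {T : Idx N → Idx p → X}
    (hT : ∀ i j, T i j ∈ gX (par i + par j)) {Z : Mat2 N N N N K} (hZ : EvenScal Z) {c : Idx N}
    {α : Idx p} (hf : f (T c α) =
      dot1 (fun j c => cstMat X N (xMat Z j c)) (fun i j => iotaMat gX N (T i j)) c α)
    (a b : Idx N) : opMat gX f a b (T c α) =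
      ∑ d, (sgn ((par a + par b) * (par d + par α)) * Z c d a b) • T d α := by
  rw [opMat_apply, twist_of_mem gX _ (hT c α), map_smul, Matrix.smul_apply, hf, left_apply hT hZ,
    smul_smul, Finset.smul_sum, ← sgn_add]
  refine Finset.sum_congr rfl fun d _ => ?_
  rw [smul_smul, ← mul_assoc, ← sgn_add]
  by_cases h : par c + par d + par a + par b = 0
  · congr 2
    refine sgn_congr ?_
    linear_combination par b * h - par b * add_self_two (par d)
  · rw [hZ c d a b h]
    simp

end Generators

/-! ### Exchange relations between operators -/

/-- The elements x with R φ(x) = ψ(x) R form a subalgebra. -/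
theorem intertwine_of_adjoin {Y : Type} [Ring Y] [Algebra K Y] {G : Set X}
    (hG : Algebra.adjoin K G = ⊤) (φ ψ : X →ₐ[K] Y) (R : Y)
    (h : ∀ x ∈ G, R * φ x = ψ x * R) (x : X) : R * φ x = ψ x * R := by
  have hx : x ∈ Algebra.adjoin K G := by rw [hG]; exact Algebra.mem_top
  induction hx using Algebra.adjoin_induction with
  | mem x hx => exact h x hx
  | algebraMap r => rw [AlgHom.commutes, AlgHom.commutes, Algebra.commutes]
  | add x y _ _ hx hy => rw [map_add, map_add, mul_add, add_mul, hx, hy]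
  | mul x y _ _ hx hy => rw [map_mul, map_mul, ← mul_assoc, hx, mul_assoc, hy, mul_assoc]

/-- `x ↦ (f_{kx}(g_{ly}(z)))_{(k,l),(x,y)}`. -/
def compHom (f g : X →ₐ[K] Matrix (Idx N) (Idx N) X) :
    X →ₐ[K] Matrix (Idx N × Idx N) (Idx N × Idx N) X :=
  (Matrix.reindexAlgEquiv K X (Equiv.prodComm (Idx N) (Idx N))).toAlgHom.comp
    ((Matrix.compAlgEquiv (Idx N) (Idx N) X K).toAlgHom.comp (f.mapMatrix.comp g))

/-- `x ↦ (g_{jl}(f_{ik}(z)))_{(i,j),(k,l)}`. -/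
def compHom' (f g : X →ₐ[K] Matrix (Idx N) (Idx N) X) :
    X →ₐ[K] Matrix (Idx N × Idx N) (Idx N × Idx N) X :=
  (Matrix.compAlgEquiv (Idx N) (Idx N) X K).toAlgHom.comp (g.mapMatrix.comp f)

theorem compHom_apply (f g : X →ₐ[K] Matrix (Idx N) (Idx N) X) (z : X) (k l x y : Idx N) :
    compHom f g z (k, l) (x, y) = f (g z l y) k x := rfl

theorem compHom'_apply (f g : X →ₐ[K] Matrix (Idx N) (Idx N) X) (z : X) (k l x y : Idx N) :
    compHom' f g z (k, l) (x, y) = g (f z k x) l y := rfl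

/-- `Z A¹ B² = B² A¹ Z` for matrices of operators, evaluated at a vector. -/
def MixAt {M : Type} [AddCommGroup M] [Module K M] (Z : Mat2 N N N N K)
    (A B : Idx N → Idx N → Module.End K M) (v : M) : Prop := ∀ i x j y,
  ∑ k, ∑ l, (sgn ((par k + par x) * (par j + par y)) * Z i k j l) • A k x (B l y v) =
    ∑ k, ∑ l, (sgn ((par j + par l) * (par k + par x)) * Z k x l y) • B j l (A i k v)

theorem mix_iff_mixAt {M : Type} [AddCommGroup M] [Module K M] {Z : Mat2 N N N N K}
    (hZ : EvenScal Z) {A B : Idx N → Idx N → Module.End K M} :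
    Mix Z A B Z ↔ ∀ v, MixAt Z A B v := by
  rw [mix_iff hZ hZ]
  simp only [LinearMap.ext_iff, LinearMap.sum_apply, LinearMap.smul_apply, Module.End.mul_apply,
    MixAt]
  exact ⟨fun h v i x j y => h i x j y v, fun h i x j y v => h v i x j y⟩

/-- The exchange relation between the entries of `f` and `g`. -/
def Exchange (Z : Mat2 N N N N K) (f g : X →ₐ[K] Matrix (Idx N) (Idx N) X) (z : X) : Prop :=
  ∀ i x j y, ∑ k, ∑ l, (sgn (par j * par k) * Z i k j l) • f (g z l y) k x =
    ∑ k, ∑ l, (sgn (par l * par x) * Z k x l y) • g (f z i k) j l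

/-- Evenness of f and g allows all powers of γ in the operators to be moved to the argument, where
they cancel against γ^{|x|+|y|}. What remains is one overall sign, common to both sides. -/
theorem exchange_iff_mixAt {Z : Mat2 N N N N K} (hZ : EvenScal Z)
    {f g : X →ₐ[K] Matrix (Idx N) (Idx N) X} (hf : EvenHom gX f) (hg : EvenHom gX g)
    (z : X) (i x j y : Idx N) :
    (∑ k, ∑ l, (sgn (par j * par k) * Z i k j l) • f (g z l y) k x =
      ∑ k, ∑ l, (sgn (par l * par x) * Z k x l y) • g (f z i k) j l) ↔
    (∑ k, ∑ l, (sgn ((par k + par x) * (par j + par y)) * Z i k j l) •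
        opMat gX f k x (opMat gX g l y (twist gX (par x + par y) z)) =
      ∑ k, ∑ l, (sgn ((par j + par l) * (par k + par x)) * Z k x l y) •
        opMat gX g j l (opMat gX f i k (twist gX (par x + par y) z))) := by
  have h1 : ∑ k, ∑ l, (sgn ((par k + par x) * (par j + par y)) * Z i k j l) •
        opMat gX f k x (opMat gX g l y (twist gX (par x + par y) z)) =
      sgn ((par i + par j) * (par x + par y) + par x * par j + par x + par y) •
        ∑ k, ∑ l, (sgn (par j * par k) * Z i k j l) • f (g z l y) k x := by
    simp only [Finset.smul_sum]
    refine sum_congr₂ fun k l => ?_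
    rw [opMat_apply, opMat_apply, map_smul, hg, twist_twist, twist_twist,
      add_self_two, twist_zero, map_smul,
      Matrix.smul_apply, map_smul, Matrix.smul_apply, smul_smul, smul_smul, smul_smul, smul_smul]
    congr 1
    by_cases h : par i + par k + par j + par l = 0
    · rw [mul_comm _ (Z i k j l), mul_comm _ (Z i k j l), mul_left_comm _ (Z i k j l), mul_assoc,
        mul_assoc, mul_assoc, ← sgn_add, ← sgn_add, ← sgn_add, ← sgn_add]
      congr 1
      refine sgn_congr ?_
      rw [show par i = par k + par j + par l by
        linear_combination h - add_self_two (par k + par j + par l)]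
      generalize par k = k, par l = l, par j = j, par x = x, par y = y
      revert k l j x y; decide
    · rw [hZ i k j l h]
      simp
  have h2 : ∑ k, ∑ l, (sgn ((par j + par l) * (par k + par x)) * Z k x l y) •
        opMat gX g j l (opMat gX f i k (twist gX (par x + par y) z)) =
      sgn ((par i + par j) * (par x + par y) + par x * par j + par x + par y) •
        ∑ k, ∑ l, (sgn (par l * par x) * Z k x l y) • g (f z i k) j l := by
    simp only [Finset.smul_sum]
    refine sum_congr₂ fun k l => ?_
    by_cases h : par k + par x + par l + par y = 0
    · rw [opMat_apply, opMat_apply, map_smul, hf, twist_twist, twist_twist,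
        show par l + par k + (par x + par y) = 0 by linear_combination h, twist_zero, map_smul,
        Matrix.smul_apply, map_smul, Matrix.smul_apply, smul_smul, smul_smul, smul_smul, smul_smul]
      congr 1
      rw [mul_comm _ (Z k x l y), mul_comm _ (Z k x l y), mul_left_comm _ (Z k x l y), mul_assoc,
        mul_assoc, mul_assoc, ← sgn_add, ← sgn_add, ← sgn_add, ← sgn_add]
      congr 1
      refine sgn_congr ?_
      rw [show par y = par k + par x + par l by
        linear_combination h - add_self_two (par k + par x + par l)]
      generalize par k = k, par l = l, par j = j, par x = x, par i = i
      revert k l j x i; decide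
    · rw [hZ k x l y h]
      simp
  rw [h1, h2]
  exact ⟨fun h => by rw [h], fun h => by
    have := congrArg (sgn ((par i + par j) * (par x + par y) + par x * par j + par x + par y) • ·) h
    simpa only [smul_smul, sgn_mul_self, one_smul] using this⟩

theorem Mix.exchange {Z : Mat2 N N N N K} (hZ : EvenScal Z)
    {f g : X →ₐ[K] Matrix (Idx N) (Idx N) X} (hf : EvenHom gX f) (hg : EvenHom gX g)
    (h : Mix Z (opMat gX f) (opMat gX g) Z) (z : X) : Exchange Z f g z := fun i x j y =>
  (exchange_iff_mixAt hZ hf hg z i x j y).2 ((mix_iff_mixAt hZ).1 h _ i x j y)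

theorem MixAt.smul {M : Type} [AddCommGroup M] [Module K M] {Z : Mat2 N N N N K}
    {A B : Idx N → Idx N → Module.End K M} {v : M} (h : MixAt Z A B v) (c : K) :
    MixAt Z A B (c • v) := by
  intro i x j y
  have e := congrArg (c • ·) (h i x j y)
  simp only [Finset.smul_sum] at e
  refine Eq.trans (sum_congr₂ fun k l => ?_) (e.trans (sum_congr₂ fun k l => ?_))
  · rw [map_smul, map_smul, smul_comm]
  · rw [map_smul, map_smul, smul_comm]

/-- The exchange relation says that Z, with a sign, intertwines the two algebra homomorphisms
obtained by composing f and g in either order. So it holds everywhere as soon as it holds on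
generators, which would not be visible from the operators themselves, since these are not
multiplicative. -/
theorem mix_opMat {Z : Mat2 N N N N K} (hZ : EvenScal Z)
    {f g : X →ₐ[K] Matrix (Idx N) (Idx N) X} (hf : EvenHom gX f) (hg : EvenHom gX g)
    {G : Set X} (hG : Algebra.adjoin K G = ⊤) (hGd : ∀ x ∈ G, ∃ d, x ∈ gX d)
    (h : ∀ x ∈ G, MixAt Z (opMat gX f) (opMat gX g) x) :
    Mix Z (opMat gX f) (opMat gX g) Z := by
  obtain ⟨R, hR0⟩ : ∃ R : Matrix (Idx N × Idx N) (Idx N × Idx N) X, ∀ i j k l, R (i, j) (k, l) =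
      algebraMap K X (sgn (par j * par k) * Z i k j l) :=
    ⟨Matrix.of fun p p' => algebraMap K X (sgn (par p.2 * par p'.1) * Z p.1 p'.1 p.2 p'.2),
      fun _ _ _ _ => rfl⟩
  have hR : ∀ z, R * compHom f g z = compHom' f g z * R ↔ Exchange Z f g z := by
    intro z
    have hl : ∀ i x j y, (R * compHom f g z) (i, j) (x, y) =
        ∑ k, ∑ l, (sgn (par j * par k) * Z i k j l) • f (g z l y) k x := by
      intro i x j y
      rw [Matrix.mul_apply, Fintype.sum_prod_type]
      refine sum_congr₂ fun k l => ?_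
      rw [compHom_apply, hR0, ← Algebra.smul_def]
    have hr : ∀ i x j y, (compHom' f g z * R) (i, j) (x, y) =
        ∑ k, ∑ l, (sgn (par l * par x) * Z k x l y) • g (f z i k) j l := by
      intro i x j y
      rw [Matrix.mul_apply, Fintype.sum_prod_type]
      refine sum_congr₂ fun k l => ?_
      rw [compHom'_apply, hR0, ← Algebra.commutes, ← Algebra.smul_def]
    constructor
    · intro h i x j y
      rw [← hl, ← hr, h]
    · intro h
      ext ⟨i, j⟩ ⟨x, y⟩
      rw [hl, hr, h]
  have key : ∀ z, Exchange Z f g z := fun z => (hR z).1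
    (intertwine_of_adjoin hG _ _ R (fun x hx => (hR x).2 fun i x' j y' => by
      obtain ⟨d, hd⟩ := hGd x hx
      rw [exchange_iff_mixAt hZ hf hg, twist_of_mem gX _ hd]
      exact (h x hx).smul _ i x' j y') z)
  rw [mix_iff_mixAt hZ]
  intro v i x j y
  have := (exchange_iff_mixAt hZ hf hg (twist gX (par x + par y) v) i x j y).1 (key _ i x j y)
  rwa [twist_self] at this

/-- The same argument for transposed operators. Transposition exchanges rows and columns of the
intertwiner, which now goes in the opposite direction. -/
theorem mix_opMatT {Z : Mat2 N N N N K} (hZ : EvenScal Z)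
    {f : X →ₐ[K] Matrix (Idx N) (Idx N) X} (hf : EvenHom gX f)
    {G : Set X} (hG : Algebra.adjoin K G = ⊤) (hGd : ∀ x ∈ G, ∃ d, x ∈ gX d)
    (h : ∀ x ∈ G, MixAt Z (opMatT gX f) (opMatT gX f) x) :
    Mix Z (opMatT gX f) (opMatT gX f) Z := by
  obtain ⟨R, hR0⟩ : ∃ R : Matrix (Idx N × Idx N) (Idx N × Idx N) X, ∀ k l i j, R (k, l) (i, j) =
      algebraMap K X (sgn (par k * par i + par k + par i * par j) * Z i k j l) :=
    ⟨Matrix.of fun p p' => algebraMap K X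
      (sgn (par p.1 * par p'.1 + par p.1 + par p'.1 * par p'.2) * Z p'.1 p.1 p'.2 p.2),
      fun _ _ _ _ => rfl⟩
  have hR : ∀ z i x j y, (compHom f f z * R) (x, y) (i, j) =
      sgn (par x * par j + par x * par y + par i + par j + par x + par y + par i * par j) •
      ∑ k, ∑ l, (sgn ((par k + par x) * (par j + par y)) * Z i k j l) •
        opMatT gX f k x (opMatT gX f l y (twist gX (par i + par j) z)) := by
    intro z i x j y
    rw [Matrix.mul_apply, Fintype.sum_prod_type]
    simp only [Finset.smul_sum]
    refine sum_congr₂ fun k l => ?_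
    rw [compHom_apply, hR0, ← Algebra.commutes, ← Algebra.smul_def]
    by_cases h : par i + par k + par j + par l = 0
    · rw [opMatT_apply, opMatT_apply, map_smul, hf, twist_twist, twist_twist,
        show par k + par l + (par i + par j) = 0 by linear_combination h, twist_zero, map_smul,
        Matrix.smul_apply, map_smul, Matrix.smul_apply, smul_smul, smul_smul, smul_smul, smul_smul]
      congr 1
      rw [mul_comm _ (Z i k j l), mul_comm _ (Z i k j l), mul_left_comm _ (Z i k j l), mul_assoc,
        mul_assoc, mul_assoc, ← sgn_add, ← sgn_add, ← sgn_add, ← sgn_add]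
      congr 1
      refine sgn_congr ?_
      rw [show par i = par k + par j + par l by
        linear_combination h - add_self_two (par k + par j + par l)]
      generalize par k = k, par l = l, par j = j, par x = x, par y = y
      revert k l j x y; decide
    · rw [hZ i k j l h]
      simp
  have hR' : ∀ z i x j y, (R * compHom' f f z) (x, y) (i, j) =
      sgn (par x * par j + par x * par y + par i + par j + par x + par y + par i * par j) •
      ∑ k, ∑ l, (sgn ((par j + par l) * (par k + par x)) * Z k x l y) •
        opMatT gX f j l (opMatT gX f i k (twist gX (par i + par j) z)) := by
    intro z i x j y
    rw [Matrix.mul_apply, Fintype.sum_prod_type]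
    simp only [Finset.smul_sum]
    refine sum_congr₂ fun k l => ?_
    rw [compHom'_apply, hR0, ← Algebra.smul_def]
    rw [opMatT_apply, opMatT_apply, map_smul, hf, twist_twist, twist_twist,
      show par j + par i + (par i + par j) = 0 by
        linear_combination add_self_two (par i) + add_self_two (par j), twist_zero, map_smul,
      Matrix.smul_apply, map_smul, Matrix.smul_apply, smul_smul, smul_smul, smul_smul, smul_smul]
    congr 1
    by_cases h : par k + par x + par l + par y = 0
    · rw [mul_comm _ (Z k x l y), mul_comm _ (Z k x l y), mul_left_comm _ (Z k x l y), mul_assoc,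
        mul_assoc, mul_assoc, ← sgn_add, ← sgn_add, ← sgn_add, ← sgn_add]
      congr 1
      refine sgn_congr ?_
      rw [show par y = par k + par x + par l by
        linear_combination h - add_self_two (par k + par x + par l)]
      generalize par k = k, par l = l, par j = j, par x = x, par i = i
      revert k l j x i; decide
    · rw [hZ k x l y h]
      simp
  have key : ∀ z, R * compHom' f f z = compHom f f z * R := by
    refine intertwine_of_adjoin hG _ _ R fun z hz => ?_
    ext ⟨x, y⟩ ⟨i, j⟩
    obtain ⟨d, hd⟩ := hGd z hz
    rw [hR, hR', twist_of_mem gX _ hd, (h z hz).smul _ i x j y]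
  rw [mix_iff_mixAt hZ]
  intro v i x j y
  have e := congrArg (fun M => M (x, y) (i, j)) (key (twist gX (par i + par j) v))
  simp only [hR, hR', twist_self] at e
  have := congrArg (sgn (par x * par j + par x * par y + par i + par j + par x + par y +
    par i * par j) • ·) e
  simp only [smul_smul, sgn_mul_self, one_smul] at this
  exact this.symm

/-- Operators acting on a family of vectors by scalar matrices. -/
theorem mixAt_of_rep {M : Type} [AddCommGroup M] [Module K M] {Z : Mat2 N N N N K}
    (hZ : EvenScal Z) {A B : Idx N → Idx N → Module.End K M}
    {P Q : Idx N → Idx N → Matrix (Idx N) (Idx N) K} (h : Mix Z P Q Z) (v : Idx N → M)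
    (hA : ∀ a b c, A a b (v c) = ∑ j, P a b j c • v j)
    (hB : ∀ a b c, B a b (v c) = ∑ j, Q a b j c • v j) (c : Idx N) : MixAt Z A B (v c) := by
  have hAB : ∀ a b a' b', A a b (B a' b' (v c)) = ∑ j, (P a b * Q a' b') j c • v j := by
    intro a b a' b'
    rw [hB, map_sum]
    simp only [map_smul, hA, Finset.smul_sum, Matrix.mul_apply, Finset.sum_smul, smul_smul]
    rw [Finset.sum_comm]
    exact sum_congr₂ fun j k => by rw [mul_comm]
  have hBA : ∀ a b a' b', B a b (A a' b' (v c)) = ∑ j, (Q a b * P a' b') j c • v j := by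
    intro a b a' b'
    rw [hA, map_sum]
    simp only [map_smul, hB, Finset.smul_sum, Matrix.mul_apply, Finset.sum_smul, smul_smul]
    rw [Finset.sum_comm]
    exact sum_congr₂ fun j k => by rw [mul_comm]
  intro i x j y
  have e := (mix_iff hZ hZ P Q).1 h i x j y
  have e' : ∀ m, _ := fun m => congrArg (fun M => M m c) e
  simp only [Matrix.sum_apply, Matrix.smul_apply] at e'
  simp only [hAB, hBA, Finset.smul_sum, smul_smul]
  rw [sum_rotate, sum_rotate (f := fun k l m => (_ * (Q j l * P i k) m c) • v m)]
  simp only [← Finset.sum_smul]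
  exact Finset.sum_congr rfl fun m _ => by
    have := e' m
    simp only [smul_eq_mul] at this
    rw [this]

/-- Operators acting on a family of vectors by scalar matrices on the other side. -/
theorem mixAt_of_antirep {M : Type} [AddCommGroup M] [Module K M] {Z : Mat2 N N N N K}
    (hZ : EvenScal Z) {A : Idx N → Idx N → Module.End K M}
    {Q : Mat2 N N N N K} (hQ : EvenScal Q) (h : RLL Z (yMat Q) Z) (v : Idx N → M) (δ : ZMod 2)
    (hA : ∀ a b c, A a b (v c) =
      ∑ d, (sgn ((par a + par b) * (par d + δ)) * Q c d a b) • v d) (c : Idx N) :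
    MixAt Z A A (v c) := by
  -- The composite of two operators corresponds to the product of their matrices in reverse order.
  -- For this reason the hypothesis is an `RLL` relation, although the conclusion is of the type
  -- `MixAt`.
  have hAA : ∀ a b a' b', A a b (A a' b' (v c)) =
      ∑ d, (sgn ((par a + par b + par a' + par b') * (par d + δ) +
        (par a + par b) * (par a' + par b')) * (yMat Q a' b' * yMat Q a b) c d) • v d := by
    intro a b a' b'
    rw [hA, map_sum]
    simp only [map_smul, hA, Finset.smul_sum, Matrix.mul_apply, Finset.mul_sum, Finset.sum_smul,
      smul_smul]
    rw [Finset.sum_comm]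
    refine sum_congr₂ fun d k => ?_
    rw [yMat, yMat, Matrix.of_apply, Matrix.of_apply]
    congr 1
    by_cases h : par k + par d + par a + par b = 0
    · have hs : sgn ((par a + par b + par a' + par b') * (par d + δ) +
        (par a + par b) * (par a' + par b')) = sgn ((par a' + par b') * (par k + δ)) *
          sgn ((par a + par b) * (par d + δ)) := by
        rw [← sgn_add]
        refine sgn_congr ?_
        linear_combination (-(par a' + par b')) * h + (par a' + par b') * (add_self_two (par d) +
          add_self_two (par a + par b))
      rw [hs]
      ring
    · rw [hQ k d a b h]
      simp
  intro i x j y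
  have e := (rll_iff hZ hZ (yMat Q)).1 h i x j y
  have e' : ∀ m, _ := fun m => congrArg (fun M => sgn ((par i + par j + par x + par y) *
    (par m + δ)) * M c m) e
  simp only [Matrix.sum_apply, Matrix.smul_apply, Finset.mul_sum, smul_eq_mul] at e'
  simp only [hAA, Finset.smul_sum, smul_smul]
  rw [sum_rotate, sum_rotate (f := fun k l m => (_ * (_ * (yMat Q i k * yMat Q j l) c m)) • v m)]
  simp only [← Finset.sum_smul]
  refine Finset.sum_congr rfl fun m _ => ?_
  congr 1
  refine Eq.trans (sum_congr₂ fun k l => ?_) ((e' m).symm.trans (sum_congr₂ fun k l => ?_))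
  · by_cases h : par i + par k + par j + par l = 0
    · have hs : sgn ((par k + par x) * (par j + par y)) * sgn ((par k + par x + par l + par y) *
          (par m + δ) + (par k + par x) * (par l + par y)) =
          sgn ((par i + par j + par x + par y) * (par m + δ)) *
            sgn ((par j + par l) * (par k + par x)) := by
        rw [← sgn_add, ← sgn_add]
        refine sgn_congr ?_
        linear_combination (par m + δ) * h - (par m + δ) * add_self_two (par i + par j) +
          (par k + par x) * add_self_two (par y)
      linear_combination (Z i k j l * (yMat Q l y * yMat Q k x) c m) * hs
    · rw [hZ i k j l h]
      simp
  · by_cases h : par k + par x + par l + par y = 0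
    · have hs : sgn ((par j + par l) * (par k + par x)) * sgn ((par j + par l + par i + par k) *
          (par m + δ) + (par j + par l) * (par i + par k)) =
          sgn ((par i + par j + par x + par y) * (par m + δ)) *
            sgn ((par j + par l) * (par i + par x)) := by
        rw [← sgn_add, ← sgn_add]
        refine sgn_congr ?_
        linear_combination (par m + δ) * h - (par m + δ) * add_self_two (par x + par y) +
          (par j + par l) * add_self_two (par k)
      linear_combination (-(Z k x l y * (yMat Q i k * yMat Q j l) c m)) * hs
    · rw [hZ k x l y h]
      simp

end MatrixHoms

/-! ### Actions given by homomorphisms to matrices -/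

section MatAct

variable {U : Type} [Ring U] [Algebra K U] {gU : ZMod 2 → Submodule K U} [GradedAlgebra gU]
  {N : ℕ} {C : MatCoalg gU N}
  {X : Type} [Ring X] [Algebra K X] {gX : ZMod 2 → Submodule K X} [GradedAlgebra gX]

theorem isSuperalgebra_mul (gX : ZMod 2 → Submodule K X) [GradedAlgebra gX] :
    IsSuperalgebra gX (LinearMap.mul K X) 1 where
  isInternal := (parity_twist gX).isInternal
  one_mem := SetLike.GradedOne.one_mem
  mul_mem hx hy := SetLike.GradedMul.mul_mem hx hy
  one_mul := by simp
  mul_one := by simp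
  mul_assoc x y z := by simp [mul_assoc]

/-- The action `ρ` is given by the homomorphism `f`. -/
structure IsMatAct (C : MatCoalg gU N) (gX : ZMod 2 → Submodule K X) [GradedAlgebra gX]
    (ρ : U →ₐ[K] Module.End K X) (f : X →ₐ[K] Matrix (Idx N) (Idx N) X) : Prop where
  even : EvenHom gX f
  act : ∀ a b x, ρ (C.gen a b) (twist gX (par b) x) = f x a b

theorem IsMatAct.evenAct {ρ : U →ₐ[K] Module.End K X} {f : X →ₐ[K] Matrix (Idx N) (Idx N) X}
    (h : IsMatAct C gX ρ f) : EvenAct gU (twist gX) ρ.toLinearMap := by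
  refine evenAct_of_gen C (parity_twist gX) ρ fun a b x => ?_
  obtain ⟨x, rfl⟩ : ∃ x', x = twist gX (par b) x' := ⟨_, (twist_self gX (par b) x).symm⟩
  rw [h.act, h.even, one_mul, twist_twist gX 1, add_comm 1, ← twist_twist, h.act]

/-- The rule for the unit is f(1) = 1, and the rule for products is f(xy) = f(x)f(y). -/
theorem IsMatAct.isSupermoduleSuperalgebra {ρ : U →ₐ[K] Module.End K X}
    {f : X →ₐ[K] Matrix (Idx N) (Idx N) X} (h : IsMatAct C gX ρ f) :
    IsSupermoduleSuperalgebra gU gX C.Δ C.counitHom.toLinearMap (LinearMap.mul K X) 1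
      ρ.toLinearMap := by
  refine isSupermoduleSuperalgebra_of_gen C (isSuperalgebra_mul gX) (parity_twist gX) h.evenAct
    ?_ ?_
  · intro a b
    have := h.act a b 1
    rwa [twist_one, map_one f, Matrix.one_apply] at this
  · intro a b x y
    simp only [h.act, LinearMap.mul_apply', map_mul, Matrix.mul_apply]

/-- Actions which agree on generators are equal. -/
theorem action_ext (C : MatCoalg gU N) {ρ σ : U →ₗ[K] Module.End K X}
    (hρ : IsSupermoduleSuperalgebra gU gX C.Δ C.counitHom.toLinearMap (LinearMap.mul K X) 1 ρ)
    (hσ : IsSupermoduleSuperalgebra gU gX C.Δ C.counitHom.toLinearMap (LinearMap.mul K X) 1 σ)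
    {G : Set X} (hG : Algebra.adjoin K G = ⊤) (hGd : ∀ x ∈ G, ∃ d, x ∈ gX d)
    (h : ∀ x ∈ G, ∀ a b, ρ (C.gen a b) x = σ (C.gen a b) x) : ρ = σ := by
  -- In the normalisation with γ^{|b|} both actions are multiplicative in the matrix sense, so
  -- agreement propagates from generators to products of algebra elements.
  have h1 : ∀ x a b, ρ (C.gen a b) (twist gX (par b) x) = σ (C.gen a b) (twist gX (par b) x) := by
    intro x
    have hx : x ∈ Algebra.adjoin K G := by rw [hG]; exact Algebra.mem_top
    induction hx using Algebra.adjoin_induction with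
    | mem x hx =>
      intro a b
      obtain ⟨d, hd⟩ := hGd x hx
      rw [twist_of_mem gX _ hd, map_smul, map_smul, h x hx]
    | algebraMap r =>
      intro a b
      rw [Algebra.algebraMap_eq_smul_one, map_smul, twist_one, map_smul, map_smul, hρ.act_one,
        hσ.act_one]
    | add x y _ _ hx hy => intro a b; simp only [map_add, hx, hy]
    | mul x y _ _ hx hy =>
      intro a b
      have e1 := hρ.gen_mul C (parity_twist gX) a b x y
      have e2 := hσ.gen_mul C (parity_twist gX) a b x y
      rw [LinearMap.mul_apply'] at e1 e2
      rw [e1, e2]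
      exact Finset.sum_congr rfl fun c _ => by rw [hx, hy]
  ext u x
  induction u using C.induction generalizing x with
  | hgen a b =>
    have := h1 (twist gX (par b) x) a b
    rwa [twist_self] at this
  | hmap r =>
    rw [Algebra.algebraMap_eq_smul_one, map_smul, map_smul, LinearMap.smul_apply,
      LinearMap.smul_apply, hρ.isSupermodule.one_act, hσ.isSupermodule.one_act]
  | hadd u v hu hv => rw [map_add, map_add, LinearMap.add_apply, LinearMap.add_apply, hu, hv]
  | hmul u v hu hv =>
    rw [hρ.isSupermodule.mul_act, hσ.isSupermodule.mul_act, hu, hv]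

/-! #### Triangular homomorphisms -/

/-- Triangular matrices form a subalgebra for any preorder on the indices. The actions of U_q(𝔮_n)
use the order itself and the co-opposite action uses the reverse order. -/
theorem triangular_of_gen (r : Idx N → Idx N → Prop) [Std.Refl r] [IsTrans (Idx N) r]
    {f : X →ₐ[K] Matrix (Idx N) (Idx N) X} {G : Set X} (hG : Algebra.adjoin K G = ⊤)
    (h : ∀ x ∈ G, ∀ a b, ¬ r a b → f x a b = 0) (x : X) (a b : Idx N) (hab : ¬ r a b) :
    f x a b = 0 := by
  have hx : x ∈ Algebra.adjoin K G := by rw [hG]; exact Algebra.mem_top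
  induction hx using Algebra.adjoin_induction generalizing a b with
  | mem x hx => exact h x hx a b hab
  | algebraMap c =>
    rw [AlgHom.commutes, Matrix.algebraMap_matrix_apply, if_neg]
    rintro rfl
    exact hab (refl_of r a)
  | add x y _ _ hx hy => rw [map_add, Matrix.add_apply, hx a b hab, hy a b hab, add_zero]
  | mul x y _ _ hx hy =>
    rw [map_mul, Matrix.mul_apply]
    refine Finset.sum_eq_zero fun c _ => ?_
    by_cases hac : r a c
    · rw [hy c b fun hcb => hab (trans_of r hac hcb), mul_zero]
    · rw [hx a c hac, zero_mul]

/-- Diagonal entries of a triangular homomorphism are multiplicative, so the composite of the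
entries at i and -i can be compared with γ on generators. Since i and -i have opposite parities, the
powers of γ in the two operators supply the other γ. -/
theorem opMat_diag_inv (r : Idx N → Idx N → Prop) [Std.Antisymm r]
    {f : X →ₐ[K] Matrix (Idx N) (Idx N) X} (hf : EvenHom gX f)
    (htri : ∀ x a b, ¬ r a b → f x a b = 0) {G : Set X} (hG : Algebra.adjoin K G = ⊤)
    (h : ∀ x ∈ G, ∀ i, f (f x (-i) (-i)) i i = twist gX 1 x) (i : Idx N) :
    opMat gX f i i * opMat gX f (-i) (-i) = 1 := by
  have hm : ∀ i x y, f (x * y) i i = f x i i * f y i i := by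
    intro i x y
    rw [map_mul, Matrix.mul_apply, Finset.sum_eq_single i]
    · intro c _ hc
      by_cases hic : r i c
      · rw [htri y c i fun hci => hc (antisymm_of r hci hic), mul_zero]
      · rw [htri x i c hic, zero_mul]
    · simp
  have key : ∀ x i, f (f x (-i) (-i)) i i = twist gX 1 x := by
    intro x
    have hx : x ∈ Algebra.adjoin K G := by rw [hG]; exact Algebra.mem_top
    induction hx using Algebra.adjoin_induction with
    | mem x hx => exact h x hx
    | algebraMap c =>
      intro i
      rw [AlgHom.commutes, Matrix.algebraMap_matrix_apply, if_pos rfl, AlgHom.commutes,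
        Matrix.algebraMap_matrix_apply, if_pos rfl, Algebra.algebraMap_eq_smul_one, map_smul,
        twist_one]
    | add x y _ _ hx hy =>
      intro i
      rw [map_add, Matrix.add_apply, map_add, Matrix.add_apply, hx, hy, map_add]
    | mul x y _ _ hx hy => intro i; rw [hm, hm, hx, hy, twist_mul]
  ext x
  rw [Module.End.mul_apply, Module.End.one_apply, opMat_apply, opMat_apply]
  simp only [add_self_two, mul_zero, sgn_zero, one_smul]
  rw [hf, add_self_two, mul_zero, sgn_zero, one_smul, key, twist_twist, twist_twist, par_neg]
  rw [show 1 + par i + (par i + 1) = 0 by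
    linear_combination add_self_two 1 + add_self_two (par i), twist_zero]

variable {f : X →ₐ[K] Matrix (Idx N) (Idx N) X}

/-- The action of `U_q(𝔮_N)` given by a homomorphism to matrices. -/
def matActU (f : X →ₐ[K] Matrix (Idx N) (Idx N) X) (htri : ∀ x a b, ¬ a ≤ b → f x a b = 0)
    (hinv : ∀ i, opMat gX f i i * opMat gX f (-i) (-i) = 1)
    (hmix : Mix (Sinv N) (opMat gX f) (opMat gX f) (Sinv N)) : Uq N →ₐ[K] Module.End K X :=
  liftU (genMat (opMat gX f))
    (fun i j h => by
      ext x
      rw [genMat, LinearMap.smul_apply, opMat_apply, htri _ _ _ h]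
      simp)
    (fun i => by simp only [genMat, add_self_two, sgn_zero, one_smul, hinv])
    (by
      have e : genMat (genMat (opMat gX f)) = opMat gX f := by
        funext a b
        rw [genMat, genMat, smul_smul, sgn_mul_self, one_smul]
      rw [e]
      exact rll_iff_mix_S.2 hmix)

theorem matActU_L (htri : ∀ x a b, ¬ a ≤ b → f x a b = 0)
    (hinv : ∀ i, opMat gX f i i * opMat gX f (-i) (-i) = 1)
    (hmix : Mix (Sinv N) (opMat gX f) (opMat gX f) (Sinv N)) (a b : Idx N) (x : X) :
    sgn (par a + par b) • matActU f htri hinv hmix (L a b) x = opMat gX f a b x := by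
  rw [matActU, liftU_L, genMat, LinearMap.smul_apply, smul_smul, sgn_mul_self, one_smul]

theorem isMatAct_matActU (hf : EvenHom gX f) (htri : ∀ x a b, ¬ a ≤ b → f x a b = 0)
    (hinv : ∀ i, opMat gX f i i * opMat gX f (-i) (-i) = 1)
    (hmix : Mix (Sinv N) (opMat gX f) (opMat gX f) (Sinv N)) :
    IsMatAct (coalgU N) gX (matActU f htri hinv hmix) f where
  even := hf
  act a b x := by
    change matActU f htri hinv hmix (sgn (par a * (par b + 1)) • L a b) _ = _
    rw [map_smul, LinearMap.smul_apply, matActU, liftU_L, genMat, LinearMap.smul_apply,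
      opMat_apply, twist_self, smul_smul, smul_smul, ← sgn_add, ← sgn_add]
    rw [show par a * (par b + 1) + (par a + par b) + par b * (par a + par b) = 0 by
      generalize par a = a, par b = b
      revert a b; decide, sgn_zero, one_smul]

/-- The action of `U_q(𝔮_N)^cop` given by a homomorphism to matrices. -/
def matActUcop (f : X →ₐ[K] Matrix (Idx N) (Idx N) X) (htri : ∀ x a b, ¬ a ≥ b → f x a b = 0)
    (hinv : ∀ i, opMat gX f i i * opMat gX f (-i) (-i) = 1)
    (hmix : Mix (Sinv N) (opMatT gX f) (opMatT gX f) (Sinv N)) : Uq N →ₐ[K] Module.End K X :=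
  liftU (genMat (opMatT gX f))
    (fun i j h => by
      ext x
      rw [genMat, LinearMap.smul_apply, opMatT_apply, htri _ _ _ h]
      simp)
    (fun i => by
      have e : ∀ i, opMatT gX f i i = opMat gX f i i := by
        intro i
        ext x
        rw [opMatT_eq, show par i * (par i + 1) = 0 by generalize par i = i; revert i; decide,
          sgn_zero, one_smul]
      simp only [genMat, add_self_two, sgn_zero, one_smul, e, hinv])
    (by
      have e : genMat (genMat (opMatT gX f)) = opMatT gX f := by
        funext a b
        rw [genMat, genMat, smul_smul, sgn_mul_self, one_smul]
      rw [e]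
      exact rll_iff_mix_S.2 hmix)

theorem matActUcop_L (htri : ∀ x a b, ¬ a ≥ b → f x a b = 0)
    (hinv : ∀ i, opMat gX f i i * opMat gX f (-i) (-i) = 1)
    (hmix : Mix (Sinv N) (opMatT gX f) (opMatT gX f) (Sinv N)) (a b : Idx N) (x : X) :
    sgn (par a + par b) • matActUcop f htri hinv hmix (L a b) x = opMatT gX f a b x := by
  rw [matActUcop, liftU_L, genMat, LinearMap.smul_apply, smul_smul, sgn_mul_self, one_smul]

theorem isMatAct_matActUcop (hf : EvenHom gX f) (htri : ∀ x a b, ¬ a ≥ b → f x a b = 0)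
    (hinv : ∀ i, opMat gX f i i * opMat gX f (-i) (-i) = 1)
    (hmix : Mix (Sinv N) (opMatT gX f) (opMatT gX f) (Sinv N)) :
    IsMatAct (coalgUcop N) gX (matActUcop f htri hinv hmix) f where
  even := hf
  act a b x := by
    change matActUcop f htri hinv hmix (L b a) _ = _
    rw [matActUcop, liftU_L, genMat, LinearMap.smul_apply,
      opMatT_apply, twist_self, smul_smul, sgn_mul_self, one_smul]

end MatAct

/-! ### Values of the matrices on the right-hand sides of the actions -/

theorem leg1_dot_scal {B : Type} [Ring B] [Algebra K B] {m N p : ℕ} {Z : Mat2 N N p p K}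
    (hZ : EvenScal Z) (T : Idx m → Idx N → B) (i : Idx m) (c : Idx N) (a b : Idx p) :
    (leg1 p T ⋆ scal B Z) i c a b = ∑ j, Z j c a b • T i j := by
  rw [dot_apply]
  refine Finset.sum_congr rfl fun j _ => ?_
  rw [Finset.sum_eq_single a]
  · rw [leg1, if_pos rfl, scal, ← Algebra.commutes, ← Algebra.smul_def, smul_smul]
    by_cases h : par j + par c + par a + par b = 0
    · rw [h, mul_zero, zero_add, add_self_two, zero_mul, sgn_zero, one_mul]
    · rw [hZ j c a b h]
      simp
  · intro l _ hl
    rw [leg1, if_neg (Ne.symm hl), zero_mul, smul_zero]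
  · simp

theorem scal_dot_leg1 {B : Type} [Ring B] [Algebra K B] {m N p : ℕ} {Z : Mat2 N N p p K}
    (hZ : EvenScal Z) (T : Idx N → Idx m → B) (c : Idx N) (α : Idx m) (a b : Idx p) :
    (scal B Z ⋆ leg1 p T) c α a b =
      ∑ d, (sgn ((par a + par b) * (par d + par α)) * Z c d a b) • T d α := by
  rw [dot_apply]
  refine Finset.sum_congr rfl fun d _ => ?_
  rw [Finset.sum_eq_single b]
  · rw [leg1, if_pos rfl, scal, ← Algebra.smul_def, smul_smul]
    by_cases h : par c + par d + par a + par b = 0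
    · rw [h, zero_mul, zero_add]
    · rw [hZ c d a b h]
      simp
  · intro l _ hl
    rw [leg1, if_neg hl, mul_zero, smul_zero]
  · simp

theorem sMatrix_triangular {N : ℕ} (Q : K) (j c a b : Idx N) (h : ¬ a ≤ b) :
    sMatrix N Q j c a b = 0 := by
  unfold sMatrix
  rw [if_neg (fun h' => h h'.2.le), if_neg (fun h' => h (le_of_lt h'))]
  simp

theorem sMatrix_diag {N : ℕ} (Q : K) (j c a : Idx N) :
    sMatrix N Q j c a a = if j = c then Q ^ phi c a else 0 := by
  unfold sMatrix
  rw [if_neg (lt_irrefl a), mul_zero, add_zero]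
  by_cases h : j = c
  · subst h; simp
  · simp [h]

/-! ### Generating sets -/

theorem adjoin_t_pos (r n : ℕ) :
    Algebra.adjoin K {x : Aq r n | ∃ i a, 0 < i.1 ∧ x = t i a} = ⊤ := by
  rw [eq_top_iff]
  intro u _
  induction u using aq_induction_pos with
  | hgen i a h => exact Algebra.subset_adjoin ⟨i, a, h, rfl⟩
  | hmap r => exact Subalgebra.algebraMap_mem _ r
  | hadd u v hu hv => exact Subalgebra.add_mem _ (hu trivial) (hv trivial)
  | hmul u v hu hv => exact Subalgebra.mul_mem _ (hu trivial) (hv trivial)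

theorem adjoin_tbar (s n : ℕ) :
    Algebra.adjoin K {x : Abar s n | ∃ b α, x = barMat tbar b α} = ⊤ := by
  rw [eq_top_iff]
  intro u _
  induction u using abar_induction with
  | hgen b α => exact Algebra.subset_adjoin ⟨b, α, rfl⟩
  | hmap r => exact Subalgebra.algebraMap_mem _ r
  | hadd u v hu hv => exact Subalgebra.add_mem _ (hu trivial) (hv trivial)
  | hmul u v hu hv => exact Subalgebra.mul_mem _ (hu trivial) (hv trivial)

theorem t_pos_homogeneous {r n : ℕ} :
    ∀ x ∈ {x : Aq r n | ∃ i a, 0 < i.1 ∧ x = t i a}, ∃ d, x ∈ gradeA r n d := by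
  rintro _ ⟨i, a, _, rfl⟩
  exact ⟨_, t_mem i a⟩

theorem tbar_homogeneous {s n : ℕ} :
    ∀ x ∈ {x : Abar s n | ∃ b α, x = barMat tbar b α}, ∃ d, x ∈ gradeAbar s n d := by
  rintro _ ⟨b, α, rfl⟩
  exact ⟨_, barMat_tbar_mem b α⟩

/-! ### The action of `U_q(𝔮_n)` on `A_{r,n}` -/

section Phi

variable (r n : ℕ)

/-- The matrix of the action on `A_{r,n}`. -/
def phiHom : Aq r n →ₐ[K] Matrix (Idx n) (Idx n) (Aq r n) :=
  liftA (dot1 (fun i j => iotaMat (gradeA r n) n (t i j))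
      (fun j c => cstMat (Aq r n) n (xMat (S n) j c)))
    -- The product TX inherits the symmetry of T because the first leg of `S` is invariant under
    -- negation, and it inherits the quadratic relation by fusion of T with X.
    (dot1_neg (fun i j => by rw [t_neg]) (fun i j => by
      congr 1
      ext a b
      exact S_neg_neg i j a b))
    (((mix_t r n).map (evenScal_S r) (evenScal_S n) _).dot1
      ((mix_xMat n).map (evenScal_S n) (evenScal_S n) _)
      (superComm_cst_iota _ (evenScal_S n) t_mem))

variable {r n}

theorem phiHom_t (i : Idx r) (c : Idx n) : phiHom r n (t i c) =
    dot1 (fun i j => iotaMat (gradeA r n) n (t i j))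
      (fun j c => cstMat (Aq r n) n (xMat (S n) j c)) i c :=
  liftA_t _ _ _ i c

theorem opMat_phiHom (i : Idx r) (c a b : Idx n) :
    opMat (gradeA r n) (phiHom r n) a b (t i c) = ∑ j, S n j c a b • t i j :=
  opMat_right t_mem (evenScal_S n) (phiHom_t i c) a b

theorem phiHom_even : EvenHom (gradeA r n) (phiHom r n) := by
  refine evenHom_of_gen (adjoin_t_pos r n) ?_
  rintro _ ⟨i, c, _, rfl⟩
  refine ⟨_, t_mem i c, fun a b => ?_⟩
  rw [phiHom_t]
  exact right_mem t_mem (evenScal_S n) i c a b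

theorem phiHom_triangular (x : Aq r n) (a b : Idx n) (h : ¬ a ≤ b) : phiHom r n x a b = 0 := by
  refine triangular_of_gen (· ≤ ·) (adjoin_t_pos r n) ?_ x a b h
  rintro _ ⟨i, c, _, rfl⟩ a b h
  rw [phiHom_t, right_apply t_mem (evenScal_S n)]
  exact Finset.sum_eq_zero fun j _ => by rw [S, sMatrix_triangular q j c a b h]; simp

theorem phiHom_t_diag (i : Idx r) (c a : Idx n) : phiHom r n (t i c) a a =
    (sgn ((par i + par c) * par a) * q ^ phi c a) • t i c := by
  rw [phiHom_t, right_apply t_mem (evenScal_S n), Finset.sum_eq_single c]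
  · rw [S, sMatrix_diag, if_pos rfl]
  · intro j _ hj
    rw [S, sMatrix_diag, if_neg hj]
    simp
  · simp

theorem phiHom_inv (i : Idx n) : opMat (gradeA r n) (phiHom r n) i i *
    opMat (gradeA r n) (phiHom r n) (-i) (-i) = 1 := by
  refine opMat_diag_inv (· ≤ ·) phiHom_even phiHom_triangular (adjoin_t_pos r n) ?_ i
  rintro _ ⟨j, c, _, rfl⟩ i
  rw [phiHom_t_diag, map_smul, Matrix.smul_apply, phiHom_t_diag, smul_smul,
    twist_of_mem _ 1 (t_mem j c), one_mul, par_neg, phi_neg_right, zpow_neg]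
  congr 1
  -- Passing from i to -i negates φ, so the powers of q cancel and only the parity sign is left.
  have hq := zpow_ne_zero (phi c i) q_ne_zero
  have hs : sgn ((par j + par c) * (par i + 1)) * sgn ((par j + par c) * par i) =
      sgn (par j + par c) := by
    rw [← sgn_add]
    exact sgn_congr (by linear_combination (par j + par c) * add_self_two (par i))
  rw [← hs]
  field_simp

/-- On each row of T the operators act by the matrices Y, so the relation is `rll_yMat` rewritten
with S⁻¹. -/
theorem phiHom_mix : Mix (Sinv n) (opMat (gradeA r n) (phiHom r n))
    (opMat (gradeA r n) (phiHom r n)) (Sinv n) := by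
  refine mix_opMat (evenScal_Sinv n) phiHom_even phiHom_even (adjoin_t_pos r n)
    t_pos_homogeneous ?_
  rintro _ ⟨i, c, _, rfl⟩
  exact mixAt_of_rep (evenScal_Sinv n) (rll_iff_mix_S.1 (rll_yMat n)) (t i)
    (fun a b c => opMat_phiHom i c a b) (fun a b c => opMat_phiHom i c a b) c

variable (r n) in
/-- The action `Φ` of `U_q(𝔮_n)` on `A_{r,n}`. -/
def phiAct : Uq n →ₐ[K] Module.End K (Aq r n) :=
  matActU (phiHom r n) phiHom_triangular phiHom_inv phiHom_mix

theorem isMatAct_phiAct : IsMatAct (coalgU n) (gradeA r n) (phiAct r n) (phiHom r n) :=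
  isMatAct_matActU phiHom_even _ _ _

theorem isPhi_phiAct : IsPhi r n (phiAct r n).toLinearMap where
  isSupermoduleSuperalgebra := isMatAct_phiAct.isSupermoduleSuperalgebra
  act_gen i c a b := by
    rw [AlgHom.toLinearMap_apply, phiAct, matActU_L, opMat_phiHom,
      leg1_dot_scal (evenScal_S n)]

theorem IsPhi.eq {Φ : Uq n →ₗ[K] Module.End K (Aq r n)} (h : IsPhi r n Φ) :
    Φ = (phiAct r n).toLinearMap := by
  refine action_ext (coalgU n) h.isSupermoduleSuperalgebra
    isPhi_phiAct.isSupermoduleSuperalgebra (adjoin_t_pos r n) t_pos_homogeneous ?_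
  rintro _ ⟨i, c, _, rfl⟩ a b
  have e := congrArg (sgn (par a + par b) • ·) ((h.act_gen i c a b).trans
    (isPhi_phiAct.act_gen i c a b).symm)
  simp only [smul_smul, sgn_mul_self, one_smul] at e
  change Φ (sgn _ • L a b) _ = (phiAct r n).toLinearMap (sgn _ • L a b) _
  rw [map_smul, map_smul, LinearMap.smul_apply, LinearMap.smul_apply, e]

end Phi

/-! ### The action of `U_q(𝔮_n)` on `Ā_{s,n}` -/

section PhiBar

variable (s n : ℕ)

/-- The matrix of the action of `U_q(𝔮_n)` on `Ā_{s,n}`. -/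
def phiBarHom : Abar s n →ₐ[K] Matrix (Idx n) (Idx n) (Abar s n) :=
  liftAbar (dot1 (fun j c => cstMat (Abar s n) n (xMat (Sinv n) j c))
      (fun i j => iotaMat (gradeAbar s n) n (barMat tbar i j)))
    (dot1_neg (fun i j => by
      congr 1
      ext a b
      exact Sinv_neg_neg i j a b) (fun i j => by rw [barMat_tbar_neg]))
    (((rll_xMat_inv n).map (evenScal_S n) (evenScal_S n) _).dot1
      ((rll_tbar s n).map (evenScal_S n) (evenScal_S s) _)
      (superComm_iota_cst _ (evenScal_Sinv n) barMat_tbar_mem))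

variable {s n}

theorem phiBarHom_t (c : Idx n) (α : Idx s) : phiBarHom s n (barMat tbar c α) =
    dot1 (fun j c => cstMat (Abar s n) n (xMat (Sinv n) j c))
      (fun i j => iotaMat (gradeAbar s n) n (barMat tbar i j)) c α :=
  liftAbar_tbar _ _ _ c α

theorem phiBarHom_apply (c : Idx n) (α : Idx s) (a b : Idx n) :
    phiBarHom s n (barMat tbar c α) a b =
      ∑ d, (sgn (par a * (par d + par α)) * Sinv n c d a b) • barMat tbar d α := by
  rw [phiBarHom_t, left_apply barMat_tbar_mem (evenScal_Sinv n)]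

theorem opMat_phiBarHom (c : Idx n) (α : Idx s) (a b : Idx n) :
    opMat (gradeAbar s n) (phiBarHom s n) a b (barMat tbar c α) =
      ∑ d, (sgn ((par a + par b) * (par d + par α)) * Sinv n c d a b) • barMat tbar d α :=
  opMat_left barMat_tbar_mem (evenScal_Sinv n) (phiBarHom_t c α) a b

theorem phiBarHom_even : EvenHom (gradeAbar s n) (phiBarHom s n) := by
  refine evenHom_of_gen (adjoin_tbar s n) ?_
  rintro _ ⟨c, α, rfl⟩
  refine ⟨_, barMat_tbar_mem c α, fun a b => ?_⟩
  rw [phiBarHom_t]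
  exact left_mem barMat_tbar_mem (evenScal_Sinv n) c α a b

theorem phiBarHom_triangular (x : Abar s n) (a b : Idx n) (h : ¬ a ≤ b) :
    phiBarHom s n x a b = 0 := by
  refine triangular_of_gen (· ≤ ·) (adjoin_tbar s n) ?_ x a b h
  rintro _ ⟨c, α, rfl⟩ a b h
  rw [phiBarHom_apply]
  exact Finset.sum_eq_zero fun j _ => by rw [Sinv, sMatrix_triangular q⁻¹ c j a b h]; simp

theorem phiBarHom_diag (c : Idx n) (α : Idx s) (a : Idx n) :
    phiBarHom s n (barMat tbar c α) a a =
      (sgn (par a * (par c + par α)) * q⁻¹ ^ phi c a) • barMat tbar c α := by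
  rw [phiBarHom_apply, Finset.sum_eq_single c]
  · rw [Sinv, sMatrix_diag, if_pos rfl]
  · intro j _ hj
    rw [Sinv, sMatrix_diag, if_neg (Ne.symm hj)]
    simp
  · simp

theorem phiBarHom_inv (i : Idx n) : opMat (gradeAbar s n) (phiBarHom s n) i i *
    opMat (gradeAbar s n) (phiBarHom s n) (-i) (-i) = 1 := by
  refine opMat_diag_inv (· ≤ ·) phiBarHom_even phiBarHom_triangular (adjoin_tbar s n) ?_ i
  rintro _ ⟨c, α, rfl⟩ i
  rw [phiBarHom_diag, map_smul, Matrix.smul_apply, phiBarHom_diag, smul_smul,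
    twist_of_mem _ 1 (barMat_tbar_mem c α), one_mul, par_neg, phi_neg_right, zpow_neg]
  congr 1
  have hq := zpow_ne_zero (phi c i) (inv_ne_zero q_ne_zero)
  have hs : sgn ((par i + 1) * (par c + par α)) * sgn (par i * (par c + par α)) =
      sgn (par c + par α) := by
    rw [← sgn_add]
    exact sgn_congr (by linear_combination (par c + par α) * add_self_two (par i))
  rw [← hs]
  generalize q⁻¹ ^ phi c i = z at hq ⊢
  field_simp

/-- On each column of T̄ the operators act by Y⁻¹ with reversed composition, so the relation comes
from `mix_yMat_inv`. -/
theorem phiBarHom_mix : Mix (Sinv n) (opMat (gradeAbar s n) (phiBarHom s n))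
    (opMat (gradeAbar s n) (phiBarHom s n)) (Sinv n) := by
  refine mix_opMat (evenScal_Sinv n) phiBarHom_even phiBarHom_even (adjoin_tbar s n)
    tbar_homogeneous ?_
  rintro _ ⟨c, α, rfl⟩
  exact mixAt_of_antirep (evenScal_Sinv n) (evenScal_Sinv n) (mix_iff_rll_S.1 (mix_yMat_inv n))
    (fun c => barMat tbar c α) (par α) (fun a b c => opMat_phiBarHom c α a b) c

variable (s n) in
/-- The action `Φ` of `U_q(𝔮_n)` on `Ā_{s,n}`. -/
def phiBarAct : Uq n →ₐ[K] Module.End K (Abar s n) :=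
  matActU (phiBarHom s n) phiBarHom_triangular phiBarHom_inv phiBarHom_mix

theorem isMatAct_phiBarAct :
    IsMatAct (coalgU n) (gradeAbar s n) (phiBarAct s n) (phiBarHom s n) :=
  isMatAct_matActU phiBarHom_even _ _ _

theorem isPhiBar_phiBarAct : IsPhiBar s n (phiBarAct s n).toLinearMap where
  isSupermoduleSuperalgebra := isMatAct_phiBarAct.isSupermoduleSuperalgebra
  act_gen c α a b := by
    rw [AlgHom.toLinearMap_apply, phiBarAct, matActU_L, opMat_phiBarHom,
      scal_dot_leg1 (evenScal_Sinv n)]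

theorem IsPhiBar.eq {Φ : Uq n →ₗ[K] Module.End K (Abar s n)} (h : IsPhiBar s n Φ) :
    Φ = (phiBarAct s n).toLinearMap := by
  refine action_ext (coalgU n) h.isSupermoduleSuperalgebra
    isPhiBar_phiBarAct.isSupermoduleSuperalgebra (adjoin_tbar s n) tbar_homogeneous ?_
  rintro _ ⟨c, α, rfl⟩ a b
  have e := congrArg (sgn (par a + par b) • ·) ((h.act_gen c α a b).trans
    (isPhiBar_phiBarAct.act_gen c α a b).symm)
  simp only [smul_smul, sgn_mul_self, one_smul] at e
  change Φ (sgn _ • L a b) _ = (phiBarAct s n).toLinearMap (sgn _ • L a b) _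
  rw [map_smul, map_smul, LinearMap.smul_apply, LinearMap.smul_apply, e]

end PhiBar

/-! ### The action of `U_q(𝔮_s)` on `Ā_{s,n}` -/

section Psi

variable (s n : ℕ) (e : ℤˣ)

/-- The diagonal entries of `D^e`. -/
def dEntry {s : ℕ} (e : ℤˣ) (a : Idx s) : K := (q ^ (2 * |a.1|)) ^ (e : ℤ)

theorem dEntry_ne_zero {s : ℕ} (e : ℤˣ) (a : Idx s) : dEntry e a ≠ 0 :=
  zpow_ne_zero _ (zpow_ne_zero _ q_ne_zero)

theorem dEntry_neg {s : ℕ} (e : ℤˣ) (a : Idx s) : dEntry e (-a) = dEntry e a := by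
  rw [dEntry, dEntry, neg_val, abs_neg]

theorem Stilde_eq {s : ℕ} (i k j l : Idx s) :
    Stilde s e i k j l = dEntry e j * S s i k j l * (dEntry e l)⁻¹ := by
  rw [Stilde, dEntry, dEntry, zpow_neg]

theorem evenScal_Stilde : EvenScal (Stilde s e) := by
  intro i k j l h
  rw [Stilde_eq, evenScal_S s i k j l h]
  simp

/-- `S` commutes with `D ⊗ D`. -/
theorem S_dEntry {i k j l : Idx s} (h : S s i k j l ≠ 0) :
    dEntry e i * dEntry e j = dEntry e k * dEntry e l := by
  by_contra hd
  apply h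
  unfold S sMatrix
  have h1 : ¬ (i = k ∧ j = l) := by rintro ⟨rfl, rfl⟩; exact hd rfl
  have h2 : ¬ (i = l ∧ k = j) := by rintro ⟨rfl, rfl⟩; exact hd (mul_comm _ _)
  have h3 : ¬ (i = -l ∧ k = -j) := by
    rintro ⟨rfl, rfl⟩
    apply hd
    rw [dEntry_neg, dEntry_neg, mul_comm]
  rw [if_neg h1, if_neg h2, if_neg h3]
  simp

/-- Conjugation by D multiplies the matrix Y_{ab} by d_a/d_b, and these factors come out of both
sums because `S` commutes with D ⊗ D. About D nothing is used except that it is diagonal, invertible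
and invariant under a ↦ -a, whence either exponent is allowed. -/
theorem rll_yMat_Stilde : RLL (S s) (yMat (Stilde s e)) (S s) := by
  have h := (rll_iff (evenScal_S s) (evenScal_S s) (yMat (S s))).1 (rll_yMat s)
  rw [rll_iff (evenScal_S s) (evenScal_S s)]
  intro i x j y
  have hy : ∀ a b, yMat (Stilde s e) a b = (dEntry e a * (dEntry e b)⁻¹) • yMat (S s) a b := by
    intro a b
    ext p m
    rw [yMat, Matrix.of_apply, Stilde_eq, Matrix.smul_apply, yMat, Matrix.of_apply, smul_eq_mul]
    ring
  have h' := congrArg ((dEntry e i * dEntry e j * (dEntry e x)⁻¹ * (dEntry e y)⁻¹) • ·) (h i x j y)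
  simp only [Finset.smul_sum] at h'
  have hd := fun a : Idx s => dEntry_ne_zero e a
  refine Eq.trans (sum_congr₂ fun k l => ?_) (h'.trans (sum_congr₂ fun k l => ?_))
  · by_cases h0 : S s k x l y = 0
    · rw [h0]; simp
    · have := S_dEntry s e h0
      rw [hy, hy, smul_mul_smul_comm, smul_comm]
      congr 1
      have h1 := hd k
      have h2 := hd l
      have h3 := hd x
      have h4 := hd y
      field_simp
      linear_combination (-(dEntry e i * dEntry e j)) * this
  · by_cases h0 : S s i k j l = 0
    · rw [h0]; simp
    · have := S_dEntry s e h0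
      rw [hy, hy, smul_mul_smul_comm, smul_comm]
      congr 2
      linear_combination ((dEntry e x)⁻¹ * (dEntry e y)⁻¹) * this

/-- Here D acts in the matrix space itself, so all matrices X are conjugated simultaneously. -/
theorem mix_xMat_Stilde : Mix (S s) (xMat (Stilde s e)) (xMat (Stilde s e)) (S s) := by
  have h := (mix_iff (evenScal_S s) (evenScal_S s) (xMat (S s)) (xMat (S s))).1 (mix_xMat s)
  rw [mix_iff (evenScal_S s) (evenScal_S s)]
  intro i x j y
  ext a b
  have h' := congrArg (fun M => dEntry e a * M a b * (dEntry e b)⁻¹) (h i x j y)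
  have hm : ∀ k x l y, (xMat (Stilde s e) k x * xMat (Stilde s e) l y) a b =
      dEntry e a * (xMat (S s) k x * xMat (S s) l y) a b * (dEntry e b)⁻¹ := by
    intro k x l y
    rw [Matrix.mul_apply, Matrix.mul_apply, Finset.mul_sum, Finset.sum_mul]
    refine Finset.sum_congr rfl fun c _ => ?_
    simp only [xMat, Matrix.of_apply, Stilde_eq]
    have := dEntry_ne_zero e c
    field_simp
  simp only [Matrix.sum_apply, Matrix.smul_apply, smul_eq_mul, Finset.mul_sum,
    Finset.sum_mul] at h' ⊢
  refine Eq.trans (sum_congr₂ fun k l => ?_) (h'.trans (sum_congr₂ fun k l => ?_))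
  · rw [hm]; ring
  · rw [hm]; ring

/-- The super transpose of the second leg of `S̃`. -/
def psiMat : Mat2 s s s s K := fun β α b a => sgn (par b * (par a + 1)) * Stilde s e β α a b

theorem evenScal_psiMat : EvenScal (psiMat s e) := by
  intro i k j l h
  rw [psiMat, evenScal_Stilde s e i k l j (fun h' => h (by rw [← h']; ring)), mul_zero]

/-- The supertranspose reverses products in the matrix space, up to the rule of signs, and so turns
the relation S X¹X² = X²X¹S into the one needed for right multiplication of T̄. It matches the
exchange of indices in the generators of the co-opposite. -/
theorem rll_psiMat : RLL (S s) (xMat (psiMat s e)) (S s) := by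
  have h := (mix_iff (evenScal_S s) (evenScal_S s) _ _).1 (mix_xMat_Stilde s e)
  rw [rll_iff (evenScal_S s) (evenScal_S s)]
  intro i x j y
  ext b a
  have hm : ∀ α β γ δ, (xMat (psiMat s e) α β * xMat (psiMat s e) γ δ) b a =
      sgn (par b * (par a + 1) + (par α + par β) * (par γ + par δ)) *
        (xMat (Stilde s e) γ δ * xMat (Stilde s e) α β) a b := by
    intro α β γ δ
    rw [Matrix.mul_apply, Matrix.mul_apply, Finset.mul_sum]
    refine Finset.sum_congr rfl fun c _ => ?_
    simp only [xMat, Matrix.of_apply, psiMat]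
    by_cases h1 : par α + par β + par c + par b = 0
    · by_cases h2 : par γ + par δ + par a + par c = 0
      · have hs : sgn (par b * (par c + 1)) * sgn (par c * (par a + 1)) =
            sgn (par b * (par a + 1) + (par α + par β) * (par γ + par δ)) := by
          rw [← sgn_add]
          refine sgn_congr ?_
          rw [show par α + par β = par c + par b by
              linear_combination h1 - add_self_two (par c + par b),
            show par γ + par δ = par a + par c by
              linear_combination h2 - add_self_two (par a + par c)]
          generalize par a = a, par b = b, par c = c
          revert a b c; decide
        rw [← hs]
        ring
      · rw [evenScal_Stilde s e γ δ a c h2]; simp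
    · rw [evenScal_Stilde s e α β c b h1]; simp
  have h' := congrArg (fun M => sgn (par b * (par a + 1)) * M a b) (h i x j y)
  simp only [Matrix.sum_apply, Matrix.smul_apply, smul_eq_mul, Finset.mul_sum, hm] at h' ⊢
  refine Eq.trans (sum_congr₂ fun k l => ?_) (h'.symm.trans (sum_congr₂ fun k l => ?_))
  · have hs : sgn ((par j + par l) * (par i + par x)) *
        sgn ((par i + par k) * (par j + par l)) = sgn ((par j + par l) * (par k + par x)) := by
      rw [← sgn_add]
      refine sgn_congr ?_
      linear_combination (par j + par l) * add_self_two (par i)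
    rw [sgn_add, ← hs]
    ring
  · have hs : sgn ((par j + par l) * (par k + par x)) *
        sgn ((par l + par y) * (par k + par x)) = sgn ((par k + par x) * (par j + par y)) := by
      rw [← sgn_add]
      refine sgn_congr ?_
      linear_combination (par k + par x) * add_self_two (par l)
    rw [sgn_add, ← hs]
    ring

/-- The matrix of the action of `U_q(𝔮_s)` on `Ā_{s,n}`. -/
def psiHom : Abar s n →ₐ[K] Matrix (Idx s) (Idx s) (Abar s n) :=
  liftAbar (dot1 (fun i j => iotaMat (gradeAbar s n) s (barMat tbar i j))
      (fun j c => cstMat (Abar s n) s (xMat (psiMat s e) j c)))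
    (dot1_neg (fun i j => by rw [barMat_tbar_neg]) (fun i j => by
      congr 1
      ext a b
      simp only [xMat, Matrix.of_apply, psiMat, Stilde_eq, S_neg_neg]))
    (((rll_tbar s n).map (evenScal_S n) (evenScal_S s) _).dot1
      ((rll_psiMat s e).map (evenScal_S s) (evenScal_S s) _)
      (superComm_cst_iota _ (evenScal_psiMat s e) barMat_tbar_mem))

variable {s n e}

theorem psiHom_t (c : Idx n) (α : Idx s) : psiHom s n e (barMat tbar c α) =
    dot1 (fun i j => iotaMat (gradeAbar s n) s (barMat tbar i j))
      (fun j c => cstMat (Abar s n) s (xMat (psiMat s e) j c)) c α :=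
  liftAbar_tbar _ _ _ c α

theorem opMatT_psiHom (c : Idx n) (α a b : Idx s) :
    opMatT (gradeAbar s n) (psiHom s n e) a b (barMat tbar c α) =
      ∑ β, Stilde s e β α a b • barMat tbar c β := by
  rw [opMatT_eq, opMat_right barMat_tbar_mem (evenScal_psiMat s e) (psiHom_t c α), Finset.smul_sum]
  refine Finset.sum_congr rfl fun β _ => ?_
  rw [smul_smul, psiMat, ← mul_assoc, sgn_mul_self, one_mul]

theorem psiHom_even : EvenHom (gradeAbar s n) (psiHom s n e) := by
  refine evenHom_of_gen (adjoin_tbar s n) ?_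
  rintro _ ⟨c, α, rfl⟩
  refine ⟨_, barMat_tbar_mem c α, fun a b => ?_⟩
  rw [psiHom_t]
  exact right_mem barMat_tbar_mem (evenScal_psiMat s e) c α a b

theorem psiHom_apply (c : Idx n) (α a b : Idx s) : psiHom s n e (barMat tbar c α) a b =
    ∑ β, (sgn ((par c + par β) * par b) * psiMat s e β α a b) • barMat tbar c β := by
  rw [psiHom_t, right_apply barMat_tbar_mem (evenScal_psiMat s e)]

/-- Because of the transposition the triangularity of `S` appears with the order reversed. -/
theorem psiHom_triangular (x : Abar s n) (a b : Idx s) (h : ¬ a ≥ b) :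
    psiHom s n e x a b = 0 := by
  refine triangular_of_gen (· ≥ ·) (adjoin_tbar s n) ?_ x a b h
  rintro _ ⟨c, α, rfl⟩ a b h
  rw [psiHom_apply]
  exact Finset.sum_eq_zero fun j _ => by
    rw [psiMat, Stilde_eq, S, sMatrix_triangular q j α b a h]; simp

theorem psiHom_diag (c : Idx n) (α a : Idx s) : psiHom s n e (barMat tbar c α) a a =
    (sgn ((par c + par α) * par a) * q ^ phi α a) • barMat tbar c α := by
  have hz : ∀ β, psiMat s e β α a a = if β = α then q ^ phi α a else 0 := by
    intro β
    rw [psiMat, Stilde_eq, S, sMatrix_diag,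
      show par a * (par a + 1) = 0 by generalize par a = a; revert a; decide, sgn_zero, one_mul]
    split
    · rw [mul_assoc, mul_comm, mul_assoc, inv_mul_cancel₀ (dEntry_ne_zero e a), mul_one]
    · simp
  rw [psiHom_apply, Finset.sum_eq_single α]
  · rw [hz, if_pos rfl]
  · intro j _ hj
    rw [hz, if_neg hj]
    simp
  · simp

theorem psiHom_inv (i : Idx s) : opMat (gradeAbar s n) (psiHom s n e) i i *
    opMat (gradeAbar s n) (psiHom s n e) (-i) (-i) = 1 := by
  refine opMat_diag_inv (· ≥ ·) psiHom_even psiHom_triangular (adjoin_tbar s n) ?_ i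
  rintro _ ⟨c, α, rfl⟩ i
  rw [psiHom_diag, map_smul, Matrix.smul_apply, psiHom_diag, smul_smul,
    twist_of_mem _ 1 (barMat_tbar_mem c α), one_mul, par_neg, phi_neg_right, zpow_neg]
  congr 1
  have hq := zpow_ne_zero (phi α i) q_ne_zero
  have hs : sgn ((par c + par α) * (par i + 1)) * sgn ((par c + par α) * par i) =
      sgn (par c + par α) := by
    rw [← sgn_add]
    exact sgn_congr (by linear_combination (par c + par α) * add_self_two (par i))
  rw [← hs]
  field_simp

/-- On each row of T̄ the transposed operators act by the matrices Y of `Stilde`, so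
`rll_yMat_Stilde` is what is needed. -/
theorem psiHom_mix : Mix (Sinv s) (opMatT (gradeAbar s n) (psiHom s n e))
    (opMatT (gradeAbar s n) (psiHom s n e)) (Sinv s) := by
  refine mix_opMatT (evenScal_Sinv s) psiHom_even (adjoin_tbar s n) tbar_homogeneous ?_
  rintro _ ⟨c, α, rfl⟩
  exact mixAt_of_rep (evenScal_Sinv s) (rll_iff_mix_S.1 (rll_yMat_Stilde s e)) (barMat tbar c)
    (fun a b α => opMatT_psiHom c α a b) (fun a b α => opMatT_psiHom c α a b) α

variable (s n e) in
/-- The action `Ψ` of `U_q(𝔮_s)` on `Ā_{s,n}`. -/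
def psiAct : Uq s →ₐ[K] Module.End K (Abar s n) :=
  matActUcop (psiHom s n e) psiHom_triangular psiHom_inv psiHom_mix

theorem isMatAct_psiAct :
    IsMatAct (coalgUcop s) (gradeAbar s n) (psiAct s n e) (psiHom s n e) :=
  isMatAct_matActUcop psiHom_even _ _ _

theorem isPsiBar_psiAct : IsPsiBar s n e (psiAct s n e).toLinearMap where
  isSupermoduleSuperalgebra := by
    rw [← coalgUcop_Δ]
    exact isMatAct_psiAct.isSupermoduleSuperalgebra
  act_gen c α a b := by
    rw [AlgHom.toLinearMap_apply, psiAct, matActUcop_L, opMatT_psiHom,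
      leg1_dot_scal (evenScal_Stilde s e)]

theorem IsPsiBar.eq {Ψ : Uq s →ₗ[K] Module.End K (Abar s n)} (h : IsPsiBar s n e Ψ) :
    Ψ = (psiAct s n e).toLinearMap := by
  have h1 := h.isSupermoduleSuperalgebra
  have h2 := (isPsiBar_psiAct (s := s) (n := n) (e := e)).isSupermoduleSuperalgebra
  rw [← coalgUcop_Δ] at h1 h2
  refine action_ext (coalgUcop s) h1 h2 (adjoin_tbar s n) tbar_homogeneous ?_
  rintro _ ⟨c, α, rfl⟩ a b
  have e := congrArg (sgn (par b + par a) • ·) ((h.act_gen c α b a).trans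
    (isPsiBar_psiAct.act_gen c α b a).symm)
  simp only [smul_smul, sgn_mul_self, one_smul] at e
  exact e

end Psi

/-! ### The matrix of the braiding -/

section Nu

/-- The matrix `(-1)^{|j|+|c|} S⁻¹` with its legs exchanged. -/
def nuMat (n : ℕ) : Mat2 n n n n K := fun j c a b => sgn (par j + par c) * Sinv n a b j c

theorem evenScal_nuMat (n : ℕ) : EvenScal (nuMat n) := by
  intro i k j l h
  rw [nuMat, evenScal_Sinv n j l i k (fun h' => h (by rw [← h']; ring)), mul_zero]

/-- Exchanging the legs makes ν, up to sign, the inverse of Y, whose relation is already known. -/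
theorem mix_nuMat (n : ℕ) : Mix (S n) (xMat (nuMat n)) (xMat (nuMat n)) (S n) := by
  have e : xMat (nuMat n) = genMat (yMat (Sinv n)) := by
    funext j c
    ext a b
    rfl
  rw [e]
  exact (mix_yMat_inv n).genMat (evenScal_S n)

variable (r n : ℕ)

/-- The matrix of the braiding: `Υ(T̄_{bα} ⊗ x)` is a signed sum of `ν_{bd}(x) ⊗ T̄_{dα}`. -/
def nuHom : Aq r n →ₐ[K] Matrix (Idx n) (Idx n) (Aq r n) :=
  liftA (fun i a => if 0 < i.1 then
      dot1 (fun i j => iotaMat (gradeA r n) n (t i j))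
        (fun j c => cstMat (Aq r n) n (xMat (nuMat n) j c)) i a else
      dot1 (fun i j => iotaMat (gradeA r n) n (t i j))
        (fun j c => cstMat (Aq r n) n (xMat (nuMat n) j c)) (-i) (-a))
    (by
      intro i a
      have := val_ne_zero i
      by_cases h : 0 < i.1
      · rw [if_pos h, if_neg (by rw [neg_val]; omega), neg_neg_idx, neg_neg_idx]
      · rw [if_neg h, if_pos (by rw [neg_val]; omega)])
    -- The product of T with ν need not be symmetric, since the leg of S⁻¹ multiplying T is the
    -- second one. Only its positive rows are kept, in accordance with the use of T₊ in the
    -- condition on Υ.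
    (mix_symmetrize (((mix_t r n).map (evenScal_S r) (evenScal_S n) _).dot1
      ((mix_nuMat n).map (evenScal_S n) (evenScal_S n) _)
      (superComm_cst_iota _ (evenScal_nuMat n) t_mem)))

variable {r n}

theorem nuHom_t {i : Idx r} (hi : 0 < i.1) (c : Idx n) : nuHom r n (t i c) =
    dot1 (fun i j => iotaMat (gradeA r n) n (t i j))
      (fun j c => cstMat (Aq r n) n (xMat (nuMat n) j c)) i c := by
  rw [nuHom, liftA_t, if_pos hi]

theorem nuHom_apply {i : Idx r} (hi : 0 < i.1) (c a b : Idx n) : nuHom r n (t i c) a b =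
    ∑ j, (sgn ((par i + par j) * par b) * nuMat n j c a b) • t i j := by
  rw [nuHom_t hi, right_apply t_mem (evenScal_nuMat n)]

theorem nuHom_even : EvenHom (gradeA r n) (nuHom r n) := by
  refine evenHom_of_gen (adjoin_t_pos r n) ?_
  rintro _ ⟨i, c, hi, rfl⟩
  refine ⟨_, t_mem i c, fun a b => ?_⟩
  rw [nuHom_t hi]
  exact right_mem t_mem (evenScal_nuMat n) i c a b

theorem opMat_nuHom {i : Idx r} (hi : 0 < i.1) (a b c : Idx n) :
    opMat (gradeA r n) (nuHom r n) a b (t i c) =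
      ∑ j, genMat (xMat (Sinv n)) a b j c • t i j := by
  rw [opMat_right t_mem (evenScal_nuMat n) (nuHom_t hi c)]
  refine Finset.sum_congr rfl fun j _ => ?_
  rw [genMat, Matrix.smul_apply, xMat, Matrix.of_apply, smul_eq_mul, nuMat]
  by_cases h : par a + par b + par j + par c = 0
  · congr 2
    refine sgn_congr ?_
    linear_combination h - add_self_two (par a + par b)
  · rw [evenScal_Sinv n a b j c h]
    simp

/-- On a positive row of T the operators of ν act by X⁻¹ up to the sign of `genMat`. The relation
then says that they satisfy the quadratic relation of T̄ with `S n` on both sides. -/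
theorem nuHom_mix : Mix (Sinv n) (opMat (gradeA r n) (nuHom r n))
    (opMat (gradeA r n) (nuHom r n)) (Sinv n) := by
  refine mix_opMat (evenScal_Sinv n) nuHom_even nuHom_even (adjoin_t_pos r n)
    t_pos_homogeneous ?_
  rintro _ ⟨i, c, hi, rfl⟩
  exact mixAt_of_rep (evenScal_Sinv n)
    ((rll_iff_mix_S.1 (rll_xMat_inv n)).genMat (evenScal_Sinv n)) (t i)
    (fun a b c => opMat_nuHom hi a b c) (fun a b c => opMat_nuHom hi a b c) c

/-- On a positive row of T, ν acts by X⁻¹ and φ by Y, so this is the relation derived from the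
Yang–Baxter equation with middle matrix space. It contains the equivariance of the braiding under
U_q(𝔮_n). -/
theorem nuHom_phiHom_mix : Mix (Sinv n) (opMat (gradeA r n) (nuHom r n))
    (opMat (gradeA r n) (phiHom r n)) (Sinv n) := by
  refine mix_opMat (evenScal_Sinv n) nuHom_even phiHom_even (adjoin_t_pos r n)
    t_pos_homogeneous ?_
  rintro _ ⟨i, c, hi, rfl⟩
  exact mixAt_of_rep (evenScal_Sinv n) (mix_xMat_inv_yMat n) (t i)
    (fun a b c => opMat_nuHom hi a b c) (fun a b c => opMat_phiHom i c a b) c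

end Nu

/-! ### The braiding -/

section Braiding

variable {r s n : ℕ}

/-- On generators this is the invariance of the first leg of S⁻¹, with γ accounting for the change
of parity. It ensures that the operators attached to T̄ have the symmetry of T̄. -/
theorem nuHom_neg (x : Aq r n) (b d : Idx n) :
    nuHom r n x (-b) (-d) = twist (gradeA r n) 1 (nuHom r n x b d) := by
  induction x using aq_induction_pos generalizing b d with
  | hgen i c hi =>
    rw [nuHom_apply hi, nuHom_apply hi, map_sum]
    refine Finset.sum_congr rfl fun j _ => ?_
    rw [map_smul, twist_of_mem _ 1 (t_mem i j), smul_smul, nuMat, nuMat, Sinv_neg_neg, par_neg,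
      mul_add, mul_one, sgn_add, one_mul]
    congr 1
    ring
  | hmap k =>
    rw [AlgHom.commutes, Matrix.algebraMap_matrix_apply, Matrix.algebraMap_matrix_apply]
    simp only [neg_idx_inj]
    split
    · rw [Algebra.algebraMap_eq_smul_one, map_smul, twist_one]
    · simp
  | hadd u v hu hv => simp only [map_add, Matrix.add_apply, hu, hv]
  | hmul u v hu hv =>
    rw [map_mul, Matrix.mul_apply, Matrix.mul_apply, map_sum, ← sum_neg_idx]
    exact Finset.sum_congr rfl fun c _ => by rw [hu, hv, twist_mul]

instance endOqRing (r s n : ℕ) : Ring (Module.End K (Oq r s n)) :=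
  @Module.End.instRing K (Oq r s n) _ TensorProduct.addCommGroup _

/-- `ν ⊗ 1`. -/
def braidLeft (r s n : ℕ) (b d : Idx n) : Module.End K (Oq r s n) :=
  Module.End.rTensorAlgHom K (Aq r n) (Abar s n) (opMat (gradeA r n) (nuHom r n) b d)

/-- Left multiplication by `T̄` on the second factor, with the sign rule. -/
def braidRight (r s n : ℕ) (d : Idx n) (α : Idx s) : Module.End K (Oq r s n) :=
  TensorProduct.map (twist (gradeA r n) (par d + par α)) (LinearMap.mulLeft K (barMat tbar d α))

theorem braidLeft_tmul (b d : Idx n) (x : Aq r n) (h : Abar s n) :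
    braidLeft r s n b d (x ⊗ₜ h) = opMat (gradeA r n) (nuHom r n) b d x ⊗ₜ h := rfl

theorem braidRight_tmul (d : Idx n) (α : Idx s) (x : Aq r n) (h : Abar s n) :
    braidRight r s n d α (x ⊗ₜ h) =
      twist (gradeA r n) (par d + par α) x ⊗ₜ (barMat tbar d α * h) := rfl

theorem rll_braidLeft : RLL (S n) (braidLeft r s n) (S n) :=
  (rll_iff_mix_S.2 nuHom_mix).map (evenScal_S n) (evenScal_S n) _

/-- Left multiplication by T̄ inherits the relation of T̄. The power of γ on the other factor
depends only on the total parity of the two entries, which is constant over the contributing terms.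
-/
theorem rll_braidRight : RLL (S n) (braidRight r s n) (S s) := by
  have h := (rll_iff (evenScal_S n) (evenScal_S s) _).1 (rll_tbar s n)
  rw [rll_iff (evenScal_S n) (evenScal_S s)]
  intro i x j y
  refine TensorProduct.ext' fun f g => ?_
  simp only [LinearMap.sum_apply, LinearMap.smul_apply, Module.End.mul_apply, braidRight_tmul,
    twist_twist, ← mul_assoc, TensorProduct.smul_tmul']
  have e := congrArg (fun z => twist (gradeA r n) (par i + par x + par j + par y) f ⊗ₜ[K] (z * g))
    (h i x j y)
  simp only [Finset.sum_mul, TensorProduct.tmul_sum, smul_mul_assoc, TensorProduct.tmul_smul] at e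
  refine Eq.trans (sum_congr₂ fun k l => ?_) (e.trans (sum_congr₂ fun k l => ?_))
  · by_cases h0 : par k + par x + par l + par y = 0
    · rw [TensorProduct.smul_tmul', show par i + par k + (par j + par l) =
        par i + par x + par j + par y by
          linear_combination h0 - add_self_two (par x + par y)]
    · rw [evenScal_S s k x l y h0]; simp
  · by_cases h0 : par i + par k + par j + par l = 0
    · rw [TensorProduct.smul_tmul', show par l + par y + (par k + par x) =
        par i + par x + par j + par y by
          linear_combination h0 - add_self_two (par i + par j)]
    · rw [evenScal_S n i k j l h0]; simp

/-- The second factors do not interact; the sign arises when γ^{|d|+|α|} passes the entry of ν,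
whose parity shift is |b| + |c|. -/
theorem superComm_braid : SuperComm (braidRight r s n) (braidLeft r s n) := by
  intro d α b c
  refine TensorProduct.ext' fun f g => ?_
  rw [Module.End.mul_apply, LinearMap.smul_apply, Module.End.mul_apply, braidLeft_tmul,
    braidRight_tmul, braidRight_tmul, braidLeft_tmul, TensorProduct.smul_tmul', opMat_apply,
    opMat_apply, map_smul, nuHom_even, twist_twist, twist_twist, smul_smul, smul_smul,
    add_comm (par d + par α) (par c), mul_comm (sgn (par c * _))]

theorem dot1_braid_tmul (b : Idx n) (α : Idx s) (x : Aq r n) (h : Abar s n) :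
    dot1 (braidLeft r s n) (braidRight r s n) b α (x ⊗ₜ h) =
      ∑ d, twist (gradeA r n) (par α) (nuHom r n x b d) ⊗ₜ (barMat tbar d α * h) := by
  rw [dot1, LinearMap.sum_apply]
  refine Finset.sum_congr rfl fun d _ => ?_
  rw [LinearMap.smul_apply, Module.End.mul_apply, braidRight_tmul, braidLeft_tmul, opMat_apply,
    twist_twist, nuHom_even, TensorProduct.smul_tmul', smul_smul, ← sgn_add,
    show par d + (par d + par α) = par α by linear_combination add_self_two (par d)]
  congr 2
  refine sgn_congr ?_
  linear_combination (par b + par d) * add_self_two (par d)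

/-- The algebra homomorphism `ḡ ↦ (y ⊗ h ↦ Υ(ḡ ⊗ y)(1 ⊗ h))`. -/
def braidAct (r s n : ℕ) : Abar s n →ₐ[K] Module.End K (Oq r s n) :=
  liftAbar (dot1 (braidLeft r s n) (braidRight r s n))
    (fun b α => by
      refine TensorProduct.ext' fun x h => ?_
      rw [dot1_braid_tmul, dot1_braid_tmul, ← sum_neg_idx]
      refine Finset.sum_congr rfl fun d _ => ?_
      rw [nuHom_neg, twist_twist, barMat_tbar_neg, par_neg, add_assoc, add_self_two, add_zero])
    -- A solution with `S n` on both sides, followed by one from `S n` to `S s` with supercommuting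
    -- entries, satisfies the relation of T̄.
    (rll_braidLeft.dot1 rll_braidRight superComm_braid)

theorem braidAct_tbar (b : Idx n) (α : Idx s) (x : Aq r n) (h : Abar s n) :
    braidAct r s n (barMat tbar b α) (x ⊗ₜ h) =
      ∑ d, twist (gradeA r n) (par α) (nuHom r n x b d) ⊗ₜ (barMat tbar d α * h) := by
  rw [braidAct, liftAbar_tbar, dot1_braid_tmul]

/-- The braiding `Υ`. -/
def braid (r s n : ℕ) : Abar s n ⊗[K] Aq r n →ₗ[K] Oq r s n :=
  TensorProduct.lift ((LinearMap.lcomp K (Oq r s n) ((TensorProduct.mk K (Aq r n) (Abar s n)).flip 1)) ∘ₗ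
    (braidAct r s n).toLinearMap)

theorem braid_tmul (g : Abar s n) (x : Aq r n) :
    braid r s n (g ⊗ₜ x) = braidAct r s n g (x ⊗ₜ 1) := rfl

theorem braid_tbar (b : Idx n) (α : Idx s) (x : Aq r n) : braid r s n (barMat tbar b α ⊗ₜ x) =
    ∑ d, twist (gradeA r n) (par α) (nuHom r n x b d) ⊗ₜ barMat tbar d α := by
  simp only [braid_tmul, braidAct_tbar, mul_one]

theorem braidAct_mul_right (g h : Abar s n) (z : Oq r s n) :
    braidAct r s n g (z * (1 ⊗ₜ h)) = braidAct r s n g z * (1 ⊗ₜ h) := by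
  induction g using abar_induction generalizing z with
  | hgen b α =>
    induction z using TensorProduct.induction_on with
    | zero => simp
    | add z w hz hw => simp only [add_mul, map_add, hz, hw]
    | tmul x k =>
      rw [Algebra.TensorProduct.tmul_mul_tmul, mul_one, braidAct_tbar, braidAct_tbar,
        Finset.sum_mul]
      simp only [Algebra.TensorProduct.tmul_mul_tmul, mul_one, mul_assoc]
  | hmap c =>
    rw [AlgHom.commutes, Module.algebraMap_end_apply, Module.algebraMap_end_apply, smul_mul_assoc]
  | hadd u v hu hv => simp only [map_add, LinearMap.add_apply, hu, hv, add_mul]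
  | hmul u v hu hv => simp only [map_mul, Module.End.mul_apply, hu, hv]

theorem braidAct_apply (g h : Abar s n) (x : Aq r n) :
    braidAct r s n g (x ⊗ₜ h) = braid r s n (g ⊗ₜ x) * (1 ⊗ₜ h) := by
  rw [braid_tmul, ← braidAct_mul_right, Algebra.TensorProduct.tmul_mul_tmul, mul_one, one_mul]

/-- This is multiplicativity of ν: moving T̄_{bα} past y leaves entries T̄_{dα} with the same α,
which then act on the rest. -/
theorem braidAct_tbar_mul_left (b : Idx n) (α : Idx s) (y : Aq r n) (w : Oq r s n) :
    braidAct r s n (barMat tbar b α) ((y ⊗ₜ 1) * w) =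
      ∑ d, (twist (gradeA r n) (par α) (nuHom r n y b d) ⊗ₜ 1) *
        braidAct r s n (barMat tbar d α) w := by
  induction w using TensorProduct.induction_on with
  | zero => simp
  | add z w hz hw => simp only [mul_add, map_add, hz, hw, Finset.sum_add_distrib]
  | tmul x k =>
    simp only [Algebra.TensorProduct.tmul_mul_tmul, one_mul, braidAct_tbar, Finset.mul_sum,
      map_mul, Matrix.mul_apply, map_sum, twist_mul, TensorProduct.sum_tmul]
    exact Finset.sum_comm

/-- `x ⊗ h ↦ (x ⊗ 1) Υ(h ⊗ y)`. -/
def rightAct (Υ : Abar s n ⊗[K] Aq r n →ₗ[K] Oq r s n) (y : Aq r n) : Module.End K (Oq r s n) :=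
  (LinearMap.mul' K (Aq r n)).rTensor (Abar s n) ∘ₗ
    (TensorProduct.assoc K (Aq r n) (Aq r n) (Abar s n)).symm.toLinearMap ∘ₗ
    Υ.lTensor (Aq r n) ∘ₗ
    (TensorProduct.assoc K (Aq r n) (Abar s n) (Aq r n)).toLinearMap ∘ₗ
    (TensorProduct.mk K (Oq r s n) (Aq r n)).flip y

theorem rightAct_tmul (Υ : Abar s n ⊗[K] Aq r n →ₗ[K] Oq r s n) (y x : Aq r n) (h : Abar s n) :
    rightAct Υ y (x ⊗ₜ h) = (x ⊗ₜ 1) * Υ (h ⊗ₜ y) := by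
  simp only [rightAct, LinearMap.comp_apply, LinearMap.flip_apply, TensorProduct.mk_apply,
    LinearEquiv.coe_coe, TensorProduct.assoc_tmul, LinearMap.lTensor_tmul]
  generalize Υ (h ⊗ₜ y) = w
  induction w using TensorProduct.induction_on with
  | zero => simp
  | add z w hz hw => simp only [TensorProduct.tmul_add, map_add, hz, hw, mul_add]
  | tmul x k => simp

theorem IsBraiding.mul_right_apply {Υ : Abar s n ⊗[K] Aq r n →ₗ[K] Oq r s n}
    (hΥ : IsBraiding r s n Υ) (g : Abar s n) (x y : Aq r n) :
    Υ (g ⊗ₜ (x * y)) = rightAct Υ y (Υ (g ⊗ₜ x)) :=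
  congrArg (fun f => f (g ⊗ₜ (x ⊗ₜ y))) hΥ.mul_right

/-- `x ⊗ h ↦ Υ(g ⊗ x)(1 ⊗ h)`. -/
def leftAct (Υ : Abar s n ⊗[K] Aq r n →ₗ[K] Oq r s n) (g : Abar s n) : Module.End K (Oq r s n) :=
  (LinearMap.mul' K (Abar s n)).lTensor (Aq r n) ∘ₗ
    (TensorProduct.assoc K (Aq r n) (Abar s n) (Abar s n)).toLinearMap ∘ₗ
    Υ.rTensor (Abar s n) ∘ₗ
    (TensorProduct.assoc K (Abar s n) (Aq r n) (Abar s n)).symm.toLinearMap ∘ₗ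
    TensorProduct.mk K (Abar s n) (Oq r s n) g

theorem leftAct_tmul (Υ : Abar s n ⊗[K] Aq r n →ₗ[K] Oq r s n) (x : Aq r n) (g h : Abar s n) :
    leftAct Υ g (x ⊗ₜ h) = Υ (g ⊗ₜ x) * (1 ⊗ₜ h) := by
  simp only [leftAct, LinearMap.comp_apply, TensorProduct.mk_apply,
    LinearEquiv.coe_coe, TensorProduct.assoc_symm_tmul, LinearMap.rTensor_tmul]
  generalize Υ (g ⊗ₜ x) = w
  induction w using TensorProduct.induction_on with
  | zero => simp
  | add z w hz hw => simp only [TensorProduct.add_tmul, map_add, hz, hw, add_mul]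
  | tmul x k => simp

theorem IsBraiding.mul_left_apply {Υ : Abar s n ⊗[K] Aq r n →ₗ[K] Oq r s n}
    (hΥ : IsBraiding r s n Υ) (g h : Abar s n) (x : Aq r n) :
    Υ ((g * h) ⊗ₜ x) = leftAct Υ g (Υ (h ⊗ₜ x)) :=
  congrArg (fun f => f ((g ⊗ₜ h) ⊗ₜ x)) hΥ.mul_left

theorem leftAct_braid (g : Abar s n) : leftAct (braid r s n) g = braidAct r s n g := by
  refine TensorProduct.ext' fun x h => ?_
  rw [leftAct_tmul, braidAct_apply]

theorem rightAct_mul_left (Υ : Abar s n ⊗[K] Aq r n →ₗ[K] Oq r s n) (x y : Aq r n)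
    (w : Oq r s n) : rightAct Υ y ((x ⊗ₜ 1) * w) = (x ⊗ₜ 1) * rightAct Υ y w := by
  induction w using TensorProduct.induction_on with
  | zero => simp
  | add z w hz hw => simp only [mul_add, map_add, hz, hw]
  | tmul z k =>
    rw [Algebra.TensorProduct.tmul_mul_tmul, one_mul, rightAct_tmul, rightAct_tmul, ← mul_assoc,
      Algebra.TensorProduct.tmul_mul_tmul, one_mul]

/-- The left and the right actions on `O_{r,s}` commute. -/
theorem braidAct_rightAct (g : Abar s n) (y : Aq r n) (z : Oq r s n) :
    braidAct r s n g (rightAct (braid r s n) y z) =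
      rightAct (braid r s n) y (braidAct r s n g z) := by
  induction g using abar_induction generalizing z with
  | hgen b α =>
    induction z using TensorProduct.induction_on with
    | zero => simp
    | add z w hz hw => simp only [map_add, hz, hw]
    | tmul x k =>
      rw [rightAct_tmul, braidAct_tbar_mul_left, braidAct_tbar, map_sum]
      refine Finset.sum_congr rfl fun d _ => ?_
      -- With T̄ moved past x by ν, the entry T̄_{dα} acts on Υ(k ⊗ y); the two sides agree because
      -- `braidAct` is multiplicative in T̄_{dα}k.
      rw [rightAct_tmul, braid_tmul, braid_tmul, map_mul, Module.End.mul_apply]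
  | hmap c =>
    rw [AlgHom.commutes, Module.algebraMap_end_apply, Module.algebraMap_end_apply, map_smul]
  | hadd u v hu hv => simp only [map_add, LinearMap.add_apply, hu, hv]
  | hmul u v hu hv => simp only [map_mul, Module.End.mul_apply, hu, hv]

theorem braid_one_left (x : Aq r n) : braid r s n (1 ⊗ₜ x) = x ⊗ₜ 1 := by
  rw [braid_tmul, map_one, Module.End.one_apply]

theorem braid_one_right (g : Abar s n) : braid r s n (g ⊗ₜ 1) = 1 ⊗ₜ g := by
  have h : ∀ h : Abar s n, braidAct r s n g (1 ⊗ₜ h) = 1 ⊗ₜ (g * h) := by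
    induction g using abar_induction with
    | hgen b α =>
      intro h
      rw [braidAct_tbar, Finset.sum_eq_single b]
      · rw [map_one (nuHom r n), Matrix.one_apply, if_pos rfl, twist_one]
      · intro d _ hd
        rw [map_one (nuHom r n), Matrix.one_apply, if_neg (Ne.symm hd), map_zero,
          TensorProduct.zero_tmul]
      · simp
    | hmap c =>
      intro h
      rw [AlgHom.commutes, Module.algebraMap_end_apply, ← Algebra.smul_def,
        TensorProduct.tmul_smul]
    | hadd u v hu hv =>
      intro h
      rw [map_add, LinearMap.add_apply, hu, hv, add_mul, TensorProduct.tmul_add]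
    | hmul u v hu hv => intro h; rw [map_mul, Module.End.mul_apply, hv, hu, mul_assoc]
  rw [braid_tmul, h, mul_one]

theorem braid_gen_left (b : Idx n) (α : Idx s) (i : Idx r) (a : Idx n) :
    dotWith (fun x y => x ⊗ₜ[K] y) (leg1 r (barMat tbar)) (leg2 s tplus) b α i a =
      sgn ((par b + par α) * (par i + par a)) •
        ((barMat tbar b α : Abar s n) ⊗ₜ[K] (tplus i a : Aq r n)) := by
  rw [dotWith, Finset.sum_eq_single α, Finset.sum_eq_single i]
  · rw [leg1, leg2, if_pos rfl, if_pos rfl]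
    congr 1
    refine sgn_congr ?_
    generalize par a = a, par b = b, par α = α, par i = i
    revert a b α i
    decide
  · intro l _ hl
    rw [leg1, if_neg (Ne.symm hl), TensorProduct.zero_tmul, smul_zero]
  · simp
  · intro j _ hj
    refine Finset.sum_eq_zero fun l _ => ?_
    rw [leg2, if_neg hj, TensorProduct.tmul_zero, smul_zero]
  · simp

theorem braid_gen_right (b : Idx n) (α : Idx s) (i : Idx r) (a : Idx n) :
    dotWith (fun x y => x ⊗ₜ[K] y) (leg2 n tplus ⋆ scal (Aq r n) (Sinv n))
        (leg1 n (barMat tbar)) b α i a =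
      ∑ d, ∑ l, (sgn ((par b + par d) * (par d + par α) + (par i + par l) * (par l + par a)) *
        Sinv n b d l a) • ((tplus i l : Aq r n) ⊗ₜ[K] (barMat tbar d α : Abar s n)) := by
  rw [dotWith]
  refine Finset.sum_congr rfl fun d _ => ?_
  rw [Finset.sum_eq_single a]
  · rw [leg1, if_pos rfl, dot_apply, Finset.sum_eq_single b]
    · rw [TensorProduct.sum_tmul, Finset.smul_sum]
      refine Finset.sum_congr rfl fun l _ => ?_
      rw [leg2, if_pos rfl, scal, ← Algebra.commutes, ← Algebra.smul_def, smul_smul,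
        ← TensorProduct.smul_tmul', smul_smul, ← mul_assoc, ← sgn_add]
      congr 2
      refine sgn_congr ?_
      generalize par a = a, par b = b, par d = d, par α = α, par i = i, par l = l
      revert a b d α i l
      decide
    · intro j _ hj
      refine Finset.sum_eq_zero fun l _ => ?_
      rw [leg2, if_neg (Ne.symm hj), zero_mul, smul_zero]
    · simp
  · intro l _ hl
    rw [leg1, if_neg hl, TensorProduct.tmul_zero, smul_zero]
  · simp

/-- Compatibility with products in Ā holds because `braidAct` is a homomorphism. For products in A,
write xy ⊗ 1 as the right action of y on x ⊗ 1 and use that the two actions commute. -/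
theorem isBraiding_braid (r s n : ℕ) : IsBraiding r s n (braid r s n) where
  one_left := braid_one_left
  one_right := braid_one_right
  gen b α i a := by
    rw [braid_gen_left, braid_gen_right]
    by_cases hi : 0 < i.1
    · simp only [tplus, if_pos hi]
      rw [map_smul, braid_tbar, Finset.smul_sum]
      refine Finset.sum_congr rfl fun d _ => ?_
      rw [nuHom_apply hi, map_sum, TensorProduct.sum_tmul, Finset.smul_sum]
      refine Finset.sum_congr rfl fun l _ => ?_
      rw [map_smul, twist_of_mem _ _ (t_mem i l), smul_smul, ← TensorProduct.smul_tmul', smul_smul,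
        nuMat]
      by_cases h : par b + par d + par l + par a = 0
      · congr 1
        rw [← mul_assoc (sgn ((par i + par l) * par d)), mul_right_comm, ← mul_assoc, ← sgn_add,
          ← sgn_add, ← sgn_add]
        congr 1
        refine sgn_congr ?_
        rw [show par b = par d + par l + par a by
          linear_combination h - add_self_two (par d + par l + par a)]
        generalize par a = a, par d = d, par α = α, par i = i, par l = l
        revert a d α i l
        decide
      · rw [evenScal_Sinv n b d l a h]
        simp
    · simp [tplus, if_neg hi]
  mul_right := by
    refine TensorProduct.ext_threefold' fun g x y => ?_
    change braid r s n (g ⊗ₜ (x * y)) = rightAct (braid r s n) y (braid r s n (g ⊗ₜ x))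
    rw [braid_tmul, braid_tmul, ← braidAct_rightAct, rightAct_tmul, braid_one_left,
      Algebra.TensorProduct.tmul_mul_tmul, one_mul]
  mul_left := by
    refine TensorProduct.ext_threefold fun g h x => ?_
    change braid r s n ((g * h) ⊗ₜ x) = leftAct (braid r s n) g (braid r s n (h ⊗ₜ x))
    rw [leftAct_braid, braid_tmul, braid_tmul, map_mul, Module.End.mul_apply]

/-- Moving a generator T̄ past an element of A yields only generators T̄ on the right, so
compatibility with products in A determines Υ on T̄ ⊗ A from its values on T̄ ⊗ T₊. Compatibility
with products in Ā does the rest. -/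
theorem IsBraiding.eq {Υ : Abar s n ⊗[K] Aq r n →ₗ[K] Oq r s n} (h : IsBraiding r s n Υ) :
    Υ = braid r s n := by
  have hb := isBraiding_braid r s n
  have hgen : ∀ (x : Aq r n) (b : Idx n) (α : Idx s),
      Υ (barMat tbar b α ⊗ₜ x) = braid r s n (barMat tbar b α ⊗ₜ x) := by
    intro x
    induction x using aq_induction_pos with
    | hgen i a hi =>
      intro b α
      have e := (h.gen b α i a).trans (hb.gen b α i a).symm
      rw [braid_gen_left, map_smul, map_smul, tplus, if_pos hi] at e
      exact smul_right_injective _ (sgn_ne_zero _) e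
    | hmap c =>
      intro b α
      rw [Algebra.algebraMap_eq_smul_one, TensorProduct.tmul_smul, map_smul, map_smul, h.one_right,
        hb.one_right]
    | hadd u v hu hv => intro b α; rw [TensorProduct.tmul_add, map_add, map_add, hu, hv]
    | hmul u v hu hv =>
      intro b α
      rw [h.mul_right_apply, hb.mul_right_apply, hu, braid_tbar, map_sum, map_sum]
      exact Finset.sum_congr rfl fun d _ => by rw [rightAct_tmul, rightAct_tmul, hv]
  refine TensorProduct.ext' fun g x => ?_
  induction g using abar_induction generalizing x with
  | hgen b α => exact hgen x b α
  | hmap c =>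
    rw [Algebra.algebraMap_eq_smul_one, ← TensorProduct.smul_tmul', map_smul, map_smul, h.one_left,
      hb.one_left]
  | hadd u v hu hv => rw [TensorProduct.add_tmul, map_add, map_add, hu, hv]
  | hmul u v hu hv =>
    have e : leftAct Υ u = leftAct (braid r s n) u :=
      TensorProduct.ext' fun y k => by rw [leftAct_tmul, leftAct_tmul, hu]
    rw [h.mul_left_apply, hb.mul_left_apply, hv, e]

theorem twist₂_braidAct (g : Abar s n) (z : Oq r s n) :
    twist₂ (gradeA r n) (gradeAbar s n) 1 (braidAct r s n g z) =
      braidAct r s n (twist (gradeAbar s n) 1 g)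
        (twist₂ (gradeA r n) (gradeAbar s n) 1 z) := by
  induction g using abar_induction generalizing z with
  | hgen b α =>
    induction z using TensorProduct.induction_on with
    | zero => simp
    | add z w hz hw => simp only [map_add, hz, hw]
    | tmul x k =>
      rw [braidAct_tbar, map_sum, twist_of_mem _ 1 (barMat_tbar_mem b α), map_smul,
        LinearMap.smul_apply, TensorProduct.map_tmul, braidAct_tbar, Finset.smul_sum]
      refine Finset.sum_congr rfl fun d _ => ?_
      rw [TensorProduct.map_tmul, twist_mul, twist_of_mem _ 1 (barMat_tbar_mem d α), twist_twist,
        add_comm 1 (par α), ← twist_twist, nuHom_even, map_smul, smul_mul_assoc,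
        ← TensorProduct.smul_tmul', TensorProduct.tmul_smul, smul_smul, ← sgn_add]
      congr 1
      refine sgn_congr ?_
      linear_combination add_self_two (par d)
  | hmap c =>
    rw [Algebra.algebraMap_eq_smul_one, map_smul (twist (gradeAbar s n) 1), twist_one]
    simp only [map_smul, map_one, LinearMap.smul_apply, Module.End.one_apply]
  | hadd u v hu hv => simp only [map_add, LinearMap.add_apply, hu, hv]
  | hmul u v hu hv => simp only [map_mul, twist_mul, Module.End.mul_apply, hu, hv]

theorem braid_twist₂ (z : Abar s n ⊗[K] Aq r n) :
    braid r s n (twist₂ (gradeAbar s n) (gradeA r n) 1 z) =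
      twist₂ (gradeA r n) (gradeAbar s n) 1 (braid r s n z) := by
  induction z using TensorProduct.induction_on with
  | zero => simp
  | add z w hz hw => simp only [map_add, hz, hw]
  | tmul g x =>
    rw [TensorProduct.map_tmul, braid_tmul, braid_tmul, twist₂_braidAct, TensorProduct.map_tmul,
      twist_one]

end Braiding

/-! ### The braided product -/

section BraidedProduct

variable {r s n : ℕ}

theorem braidedMul_braid_tmul (x : Aq r n) (g : Abar s n) (z : Oq r s n) :
    braidedMul (braid r s n) (x ⊗ₜ g) z = (x ⊗ₜ 1) * braidAct r s n g z := by
  induction z using TensorProduct.induction_on with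
  | zero => simp
  | add z w hz hw => simp only [mul_add, map_add, hz, hw]
  | tmul y h =>
    rw [braidAct_apply]
    simp only [braidedMul, TensorProduct.curry_apply, LinearMap.comp_apply, LinearEquiv.coe_coe,
      TensorProduct.assoc_tmul, LinearMap.lTensor_tmul, TensorProduct.assoc_symm_tmul,
      LinearMap.rTensor_tmul]
    generalize braid r s n (g ⊗ₜ y) = w
    induction w using TensorProduct.induction_on with
    | zero => simp
    | add z w hz hw =>
      simp only [TensorProduct.add_tmul, TensorProduct.tmul_add, map_add, hz, hw, add_mul, mul_add]
    | tmul x k => simp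

theorem braidedMul_braid_right (w : Oq r s n) (y : Aq r n) (h : Abar s n) :
    braidedMul (braid r s n) w (y ⊗ₜ h) = rightAct (braid r s n) y w * (1 ⊗ₜ h) := by
  induction w using TensorProduct.induction_on with
  | zero => simp
  | add z w hz hw => simp only [add_mul, map_add, LinearMap.add_apply, hz, hw]
  | tmul x g => rw [braidedMul_braid_tmul, rightAct_tmul, braidAct_apply, mul_assoc]

theorem twist₂_mul (d : ZMod 2) (z w : Oq r s n) :
    twist₂ (gradeA r n) (gradeAbar s n) d (z * w) =
      twist₂ (gradeA r n) (gradeAbar s n) d z * twist₂ (gradeA r n) (gradeAbar s n) d w := by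
  induction z using TensorProduct.induction_on with
  | zero => simp
  | add z z' hz hz' => simp only [add_mul, map_add, hz, hz']
  | tmul x g =>
    induction w using TensorProduct.induction_on with
    | zero => simp
    | add z w hz hw => simp only [mul_add, map_add, hz, hw]
    | tmul y h =>
      simp only [Algebra.TensorProduct.tmul_mul_tmul, TensorProduct.map_tmul, twist_mul]

theorem twist₂_braidedMul (z w : Oq r s n) :
    twist₂ (gradeA r n) (gradeAbar s n) 1 (braidedMul (braid r s n) z w) =
      braidedMul (braid r s n) (twist₂ (gradeA r n) (gradeAbar s n) 1 z)
        (twist₂ (gradeA r n) (gradeAbar s n) 1 w) := by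
  induction z using TensorProduct.induction_on with
  | zero => simp
  | add z z' hz hz' => simp only [map_add, LinearMap.add_apply, hz, hz']
  | tmul x g =>
    rw [braidedMul_braid_tmul, twist₂_mul, twist₂_braidAct, TensorProduct.map_tmul,
      TensorProduct.map_tmul, twist_one, braidedMul_braid_tmul]

/-- Left multiplication by x ⊗ g is `braidAct` of g followed by multiplication by x on the left
factor; right multiplication by z ⊗ k is `rightAct` of z followed by multiplication by k on the
right factor. Associativity says that these operators commute. -/
theorem isSuperalgebra_braid (r s n : ℕ) :
    IsSuperalgebra (gradeO r s n) (braidedMul (braid r s n))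
      ((1 : Aq r n) ⊗ₜ (1 : Abar s n)) where
  isInternal := (parity_tensor _ _).isInternal
  one_mem := by
    rw [(parity_tensor _ _).mem_iff, TensorProduct.map_tmul, twist_one, twist_one, sgn_zero,
      one_smul]
  mul_mem {d e x y} hx hy := by
    have h := parity_tensor (gradeA r n) (gradeAbar s n)
    rw [h.mem_iff] at hx hy ⊢
    rw [twist₂_braidedMul, hx, hy, map_smul, map_smul, LinearMap.smul_apply, smul_smul, sgn_add,
      mul_comm]
  one_mul z := by
    rw [braidedMul_braid_tmul, map_one, Module.End.one_apply, ← Algebra.TensorProduct.one_def,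
      one_mul]
  mul_one z := by
    induction z using TensorProduct.induction_on with
    | zero => simp
    | add z z' hz hz' => simp only [map_add, LinearMap.add_apply, hz, hz']
    | tmul x g =>
      rw [braidedMul_braid_tmul, ← braid_tmul, braid_one_right,
        Algebra.TensorProduct.tmul_mul_tmul, mul_one, one_mul]
  mul_assoc x y z := by
    induction x using TensorProduct.induction_on with
    | zero => simp
    | add z z' hz hz' => simp only [map_add, LinearMap.add_apply, hz, hz']
    | tmul x g =>
      induction z using TensorProduct.induction_on with
      | zero => simp
      | add z z' hz hz' => simp only [map_add, hz, hz']
      | tmul z k =>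
        -- The symbol `*` on the tensor product is the ordinary componentwise multiplication; only
        -- one-sided factors x ⊗ 1 and 1 ⊗ k are ever multiplied by it.
        rw [braidedMul_braid_right, braidedMul_braid_right, braidedMul_braid_tmul,
          braidedMul_braid_tmul, rightAct_mul_left, braidAct_mul_right, braidAct_rightAct,
          mul_assoc]

end BraidedProduct

/-! ### Equivariance -/

section Equivariance

variable {r s n N : ℕ} {U : Type} [Ring U] [Algebra K U] {gU : ZMod 2 → Submodule K U}
  [GradedAlgebra gU] {C : MatCoalg gU N}
  {f : Aq r n →ₐ[K] Matrix (Idx N) (Idx N) (Aq r n)}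
  {g : Abar s n →ₐ[K] Matrix (Idx N) (Idx N) (Abar s n)}

/-- `x ⊗ y ↦ ∑_c f(x)_{ac} ⊗ g(y)_{cb}`. -/
def tensorEntry {X Y : Type} [Ring X] [Algebra K X] [Ring Y] [Algebra K Y]
    (f : X →ₐ[K] Matrix (Idx N) (Idx N) X) (g : Y →ₐ[K] Matrix (Idx N) (Idx N) Y) (a b : Idx N) :
    X ⊗[K] Y →ₗ[K] X ⊗[K] Y :=
  ∑ c, TensorProduct.map (Matrix.entryLinearMap K X a c ∘ₗ f.toLinearMap)
    (Matrix.entryLinearMap K Y c b ∘ₗ g.toLinearMap)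

theorem tensorEntry_tmul {X Y : Type} [Ring X] [Algebra K X] [Ring Y] [Algebra K Y]
    (f : X →ₐ[K] Matrix (Idx N) (Idx N) X) (g : Y →ₐ[K] Matrix (Idx N) (Idx N) Y) (a b : Idx N)
    (x : X) (y : Y) : tensorEntry f g a b (x ⊗ₜ y) = ∑ c, f x a c ⊗ₜ g y c b := by
  simp only [tensorEntry, LinearMap.sum_apply]
  rfl

theorem tensorActHom_eq_tensorEntry {X Y : Type} [Ring X] [Algebra K X] [Ring Y] [Algebra K Y]
    {gX : ZMod 2 → Submodule K X} [GradedAlgebra gX] {gY : ZMod 2 → Submodule K Y}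
    [GradedAlgebra gY] {f : X →ₐ[K] Matrix (Idx N) (Idx N) X}
    {g : Y →ₐ[K] Matrix (Idx N) (Idx N) Y} {ρ : U →ₐ[K] Module.End K X}
    {σ : U →ₐ[K] Module.End K Y} (hρ : IsMatAct C gX ρ f) (hσ : IsMatAct C gY σ g)
    (a b : Idx N) (z : X ⊗[K] Y) :
    tensorActHom C hρ.evenAct σ (C.gen a b) (twist₂ gX gY (par b) z) =
      tensorEntry f g a b z := by
  rw [tensorActHom_gen, tensorEntry, LinearMap.sum_apply]
  refine Finset.sum_congr rfl fun c _ => ?_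
  congr 2
  · ext x
    exact hρ.act a c x
  · ext y
    exact hσ.act c b y

/-- The compatibility of the braiding with a pair of actions, on generators. -/
def BraidCompatible (f : Aq r n →ₐ[K] Matrix (Idx N) (Idx N) (Aq r n))
    (g : Abar s n →ₐ[K] Matrix (Idx N) (Idx N) (Abar s n)) : Prop :=
  ∀ (e : Idx n) (α : Idx s) (a b : Idx N) (x : Aq r n),
    tensorEntry f g a b (braid r s n (barMat tbar e α ⊗ₜ x)) =
      ∑ c, braid r s n (g (barMat tbar e α) a c ⊗ₜ f x c b)

theorem tensorEntry_mul_right (a b : Idx N) (z : Oq r s n) (h : Abar s n) :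
    tensorEntry f g a b (z * (1 ⊗ₜ h)) = ∑ c, tensorEntry f g a c z * (1 ⊗ₜ g h c b) := by
  induction z using TensorProduct.induction_on with
  | zero => simp
  | add z z' hz hz' => simp only [add_mul, map_add, hz, hz', Finset.sum_add_distrib]
  | tmul x k =>
    simp only [Algebra.TensorProduct.tmul_mul_tmul, mul_one, tensorEntry_tmul, map_mul,
      Matrix.mul_apply, TensorProduct.tmul_sum, Finset.sum_mul]
    exact Finset.sum_comm

theorem tensorEntry_mul_left (a b : Idx N) (z : Oq r s n) (x : Aq r n) :
    tensorEntry f g a b ((x ⊗ₜ 1) * z) = ∑ c, (f x a c ⊗ₜ 1) * tensorEntry f g c b z := by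
  induction z using TensorProduct.induction_on with
  | zero => simp
  | add z z' hz hz' => simp only [mul_add, map_add, hz, hz', Finset.sum_add_distrib]
  | tmul y k =>
    simp only [Algebra.TensorProduct.tmul_mul_tmul, one_mul, tensorEntry_tmul, map_mul,
      Matrix.mul_apply, TensorProduct.sum_tmul, Finset.mul_sum]
    exact Finset.sum_comm

/-- In matrix form compatibility is preserved by products in Ā, so generators T̄ suffice there. The
second argument x has to be arbitrary from the start, because T̄ is moved past elements produced by
earlier moves. -/
theorem BraidCompatible.braidAct (H : BraidCompatible f g) (a b : Idx N) (h : Abar s n)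
    (z : Oq r s n) : tensorEntry f g a b (braidAct r s n h z) =
      ∑ c, QueerBraid.braidAct r s n (g h a c) (tensorEntry f g c b z) := by
  induction h using abar_induction generalizing a b z with
  | hgen e α =>
    induction z using TensorProduct.induction_on with
    | zero => simp
    | add z z' hz hz' => simp only [map_add, hz, hz', Finset.sum_add_distrib]
    | tmul x k =>
      simp only [braidAct_apply, tensorEntry_mul_right, H e α, tensorEntry_tmul, map_sum,
        Finset.sum_mul]
      exact Finset.sum_comm
  | hmap c =>
    simp only [AlgHom.commutes, Module.algebraMap_end_apply, map_smul,
      Matrix.algebraMap_matrix_apply]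
    rw [Finset.sum_eq_single a]
    · rw [if_pos rfl, AlgHom.commutes, Module.algebraMap_end_apply]
    · intro d _ hd
      rw [if_neg (Ne.symm hd), map_zero, LinearMap.zero_apply]
    · simp
  | hadd u v hu hv =>
    simp only [map_add, LinearMap.add_apply, hu, hv, Matrix.add_apply, Finset.sum_add_distrib]
  | hmul u v hu hv =>
    simp only [map_mul, Module.End.mul_apply, hu, hv, Matrix.mul_apply, map_sum,
      LinearMap.sum_apply]
    exact Finset.sum_comm

theorem tensorEntry_tmul_one (a b : Idx N) (x : Aq r n) :
    tensorEntry f g a b (x ⊗ₜ 1) = f x a b ⊗ₜ 1 := by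
  rw [tensorEntry_tmul, Finset.sum_eq_single b]
  · rw [map_one g, Matrix.one_apply, if_pos rfl]
  · intro d _ hd
    rw [map_one g, Matrix.one_apply, if_neg hd, TensorProduct.tmul_zero]
  · simp

/-- The value of Υ at h ⊗ x is `braidAct` of h at x ⊗ 1, and the actions do not affect the factor 1.
-/
theorem BraidCompatible.braid (H : BraidCompatible f g) (a b : Idx N)
    (z : Abar s n ⊗[K] Aq r n) :
    QueerBraid.braid r s n (tensorEntry g f a b z) =
      tensorEntry f g a b (QueerBraid.braid r s n z) := by
  induction z using TensorProduct.induction_on with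
  | zero => simp
  | add z z' hz hz' => simp only [map_add, hz, hz']
  | tmul h x =>
    simp only [tensorEntry_tmul g f, map_sum, braid_tmul, H.braidAct, tensorEntry_tmul_one]

theorem BraidCompatible.braidedMul (H : BraidCompatible f g) (a b : Idx N) (z w : Oq r s n) :
    tensorEntry f g a b (braidedMul (QueerBraid.braid r s n) z w) =
      ∑ c, QueerBraid.braidedMul (QueerBraid.braid r s n) (tensorEntry f g a c z)
        (tensorEntry f g c b w) := by
  induction z using TensorProduct.induction_on with
  | zero => simp
  | add z z' hz hz' => simp only [map_add, LinearMap.add_apply, hz, hz', Finset.sum_add_distrib]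
  | tmul x h =>
    simp only [braidedMul_braid_tmul, tensorEntry_mul_left, H.braidAct, tensorEntry_tmul, map_sum,
      LinearMap.sum_apply, Finset.mul_sum]
    exact Finset.sum_comm

theorem BraidCompatible.isSupermoduleHom (H : BraidCompatible f g)
    {ρ : U →ₐ[K] Module.End K (Aq r n)} {σ : U →ₐ[K] Module.End K (Abar s n)}
    (hρ : IsMatAct C (gradeA r n) ρ f) (hσ : IsMatAct C (gradeAbar s n) σ g) :
    IsSupermoduleHom gU (gradeAbarA r s n) (gradeO r s n)
      (tensorActHom C hσ.evenAct ρ).toLinearMap (tensorActHom C hρ.evenAct σ).toLinearMap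
      (QueerBraid.braid r s n) := by
  refine isSupermoduleHom_of_gen C (parity_tensor _ _) (parity_tensor _ _)
    (tensorActHom_even C hσ.evenAct hρ.evenAct) (tensorActHom_even C hρ.evenAct hσ.evenAct)
    braid_twist₂ fun a b z => ?_
  rw [tensorActHom_eq_tensorEntry hσ hρ, tensorActHom_eq_tensorEntry hρ hσ, H.braid]

theorem BraidCompatible.isSupermoduleSuperalgebra (H : BraidCompatible f g)
    {ρ : U →ₐ[K] Module.End K (Aq r n)} {σ : U →ₐ[K] Module.End K (Abar s n)}
    (hρ : IsMatAct C (gradeA r n) ρ f) (hσ : IsMatAct C (gradeAbar s n) σ g) :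
    IsSupermoduleSuperalgebra gU (gradeO r s n) C.Δ C.counitHom.toLinearMap
      (QueerBraid.braidedMul (QueerBraid.braid r s n)) (1 ⊗ₜ 1)
      (tensorActHom C hρ.evenAct σ).toLinearMap := by
  refine isSupermoduleSuperalgebra_of_gen C (isSuperalgebra_braid r s n) (parity_tensor _ _)
    (tensorActHom_even C hρ.evenAct hσ.evenAct) ?_ ?_
  · intro a b
    have h : (1 ⊗ₜ 1 : Oq r s n) =
        twist₂ (gradeA r n) (gradeAbar s n) (par b) (1 ⊗ₜ 1) := by
      rw [TensorProduct.map_tmul, twist_one, twist_one]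
    rw [h, tensorActHom_eq_tensorEntry hρ hσ, tensorEntry_tmul_one, map_one f, Matrix.one_apply,
      ← h]
    split <;> simp
  · intro a b x y
    simp only [tensorActHom_eq_tensorEntry hρ hσ, H.braidedMul]

end Equivariance

/-! ### The two actions -/

section Actions

variable {r s n : ℕ} {e : ℤˣ}

/-- The coefficient of each T̄_{xα} on the two sides is, after removing γ^{|α|} and a sign, one side
of the exchange relation between ν and φ with matrix S⁻¹. -/
theorem braidCompatible_phi : BraidCompatible (phiHom r n) (phiBarHom s n) := by
  intro i α j y z
  have hγ : ∀ (w : Aq r n) (a b : Idx n), phiHom r n (twist (gradeA r n) (par α) w) a b =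
      sgn (par α * (par a + par b)) • twist (gradeA r n) (par α) (phiHom r n w a b) := by
    intro w a b
    rw [phiHom_even, smul_smul, sgn_mul_self, one_smul]
  have h := nuHom_phiHom_mix.exchange (evenScal_Sinv n) nuHom_even phiHom_even z i
  trans ∑ x, (sgn (par α * par j) • twist (gradeA r n) (par α)
    (∑ k, ∑ l, (sgn (par l * par x) * Sinv n k x l y) • phiHom r n (nuHom r n z i k) j l)) ⊗ₜ[K]
      (barMat tbar x α : Abar s n)
  · simp only [braid_tbar, map_sum, tensorEntry_tmul, phiBarHom_apply, hγ, map_smul,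
      TensorProduct.tmul_sum, TensorProduct.sum_tmul, Finset.smul_sum]
    rw [sum_rotate]
    refine sum_congr₃ fun x k l => ?_
    simp only [← TensorProduct.smul_tmul', TensorProduct.tmul_smul, smul_smul]
    congr 1
    rw [mul_right_comm, ← sgn_add, ← mul_assoc, ← sgn_add]
    congr 1
    refine sgn_congr ?_
    linear_combination (par l * par α) * add_self_two 1
  · simp only [← h, braid_tbar, map_sum, phiBarHom_apply, map_smul,
      TensorProduct.sum_tmul, Finset.smul_sum, ← TensorProduct.smul_tmul']
    symm
    rw [sum_rotate, sum_swap₂₃]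
    refine sum_congr₃ fun x k l => ?_
    symm
    rw [smul_smul, ← mul_assoc, ← sgn_add]
    congr 3
    ring

/-- The trivial action corresponds to x ↦ diag(γ^{|a|}x), so the action on one factor only is an
instance of the general framework. -/
theorem isMatAct_trivAct {N : ℕ} {U : Type} [Ring U] [Algebra K U] {gU : ZMod 2 → Submodule K U}
    [GradedAlgebra gU] (C : MatCoalg gU N) {X : Type} [Ring X] [Algebra K X]
    (gX : ZMod 2 → Submodule K X) [GradedAlgebra gX] :
    IsMatAct C gX (C.trivAct X) (iotaMat gX N) where
  even d x a b := by
    rw [iotaMat_apply, iotaMat_apply]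
    split
    · next h => rw [h, add_self_two, mul_zero, sgn_zero, one_smul, twist_twist, twist_twist, add_comm]
    · simp
  act a b x := by
    rw [C.trivAct_apply, C.counitHom_gen, iotaMat_apply]
    split
    · next h => rw [h, one_smul]
    · simp

/-- The braiding changes only the left index of T̄ and the action only the right one, so no
quadratic relation enters. The powers of γ and the signs agree by evenness of `psiMat`. -/
theorem braidCompatible_psi : BraidCompatible (iotaMat (gradeA r n) s) (psiHom s n e) := by
  intro i α a b x
  simp only [braid_tbar, map_sum, tensorEntry_tmul, iotaMat_apply, psiHom_apply]
  rw [Finset.sum_congr rfl fun d _ => Finset.sum_eq_single_of_mem a (Finset.mem_univ _)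
      fun c _ hc => by rw [if_neg (Ne.symm hc), TensorProduct.zero_tmul],
    Finset.sum_eq_single_of_mem b (Finset.mem_univ _)
      fun c _ hc => by rw [if_neg hc, TensorProduct.tmul_zero, map_zero]]
  simp only [if_pos, TensorProduct.tmul_sum, TensorProduct.sum_tmul, map_sum,
    ← TensorProduct.smul_tmul', TensorProduct.tmul_smul, map_smul, braid_tbar, Finset.smul_sum]
  rw [Finset.sum_comm]
  refine sum_congr₂ fun β d => ?_
  have hν : nuHom r n (twist (gradeA r n) (par b) x) i d = sgn (par b * (par i + par d)) •
      twist (gradeA r n) (par b) (nuHom r n x i d) := by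
    rw [nuHom_even, smul_smul, sgn_mul_self, one_smul]
  rw [hν, map_smul, twist_twist, twist_twist, ← TensorProduct.smul_tmul', smul_smul]
  by_cases h : par β + par α + par a + par b = 0
  · rw [mul_right_comm, ← sgn_add, show par a + par α = par β + par b by
      linear_combination h - add_self_two (par β + par b)]
    congr 3
    linear_combination (-(par i * par b)) * add_self_two 1
  · rw [evenScal_psiMat s e β α a b h]
    simp

end Actions

end QueerBraid
end

theorem proposition3 (r s n : ℕ) (e : ℤˣ) :
    (∃! Φ : Uq n →ₗ[K] Module.End K (Aq r n), IsPhi r n Φ) ∧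
    (∃! Φbar : Uq n →ₗ[K] Module.End K (Abar s n), IsPhiBar s n Φbar) ∧
    (∃! Ψbar : Uq s →ₗ[K] Module.End K (Abar s n), IsPsiBar s n e Ψbar) ∧
    (∃! Υ : Abar s n ⊗[K] Aq r n →ₗ[K] Oq r s n, IsBraiding r s n Υ) ∧
    ∀ (Φ : Uq n →ₗ[K] Module.End K (Aq r n)) (Φbar : Uq n →ₗ[K] Module.End K (Abar s n))
      (Ψbar : Uq s →ₗ[K] Module.End K (Abar s n)) (Υ : Abar s n ⊗[K] Aq r n →ₗ[K] Oq r s n),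
      IsPhi r n Φ → IsPhiBar s n Φbar → IsPsiBar s n e Ψbar → IsBraiding r s n Υ →
        IsSupermoduleHom (gradeU n) (gradeAbarA r s n) (gradeO r s n)
          (tensorAct (gradeU n) (gradeAbar s n) (comul n) Φbar Φ)
          (tensorAct (gradeU n) (gradeA r n) (comul n) Φ Φbar) Υ ∧
        IsSupermoduleHom (gradeU s) (gradeAbarA r s n) (gradeO r s n)
          (actFirst Ψbar) (actSecond (gradeU s) (gradeA r n) Ψbar) Υ ∧
        IsSupermoduleSuperalgebra (gradeU n) (gradeO r s n) (comul n) (counit n)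
          (braidedMul Υ) (1 ⊗ₜ 1) (tensorAct (gradeU n) (gradeA r n) (comul n) Φ Φbar) ∧
        IsSupermoduleSuperalgebra (gradeU s) (gradeO r s n) (superFlip (gradeU s) ∘ₗ comul s)
          (counit s) (braidedMul Υ) (1 ⊗ₜ 1) (actSecond (gradeU s) (gradeA r n) Ψbar) := by
  refine ⟨⟨_, isPhi_phiAct, fun _ h => h.eq⟩, ⟨_, isPhiBar_phiBarAct, fun _ h => h.eq⟩,
    ⟨_, isPsiBar_psiAct, fun _ h => h.eq⟩, ⟨_, isBraiding_braid r s n, fun _ h => h.eq⟩, ?_⟩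
  intro Φ Φbar Ψbar Υ hΦ hΦbar hΨbar hΥ
  -- By uniqueness the given maps are the constructed ones.
  rw [hΦ.eq, hΦbar.eq, hΨbar.eq, hΥ.eq]
  -- The algebra A carries the trivial action of U_q(𝔮_s), which turns `actFirst` and `actSecond`
  -- into tensor product actions.
  have hι := isMatAct_trivAct (coalgUcop s) (gradeA r n)
  refine ⟨braidCompatible_phi.isSupermoduleHom isMatAct_phiAct isMatAct_phiBarAct, ?_,
    braidCompatible_phi.isSupermoduleSuperalgebra isMatAct_phiAct isMatAct_phiBarAct, ?_⟩
  · have h := braidCompatible_psi.isSupermoduleHom hι (isMatAct_psiAct (n := n) (e := e))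
    rwa [tensorActHom_triv_left, tensorActHom_triv_right] at h
  · have h := braidCompatible_psi.isSupermoduleSuperalgebra hι (isMatAct_psiAct (n := n) (e := e))
    rwa [tensorActHom_triv_left, coalgUcop_Δ] at h
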